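/- Let $\mathbb H=\mathbb C\times\mathbb R=\mathbb R^3$ be the Heisenberg group with group law $(z,t)*(z',t')=(z+z',\,t+t'+2\,\mathrm{Im}(\overline z z'))$, gauge $\|(z,t)\|=(|z|^4+t^2)^{1/4}$, and Koranyi inversion $\iota(z,t)=\left(\frac{-z}{|z|^2+\mathrm{i}t},\frac{-t}{|z|^4+t^2}\right)$ for $(z,t)\neq 0$. Let $\mathbb H(\mathbb Z)=\mathbb Z[\mathrm i]\times\mathbb Z$ be the subgroup of integer points and let $\lambda$ be Lebesgue measure on $\mathbb R^3$. A fundamental domain for $\mathbb H(\mathbb Z)$ is a connected set $K\subset\mathbb H$ whose boundary is piecewise smooth (a finite union of images of closed squares under smooth maps), such that $\bigcup_{g\in\mathbb H(\mathbb Z)}g*K=\mathbb H$ and such that $K\cap(g*K)\neq\emptyset$ with $g\in\mathbb H(\mathbb Z)$ implies $g=0$. For $h\in\mathbb H$ let $[h]$ be the unique $g\in\mathbb H(\mathbb Z)$ with $h\in g*K$, and let $\mathrm{rad}(K)=\sup_{h\in K}\|h\|$. Theorem. Let $K$ be a fundamental domain for $\mathbb H(\mathbb Z)$ with $\mathrm{rad}(K)<1$,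 and let $T:K\to K$, $T(h)=[\iota h]^{-1}*\iota h$, be the associated Gauss map (its value at the origin is irrelevant; set $T(0)=0$). Then there is a finite $T$-invariant measure $\lambda_T$ on the Lebesgue measurable subsets of $K$ that is equivalent to $\lambda|_K$ (each is absolutely continuous with respect to the other), and $T$ is ergodic: every Lebesgue measurable $E\subset K$ with $T^{-1}E=E$ satisfies $\lambda_T(E)=0$ or $\lambda_T(K\setminus E)=0$. -/

import Mathlib

open MeasureTheory Set
open scoped ENNReal ContDiff

noncomputable section

/-- The Heisenberg group in its geometric model: the space `ℂ × ℝ = ℝ³`, whose points are written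
`(z, t)`. The group law below is not the one of the product. -/
def Heis : Type := ℂ × ℝ

namespace Heis

instance : TopologicalSpace Heis := inferInstanceAs (TopologicalSpace (ℂ × ℝ))

/-- `Heis` carries the Lebesgue measure of `ℂ × ℝ = ℝ³`. -/
instance : MeasureSpace Heis := inferInstanceAs (MeasureSpace (ℂ × ℝ))

instance : BorelSpace Heis := inferInstanceAs (BorelSpace (ℂ × ℝ))

/-- The point `(z, t)`. -/
def mk (z : ℂ) (t : ℝ) : Heis := (z, t)

/-- The coordinate `z` of `(z, t)`. -/
def z (h : Heis) : ℂ := Prod.fst h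

/-- The coordinate `t` of `(z, t)`. -/
def t (h : Heis) : ℝ := Prod.snd h

@[simp] theorem z_mk (z : ℂ) (t : ℝ) : (mk z t).z = z := rfl

@[simp] theorem t_mk (z : ℂ) (t : ℝ) : (mk z t).t = t := rfl

theorem ext' {h k : Heis} (hz : h.z = k.z) (ht : h.t = k.t) : h = k := Prod.ext hz ht

instance : One Heis := ⟨mk 0 0⟩

/-- `(z, t) * (z', t') = (z + z', t + t' + 2 Im (conj z * z'))`. -/
instance : Mul Heis :=
  ⟨fun h k => mk (h.z + k.z) (h.t + k.t + 2 * (starRingEnd ℂ h.z * k.z).im)⟩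

instance : Inv Heis := ⟨fun h => mk (-h.z) (-h.t)⟩

@[simp] theorem one_z : (1 : Heis).z = 0 := rfl

@[simp] theorem one_t : (1 : Heis).t = 0 := rfl

@[simp] theorem mul_z (h k : Heis) : (h * k).z = h.z + k.z := rfl

@[simp] theorem mul_t (h k : Heis) :
    (h * k).t = h.t + k.t + 2 * (starRingEnd ℂ h.z * k.z).im := rfl

@[simp] theorem inv_z (h : Heis) : (h⁻¹).z = -h.z := rfl

@[simp] theorem inv_t (h : Heis) : (h⁻¹).t = -h.t := rfl

instance : Group Heis :=
  Group.ofLeftAxioms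
    (fun a b c => ext' (by simp [add_assoc]) (by simp; ring))
    (fun a => ext' (by simp) (by simp))
    (fun a => ext' (by simp) (by simp; ring))

/-- The gauge (Koranyi norm) `‖(z, t)‖ = (|z|⁴ + t²)^(1/4)`. -/
def gauge (h : Heis) : ℝ := (‖h.z‖ ^ 4 + h.t ^ 2) ^ (1 / 4 : ℝ)

/-- The radius of a set: the supremum of the gauges of its points (`∞` if it is unbounded). -/
def rad (A : Set Heis) : ℝ≥0∞ := ⨆ h ∈ A, ENNReal.ofReal h.gauge

/-- The Koranyi inversion `ι (z, t) = (-z / (|z|² + i t), -t / (|z|⁴ + t²))`. It is meaningful away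
from the origin; the conventions for division by zero send the origin to itself. -/
def inversion (h : Heis) : Heis :=
  mk (-h.z / ((‖h.z‖ ^ 2 : ℝ) + Complex.I * (h.t : ℂ))) (-h.t / (‖h.z‖ ^ 4 + h.t ^ 2))

/-- The Heisenberg integers: the points all of whose (real) coordinates are integers. -/
def integers : Subgroup Heis where
  carrier := {h | ∃ a b c : ℤ, h = mk ⟨a, b⟩ c}
  one_mem' := ⟨0, 0, 0, ext' (by apply Complex.ext <;> simp) (by simp)⟩
  mul_mem' := by
    rintro _ _ ⟨a, b, c, rfl⟩ ⟨a', b', c', rfl⟩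
    refine ⟨a + a', b + b', c + c' + 2 * (a * b' - b * a'), ext' ?_ ?_⟩
    · apply Complex.ext <;> simp
    · simp
      ring
  inv_mem' := by
    rintro _ ⟨a, b, c, rfl⟩
    exact ⟨-a, -b, -c, ext' (by apply Complex.ext <;> simp) (by simp)⟩

/-- The boundary of `K` is piecewise smooth: it is a finite union of smooth surface patches, each
the image of a closed square under a smooth map into `ℂ × ℝ = ℝ³`. -/
def HasPiecewiseSmoothBoundary (K : Set Heis) : Prop :=
  ∃ (n : ℕ) (f : Fin n → ℝ × ℝ → ℂ × ℝ), (∀ i, ContDiff ℝ ∞ (f i)) ∧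
    frontier K = ⋃ i, {h : Heis | ∃ p ∈ Icc (0 : ℝ) 1 ×ˢ Icc (0 : ℝ) 1, f i p = (h.z, h.t)}

/-- A fundamental domain for the Heisenberg integers: a connected set with piecewise smooth
boundary whose left translates by the Heisenberg integers tile the Heisenberg group without any
overlap (not even along the boundary). -/
structure IsFundamentalDomain (K : Set Heis) : Prop where
  connected : IsConnected K
  boundary : HasPiecewiseSmoothBoundary K
  cover : ⋃ g ∈ integers, (fun h => g * h) '' K = univ
  disjoint : ∀ g ∈ integers, (K ∩ (fun h => g * h) '' K).Nonempty → g = 1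

variable {K : Set Heis}

theorem IsFundamentalDomain.exists_floor (hK : IsFundamentalDomain K) (h : Heis) :
    ∃ g ∈ integers, h ∈ (fun k => g * k) '' K := by
  have hh : h ∈ ⋃ g ∈ integers, (fun k => g * k) '' K := hK.cover ▸ mem_univ h
  simpa only [mem_iUnion, exists_prop] using hh

/-- The nearest-integer map `[·]` of a fundamental domain `K`: `[h]` is the Heisenberg integer `g`
with `h ∈ g K`. -/
def floor (hK : IsFundamentalDomain K) (h : Heis) : Heis := (hK.exists_floor h).choose

theorem floor_spec (hK : IsFundamentalDomain K) (h : Heis) :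
    floor hK h ∈ integers ∧ h ∈ (fun k => floor hK h * k) '' K :=
  (hK.exists_floor h).choose_spec

/-- The integer `g` with `h ∈ g K` is unique. -/
theorem floor_eq (hK : IsFundamentalDomain K) {h g : Heis} (hg : g ∈ integers)
    (hh : h ∈ (fun k => g * k) '' K) : floor hK h = g := by
  obtain ⟨hf, a, ha, e⟩ := floor_spec hK h
  obtain ⟨b, hb, e'⟩ := hh
  have e'' : floor hK h * a = g * b := e.trans e'.symm
  have h1 := hK.disjoint (g⁻¹ * floor hK h) (mul_mem (inv_mem hg) hf)
    ⟨b, hb, a, ha, by simp only [mul_assoc, e'', inv_mul_cancel_left]⟩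
  exact (inv_mul_eq_one.mp h1).symm

theorem floor_inv_mul_mem (hK : IsFundamentalDomain K) (h : Heis) : (floor hK h)⁻¹ * h ∈ K := by
  obtain ⟨-, k, hk, e⟩ := floor_spec hK h
  have e' : floor hK h * k = h := e
  rwa [← e', ← floor_eq hK (floor_spec hK h).1 ⟨k, hk, e⟩, e', inv_mul_eq_iff_eq_mul.mpr e'.symm]

/-- The Heisenberg Gauss map `T : K → K`, `T h = [ι h]⁻¹ * ι h`. It is meaningful away from the
origin, a single point of measure zero, where the value is a convention. -/
def gaussMap (hK : IsFundamentalDomain K) (h : K) : K :=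
  ⟨(floor hK (inversion h))⁻¹ * inversion h, floor_inv_mul_mem hK (inversion h)⟩

end Heis

end

/-! A point `h` lifts to a null vector `X h` of a Hermitian form on `ℂ³`; the inversion and the
integer translations become linear maps that preserve the form and the lattice of Gaussian integer
vectors. The factor `den A h` by which `A` rescales a lift is a cocycle. It governs distances, `kd
(act A h) (act A k) ^ 2 * (‖den A h‖ * ‖den A k‖) = kd h k ^ 2` (`kd_act`), and volumes, since the
Jacobian is `(‖den A h‖ ^ 4)⁻¹`. Hence the measure `dx dy / kd x y ^ 8` on pairs of points is
invariant under the diagonal action.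

Along a word of `n` digits `den` is at most `(r ^ 2) ^ n`, so the Gauss map expands. A companion
point at distance at least `sep r` from the orbit stays that far away (`sep_le_kd_act`), which gives
bounded distortion (`den_le_distortion`). As the modular group is discrete (`finite_moderate`), a
pair of points is reached by boundedly many words of a given size (`exists_encard_words_le`).
Pushing pairs forward along these words shows that orbits hit a set `N` at a given scale with
probability `O(volume N)` (`exists_volume_hitting_le`). This bound needs no invariant measure.

The obstacle is that an inverse branch may be defined on only a part of `K`. The hitting bound,
applied to neighbourhoods of the boundary (of volume `O(ρ)`) and of the origin, shows that at every
small scale half of the points lie on inverse branches defined on a ball of fixed radius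
(`exists_volume_fine_ge`, `mem_orb_of_isFine`). Continuing such a word by a full word whose branch
lies in that ball makes it full. So full branches are needed in every open set (`exists_isFull`). It
suffices to find an orbit that avoids the boundary and ends at the origin, because a large further
digit is full and its branch lies near the origin. Rational points reach the origin by a Euclidean
algorithm, but their orbits may meet the boundary. They are perturbed by far integer points that
finitely many group elements do not send to the boundary, and these exist by a determinant method
for smooth surfaces (`exists_integer_point_off_surfaces`). The result is a definite proportion of
full branches at arbitrarily small scales (`exists_many_full`).

The invariant measure is the first marginal of the invariant pair measure, restricted to pairs with
pasts of all orders. Its invariance follows from one inequality, for a set and its complement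
(`gaussMeasure_gaussPreimage`). The many full branches bound its density below
(`exists_le_gaussMeasure`). They also make the set of points in arbitrarily deep full branches have
positive volume (`volume_recurrent_pos`). By distortion, an invariant set of positive volume
contains almost all of these points (`volume_recurrent_diff_eq_zero`), so an invariant set and its
complement cannot both have positive volume. -/

open MeasureTheory Set
open scoped ENNReal ContDiff

noncomputable section

namespace Heis

section

/-! ### The gauge, the projective model and the distance -/

/-- The complex coordinate `|z|² + i t`. -/
def u (h : Heis) : ℂ := ⟨‖h.z‖ ^ 2, h.t⟩

@[simp] theorem u_re (h : Heis) : (u h).re = ‖h.z‖ ^ 2 := rfl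

@[simp] theorem u_im (h : Heis) : (u h).im = h.t := rfl

theorem norm_sq_eq (c : ℂ) : ‖c‖ ^ 2 = c.re * c.re + c.im * c.im := by
  rw [← Complex.normSq_eq_norm_sq, Complex.normSq_apply]

theorem norm_u_sq (h : Heis) : ‖u h‖ ^ 2 = ‖h.z‖ ^ 4 + h.t ^ 2 := by
  rw [← Complex.normSq_eq_norm_sq, Complex.normSq_apply]; simp; ring

theorem gauge_nonneg (h : Heis) : 0 ≤ gauge h := by unfold gauge; positivity

theorem gauge_sq (h : Heis) : gauge h ^ 2 = ‖u h‖ := by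
  have h1 : (0 : ℝ) ≤ ‖h.z‖ ^ 4 + h.t ^ 2 := by positivity
  have h2 : (gauge h ^ 2) ^ 2 = ‖u h‖ ^ 2 := by
    rw [norm_u_sq, ← pow_mul, gauge, ← Real.rpow_natCast, ← Real.rpow_mul h1]; norm_num
  exact (pow_left_inj₀ (by positivity) (norm_nonneg _) two_ne_zero).mp h2

theorem norm_z_le (h : Heis) : ‖h.z‖ ≤ gauge h := by
  have h1 : ‖h.z‖ ^ 2 ≤ gauge h ^ 2 := by
    rw [gauge_sq]; simpa using (le_abs_self _).trans (Complex.abs_re_le_norm (u h))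
  exact (pow_le_pow_iff_left₀ (norm_nonneg _) (gauge_nonneg h) two_ne_zero).mp h1

theorem abs_t_le (h : Heis) : |h.t| ≤ gauge h ^ 2 := by
  rw [gauge_sq]; simpa using Complex.abs_im_le_norm (u h)

theorem u_eq_zero {h : Heis} : u h = 0 ↔ h = 1 := by
  constructor
  · intro e
    have h1 := congrArg Complex.re e
    have h2 := congrArg Complex.im e
    simp at h1 h2
    exact ext' h1 h2
  · rintro rfl
    apply Complex.ext <;> simp

theorem gauge_eq_zero {h : Heis} : gauge h = 0 ↔ h = 1 := by
  rw [← u_eq_zero, ← norm_eq_zero (a := u h), ← gauge_sq]; simp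

theorem gauge_pos {h : Heis} (hh : h ≠ 1) : 0 < gauge h :=
  lt_of_le_of_ne (gauge_nonneg h) fun e => hh (gauge_eq_zero.mp e.symm)

@[simp] theorem gauge_one : gauge 1 = 0 := gauge_eq_zero.mpr rfl

theorem u_inv (h : Heis) : u h⁻¹ = starRingEnd ℂ (u h) := by
  apply Complex.ext <;> simp

theorem gauge_inv (h : Heis) : gauge h⁻¹ = gauge h := by
  have : gauge h⁻¹ ^ 2 = gauge h ^ 2 := by rw [gauge_sq, gauge_sq, u_inv]; simp
  exact (pow_left_inj₀ (gauge_nonneg _) (gauge_nonneg _) two_ne_zero).mp this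

theorem u_mul (g h : Heis) : u (g * h) = u g + u h + 2 * starRingEnd ℂ g.z * h.z := by
  apply Complex.ext
  · simp [norm_sq_eq]; ring
  · simp; ring

/-- The squared gauge is the norm of `u`, and `u` is additive up to a cross term of norm `2 ‖g.z‖
‖h.z‖`. -/
theorem gauge_mul_le (g h : Heis) : gauge (g * h) ≤ gauge g + gauge h := by
  have h1 : gauge (g * h) ^ 2 ≤ (gauge g + gauge h) ^ 2 := by
    rw [gauge_sq, u_mul]
    calc _ ≤ ‖u g‖ + ‖u h‖ + ‖2 * starRingEnd ℂ g.z * h.z‖ := norm_add₃_le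
      _ = gauge g ^ 2 + gauge h ^ 2 + 2 * (‖g.z‖ * ‖h.z‖) := by
          rw [gauge_sq, gauge_sq]; simp; ring
      _ ≤ gauge g ^ 2 + gauge h ^ 2 + 2 * (gauge g * gauge h) := by
          have := mul_le_mul (norm_z_le g) (norm_z_le h) (norm_nonneg _) (gauge_nonneg g)
          linarith
      _ = _ := by ring
  exact (pow_le_pow_iff_left₀ (gauge_nonneg _)
    (add_nonneg (gauge_nonneg g) (gauge_nonneg h)) two_ne_zero).mp h1

/-- The left invariant distance of the gauge. -/
def kd (h k : Heis) : ℝ := gauge (h⁻¹ * k)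

theorem kd_nonneg (h k : Heis) : 0 ≤ kd h k := gauge_nonneg _

theorem kd_comm (h k : Heis) : kd h k = kd k h := by
  rw [kd, kd, ← gauge_inv]; simp

theorem kd_triangle (a b c : Heis) : kd a c ≤ kd a b + kd b c := by
  have : a⁻¹ * c = (a⁻¹ * b) * (b⁻¹ * c) := by group
  rw [kd, this]; exact gauge_mul_le _ _

@[simp] theorem kd_left (g h k : Heis) : kd (g * h) (g * k) = kd h k := by
  rw [kd, kd]; congr 1; group

@[simp] theorem kd_one (h : Heis) : kd 1 h = gauge h := by simp [kd]

@[simp] theorem kd_self (h : Heis) : kd h h = 0 := by simp [kd]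

theorem kd_eq_zero {h k : Heis} : kd h k = 0 ↔ h = k := by
  rw [kd, gauge_eq_zero, inv_mul_eq_one]

theorem gauge_le_add_kd (h k : Heis) : gauge k ≤ gauge h + kd h k := by
  simpa using kd_triangle 1 h k

theorem kd_le_add (h k : Heis) : kd h k ≤ gauge h + gauge k := by
  have := gauge_mul_le h⁻¹ k
  rwa [gauge_inv] at this

/-- The projective model of the Heisenberg group lives in `ℂ³`. -/
abbrev V : Type := ℂ × ℂ × ℂ

/-- The lift of a point to a null vector. -/
def X (h : Heis) : V := (1, h.z, u h)

/-- The Hermitian form of signature `(1, 2)`. -/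
def form (v w : V) : ℂ :=
  starRingEnd ℂ v.1 * w.2.2 + starRingEnd ℂ v.2.2 * w.1 - 2 * starRingEnd ℂ v.2.1 * w.2.1

/-- The reason for the projective model: the form on lifts encodes the left invariant distance. -/
theorem form_X (h k : Heis) : form (X h) (X k) = u (h⁻¹ * k) := by
  rw [u_mul, u_inv]; simp [form, X]; ring

theorem norm_form_X (h k : Heis) : ‖form (X h) (X k)‖ = kd h k ^ 2 := by
  rw [form_X, kd, gauge_sq]

theorem form_smul_left (c : ℂ) (v w : V) : form (c • v) w = starRingEnd ℂ c * form v w := by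
  simp [form]; ring

theorem form_smul_right (c : ℂ) (v w : V) : form v (c • w) = c * form v w := by
  simp [form]; ring

/-- Left translation in the projective model. -/
def transl (g : Heis) : V ≃ₗ[ℂ] V where
  toFun v := (v.1, v.2.1 + g.z * v.1, v.2.2 + u g * v.1 + 2 * starRingEnd ℂ g.z * v.2.1)
  invFun v := (v.1, v.2.1 + g⁻¹.z * v.1,
    v.2.2 + u g⁻¹ * v.1 + 2 * starRingEnd ℂ g⁻¹.z * v.2.1)
  map_add' v w := by ext <;> simp <;> ring
  map_smul' c v := by ext <;> simp <;> ring
  left_inv v := by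
    have e : u g + starRingEnd ℂ (u g) = 2 * (starRingEnd ℂ g.z * g.z) := by
      apply Complex.ext
      · simp [norm_sq_eq]; ring
      · simp; ring
    refine Prod.ext rfl (Prod.ext ?_ ?_)
    · simp
    · simp only [u_inv, inv_z, map_neg]
      linear_combination v.1 * e
  right_inv v := by
    have e : u g + starRingEnd ℂ (u g) = 2 * (starRingEnd ℂ g.z * g.z) := by
      apply Complex.ext
      · simp [norm_sq_eq]; ring
      · simp; ring
    refine Prod.ext rfl (Prod.ext ?_ ?_)
    · simp
    · simp only [u_inv, inv_z, map_neg]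
      linear_combination v.1 * e

theorem transl_apply (g : Heis) (v : V) : transl g v =
    (v.1, v.2.1 + g.z * v.1, v.2.2 + u g * v.1 + 2 * starRingEnd ℂ g.z * v.2.1) := rfl

theorem transl_X (g h : Heis) : transl g (X h) = X (g * h) := by
  rw [transl_apply]
  refine Prod.ext rfl (Prod.ext ?_ ?_)
  · simp [X, add_comm]
  · simp [X, u_mul]; ring

theorem transl_symm (g : Heis) : (transl g)⁻¹ = transl g⁻¹ := by
  ext v <;> rfl

/-- The Koranyi inversion in the projective model. -/
def invl : V ≃ₗ[ℂ] V where
  toFun v := (v.2.2, -v.2.1, v.1)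
  invFun v := (v.2.2, -v.2.1, v.1)
  map_add' v w := by ext <;> simp; ring
  map_smul' c v := by ext <;> simp
  left_inv v := by simp
  right_inv v := by simp

theorem invl_apply (v : V) : invl v = (v.2.2, -v.2.1, v.1) := rfl

theorem invl_symm : invl⁻¹ = invl := by ext v <;> rfl

theorem inversion_z (h : Heis) : (inversion h).z = -h.z / u h := by
  simp only [inversion, z_mk]
  congr 1
  apply Complex.ext <;> simp [-Complex.ofReal_pow]

theorem inversion_t (h : Heis) : (inversion h).t = -h.t / ‖u h‖ ^ 2 := by
  rw [norm_u_sq]; rfl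

theorem u_inversion (h : Heis) : u (inversion h) = (u h)⁻¹ := by
  apply Complex.ext
  · rw [u_re, inversion_z, Complex.inv_re, norm_div, norm_neg, div_pow, u_re,
      Complex.normSq_eq_norm_sq]
  · rw [u_im, inversion_t, Complex.inv_im, u_im, Complex.normSq_eq_norm_sq]

@[simp] theorem inversion_one : inversion 1 = 1 :=
  u_eq_zero.mp (by rw [u_inversion, u_eq_zero.mpr rfl, inv_zero])

theorem inversion_inversion (h : Heis) : inversion (inversion h) = h := by
  by_cases hh : h = 1
  · simp [hh]
  have h0 : u h ≠ 0 := fun e => hh (u_eq_zero.mp e)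
  refine ext' ?_ ?_
  · rw [inversion_z, inversion_z, u_inversion]; field_simp
  · have := congrArg Complex.im (u_inversion (inversion h))
    rwa [u_inversion h, inv_inv] at this

theorem inversion_eq_one {h : Heis} : inversion h = 1 ↔ h = 1 := by
  constructor
  · intro e; rw [← inversion_inversion h, e, inversion_one]
  · rintro rfl; simp

theorem gauge_inversion (h : Heis) : gauge (inversion h) = (gauge h)⁻¹ := by
  have : gauge (inversion h) ^ 2 = (gauge h)⁻¹ ^ 2 := by
    rw [gauge_sq, u_inversion, norm_inv, ← gauge_sq, inv_pow]
  exact (pow_left_inj₀ (gauge_nonneg _) (inv_nonneg.mpr (gauge_nonneg _)) two_ne_zero).mp this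

theorem invl_X {h : Heis} (hh : h ≠ 1) : invl (X h) = u h • X (inversion h) := by
  have h0 : u h ≠ 0 := fun e => hh (u_eq_zero.mp e)
  rw [invl_apply]
  refine Prod.ext ?_ (Prod.ext ?_ ?_)
  · simp [X]
  · simp only [X, inversion_z, Prod.smul_mk, smul_eq_mul]; field_simp
  · simp [X, u_inversion, h0]

/-! ### The modular group -/

/-- The group generated by the inversion and the integer translations. -/
def modular : Subgroup (V ≃ₗ[ℂ] V) := Subgroup.closure ({invl} ∪ transl '' integers)

theorem invl_mem : invl ∈ modular := Subgroup.subset_closure (Or.inl rfl)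

theorem transl_mem {g : Heis} (hg : g ∈ integers) : transl g ∈ modular :=
  Subgroup.subset_closure (Or.inr ⟨g, hg, rfl⟩)

/-- The generating set is closed under inverses, so the group is generated as a monoid and no case
for inverses is needed. -/
theorem modular_induction {p : (V ≃ₗ[ℂ] V) → Prop} (h1 : p 1) (hi : p invl)
    (ht : ∀ g ∈ integers, p (transl g)) (hm : ∀ A ∈ modular, ∀ B ∈ modular, p A → p B → p (A * B))
    {A : V ≃ₗ[ℂ] V} (hA : A ∈ modular) : p A := by
  have hS : ({invl} ∪ transl '' (integers : Set Heis)) =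
      ({invl} ∪ transl '' (integers : Set Heis))⁻¹ := by
    ext B
    simp only [Set.mem_inv, Set.mem_union, Set.mem_singleton_iff, Set.mem_image]
    constructor
    · rintro (rfl | ⟨g, hg, rfl⟩)
      · exact Or.inl invl_symm
      · exact Or.inr ⟨g⁻¹, inv_mem hg, (transl_symm g).symm⟩
    · rintro (e | ⟨g, hg, e⟩)
      · exact Or.inl (by rw [← inv_inv B, e, invl_symm])
      · exact Or.inr ⟨g⁻¹, inv_mem hg, by rw [← transl_symm, e, inv_inv]⟩
  have hA' : A ∈ Submonoid.closure ({invl} ∪ transl '' (integers : Set Heis)) := by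
    have := hA
    rw [modular, ← Subgroup.mem_toSubmonoid, Subgroup.closure_toSubmonoid, ← hS,
      Set.union_self] at this
    exact this
  have hle : ∀ B ∈ Submonoid.closure ({invl} ∪ transl '' (integers : Set Heis)), B ∈ modular := by
    intro B hB
    exact (Subgroup.le_closure_toSubmonoid _) hB
  induction hA' using Submonoid.closure_induction with
  | mem B hB =>
    rcases hB with rfl | ⟨g, hg, rfl⟩
    · exact hi
    · exact ht g hg
  | one => exact h1
  | mul B C hB hC ihB ihC => exact hm B (hle B hB) C (hle C hC) (ihB (hle B hB)) (ihC (hle C hC))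

theorem form_map {A : V ≃ₗ[ℂ] V} (hA : A ∈ modular) (v w : V) : form (A v) (A w) = form v w := by
  refine modular_induction (p := fun A => ∀ v w, form (A v) (A w) = form v w) (fun _ _ => rfl)
    ?_ ?_ ?_ hA v w
  · intro v w; simp [form, invl_apply]; ring
  · intro g _ v w
    have e : u g + starRingEnd ℂ (u g) = 2 * (starRingEnd ℂ g.z * g.z) := by
      apply Complex.ext
      · simp [norm_sq_eq]; ring
      · simp; ring
    simp only [form, transl_apply, map_add, map_mul, Complex.conj_conj, Complex.conj_ofNat]
    linear_combination starRingEnd ℂ v.1 * w.1 * e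
  · intro B _ C _ ihB ihC v w
    rw [LinearEquiv.mul_apply, LinearEquiv.mul_apply, ihB, ihC]

/-- Gaussian integers, as complex numbers. -/
def IsInt (c : ℂ) : Prop := ∃ a b : ℤ, c = ⟨a, b⟩

theorem IsInt.add {c d : ℂ} : IsInt c → IsInt d → IsInt (c + d) := by
  rintro ⟨a, b, rfl⟩ ⟨a', b', rfl⟩
  exact ⟨a + a', b + b', by apply Complex.ext <;> simp⟩

theorem IsInt.mul {c d : ℂ} : IsInt c → IsInt d → IsInt (c * d) := by
  rintro ⟨a, b, rfl⟩ ⟨a', b', rfl⟩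
  exact ⟨a * a' - b * b', a * b' + b * a', by apply Complex.ext <;> simp⟩

theorem IsInt.neg {c : ℂ} : IsInt c → IsInt (-c) := by
  rintro ⟨a, b, rfl⟩
  exact ⟨-a, -b, by apply Complex.ext <;> simp⟩

theorem IsInt.conj {c : ℂ} : IsInt c → IsInt (starRingEnd ℂ c) := by
  rintro ⟨a, b, rfl⟩
  exact ⟨a, -b, by apply Complex.ext <;> simp⟩

theorem isInt_zero : IsInt 0 := ⟨0, 0, by apply Complex.ext <;> simp⟩

theorem isInt_one : IsInt 1 := ⟨1, 0, by apply Complex.ext <;> simp⟩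

theorem isInt_two : IsInt 2 := ⟨2, 0, by apply Complex.ext <;> simp⟩

theorem IsInt.normSq {c : ℂ} : IsInt c → ∃ n : ℕ, ‖c‖ ^ 2 = n := by
  rintro ⟨a, b, rfl⟩
  refine ⟨(a * a + b * b).toNat, ?_⟩
  rw [← Complex.normSq_eq_norm_sq, Complex.normSq_apply, ← Int.cast_natCast,
    Int.toNat_of_nonneg (by nlinarith [mul_self_nonneg a, mul_self_nonneg b])]
  push_cast; rfl

theorem IsInt.one_le_norm {c : ℂ} (hc : IsInt c) (h0 : c ≠ 0) : 1 ≤ ‖c‖ := by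
  obtain ⟨n, hn⟩ := hc.normSq
  have h1 : n ≠ 0 := by
    rintro rfl
    simp at hn; exact h0 hn
  have h2 : (1 : ℝ) ≤ ‖c‖ ^ 2 := by rw [hn]; exact_mod_cast Nat.one_le_iff_ne_zero.mpr h1
  nlinarith [norm_nonneg c]

theorem isInt_z_u {g : Heis} (hg : g ∈ integers) : IsInt g.z ∧ IsInt (u g) := by
  obtain ⟨a, b, c, rfl⟩ := hg
  refine ⟨⟨a, b, rfl⟩, ⟨a * a + b * b, c, ?_⟩⟩
  apply Complex.ext <;> simp [norm_sq_eq]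

theorem mem_integers_iff {g : Heis} : g ∈ integers ↔ IsInt g.z ∧ IsInt (u g) := by
  refine ⟨isInt_z_u, ?_⟩
  rintro ⟨⟨a, b, h1⟩, ⟨c, d, h2⟩⟩
  exact ⟨a, b, d, ext' h1 (congrArg Complex.im h2)⟩

theorem one_le_gauge {g : Heis} (hg : g ∈ integers) (h1 : g ≠ 1) : 1 ≤ gauge g := by
  have := (isInt_z_u hg).2.one_le_norm fun e => h1 (u_eq_zero.mp e)
  rw [← gauge_sq] at this
  nlinarith [gauge_nonneg g]

/-- The lattice of Gaussian integer vectors. -/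
def lattice : Set V := {v | IsInt v.1 ∧ IsInt v.2.1 ∧ IsInt v.2.2}

theorem map_lattice {A : V ≃ₗ[ℂ] V} (hA : A ∈ modular) {v : V} (hv : v ∈ lattice) :
    A v ∈ lattice := by
  refine modular_induction (p := fun A => ∀ v ∈ lattice, A v ∈ lattice) (fun _ h => h)
    (fun v hv => ⟨hv.2.2, hv.2.1.neg, hv.1⟩) ?_ (fun B _ C _ ihB ihC v hv => ihB _ (ihC v hv)) hA v hv
  · intro g hg v hv
    obtain ⟨h1, h2⟩ := isInt_z_u hg
    exact ⟨hv.1, hv.2.1.add (h1.mul hv.1),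
      (hv.2.2.add (h2.mul hv.1)).add ((isInt_two.mul h1.conj).mul hv.2.1)⟩

theorem X_mem_lattice {g : Heis} (hg : g ∈ integers) : X g ∈ lattice :=
  ⟨isInt_one, isInt_z_u hg⟩

/-! ### The fractional linear action and its cocycle -/

/-- The factor by which `A` scales the lift of `h`. -/
def den (A : V ≃ₗ[ℂ] V) (h : Heis) : ℂ := (A (X h)).1

@[simp] theorem den_one (h : Heis) : den 1 h = 1 := rfl

/-- The fractional linear action of `A`; it is meaningful where `den A h ≠ 0`. -/
def act (A : V ≃ₗ[ℂ] V) (h : Heis) : Heis :=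
  mk ((A (X h)).2.1 / (A (X h)).1) ((A (X h)).2.2 / (A (X h)).1).im

/-- The real part of `form v v = 0` forces the last coordinate, after division by the first, to have
real part `|z|²`, which is the shape of a lift. -/
theorem eq_smul_X {v : V} (hv : form v v = 0) (h1 : v.1 ≠ 0) :
    v = v.1 • X (mk (v.2.1 / v.1) (v.2.2 / v.1).im) := by
  refine Prod.ext (by simp [X]) (Prod.ext ?_ ?_)
  · simp only [X, Prod.smul_mk, smul_eq_mul, z_mk]; field_simp
  · have e : u (mk (v.2.1 / v.1) (v.2.2 / v.1).im) = v.2.2 / v.1 := by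
      apply Complex.ext
      · rw [u_re, z_mk, norm_div, div_pow]
        have h2 := congrArg Complex.re hv
        have hn : Complex.normSq v.1 ≠ 0 := by simpa using h1
        have h3 : ‖v.1‖ ^ 2 ≠ 0 := by simpa using h1
        rw [Complex.div_re, Complex.normSq_eq_norm_sq, ← add_div]
        congr 1
        rw [← Complex.normSq_eq_norm_sq, Complex.normSq_apply]
        simp [form] at h2
        linarith
      · rfl
    simp only [X, Prod.smul_mk, smul_eq_mul, e]; field_simp

theorem form_X_self (h : Heis) : form (X h) (X h) = 0 := by
  rw [form_X]; simp [u_eq_zero]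

theorem X_injective {h k : Heis} (e : X h = X k) : h = k := by
  have h1 : h.z = k.z := congrArg (fun v : V => v.2.1) e
  have h2 : u h = u k := congrArg (fun v : V => v.2.2) e
  exact ext' h1 (congrArg Complex.im h2)

theorem act_spec {A : V ≃ₗ[ℂ] V} (hA : A ∈ modular) {h : Heis} (h0 : den A h ≠ 0) :
    A (X h) = den A h • X (act A h) :=
  eq_smul_X (by rw [form_map hA, form_X_self]) h0

theorem den_act_eq {A : V ≃ₗ[ℂ] V} {h k : Heis} {c : ℂ} (hc : c ≠ 0)
    (e : A (X h) = c • X k) : den A h = c ∧ act A h = k := by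
  have h1 : (A (X h)).1 = c := by rw [e]; simp [X]
  refine ⟨h1, ext' ?_ ?_⟩
  · rw [act, z_mk, h1, e]; simp [X, hc]
  · rw [act, t_mk, h1, e]; simp [X, hc]

theorem den_mul {A B : V ≃ₗ[ℂ] V} (hB : B ∈ modular) {h : Heis}
    (h0 : den B h ≠ 0) : den (A * B) h = den A (act B h) * den B h := by
  rw [den, LinearEquiv.mul_apply, act_spec hB h0, map_smul]; simp [den, mul_comm]

theorem act_mul {A B : V ≃ₗ[ℂ] V} (hB : B ∈ modular) {h : Heis}
    (h0 : den B h ≠ 0) : act (A * B) h = act A (act B h) := by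
  have e : (A * B) (X h) = den B h • A (X (act B h)) := by
    rw [LinearEquiv.mul_apply, act_spec hB h0, map_smul]
  rw [act, act, e]
  simp [mul_div_mul_left _ _ h0]

@[simp] theorem act_one (h : Heis) : act 1 h = h :=
  ext' (by simp [act, X]) (by simp [act, X])

@[simp] theorem den_transl (g h : Heis) : den (transl g) h = 1 := rfl

@[simp] theorem act_transl (g h : Heis) : act (transl g) h = g * h :=
  (den_act_eq one_ne_zero (by rw [transl_X, one_smul])).2

@[simp] theorem den_invl (h : Heis) : den invl h = u h := rfl

theorem act_invl {h : Heis} (hh : h ≠ 1) : act invl h = inversion h :=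
  (den_act_eq (fun e => hh (u_eq_zero.mp e)) (invl_X hh)).2

/-- The basic identity for distortion: `A` preserves the form and rescales the two lifts by `den`.
-/
theorem kd_act {A : V ≃ₗ[ℂ] V} (hA : A ∈ modular) {h k : Heis} (h0 : den A h ≠ 0)
    (k0 : den A k ≠ 0) : kd (act A h) (act A k) ^ 2 * (‖den A h‖ * ‖den A k‖) = kd h k ^ 2 := by
  rw [← norm_form_X, ← norm_form_X, ← form_map hA (X h), act_spec hA h0, act_spec hA k0,
    form_smul_left, form_smul_right]
  simp; ring

theorem kd_inversion {h k : Heis} (hh : h ≠ 1) (hk : k ≠ 1) :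
    kd (inversion h) (inversion k) * (gauge h * gauge k) = kd h k := by
  have h0 : u h ≠ 0 := fun e => hh (u_eq_zero.mp e)
  have k0 : u k ≠ 0 := fun e => hk (u_eq_zero.mp e)
  have := kd_act invl_mem (h := h) (k := k) h0 k0
  rw [act_invl hh, act_invl hk, den_invl, den_invl, ← gauge_sq, ← gauge_sq] at this
  refine (pow_left_inj₀ ?_ (kd_nonneg _ _) two_ne_zero).mp (by rw [← this]; ring)
  exact mul_nonneg (kd_nonneg _ _) (mul_nonneg (gauge_nonneg _) (gauge_nonneg _))

theorem den_inv {A : V ≃ₗ[ℂ] V} (hA : A ∈ modular) {h : Heis} (h0 : den A h ≠ 0) :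
    den A⁻¹ (act A h) = (den A h)⁻¹ ∧ act A⁻¹ (act A h) = h := by
  refine den_act_eq (inv_ne_zero h0) ?_
  have : X (act A h) = (den A h)⁻¹ • A (X h) := by rw [act_spec hA h0, smul_smul]; simp [h0]
  rw [this, map_smul]
  congr 1
  exact A.symm_apply_apply _

end

section

/-! ### Integer points on smooth surfaces: the determinant method -/

/-- The closed unit square. -/
abbrev square : Set (ℝ × ℝ) := Icc (0 : ℝ) 1 ×ˢ Icc (0 : ℝ) 1

/-- Taylor's formula with integral remainder, uniform in the centre because all derivatives are
bounded on the compact square. -/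
theorem exists_taylor_coeff {G : ℝ × ℝ → ℝ} (hG : ContDiff ℝ ∞ G) (n : ℕ) :
    ∃ C : ℝ, 0 ≤ C ∧ ∃ coef : ℝ × ℝ → ℕ × ℕ → ℝ, (∀ c ∈ square, ∀ m, |coef c m| ≤ C) ∧
      ∀ c ∈ square, ∀ p ∈ square, ∀ s : ℝ, ‖p - c‖ ≤ s →
        |G p - ∑ m ∈ Finset.range (n + 1) ×ˢ Finset.range (n + 1),
          coef c m * ((p.1 - c.1) ^ m.2 * (p.2 - c.2) ^ (m.1 - m.2))| ≤ C * s ^ (n + 1) := by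
  have hcpt : IsCompact square := isCompact_Icc.prod isCompact_Icc
  have hbd : ∀ k : ℕ, ∃ M : ℝ, 0 ≤ M ∧ ∀ c ∈ square, ‖iteratedFDeriv ℝ k G c‖ ≤ M := by
    intro k
    have hc : Continuous (iteratedFDeriv ℝ k G) := hG.continuous_iteratedFDeriv (by exact_mod_cast le_top)
    obtain ⟨M, hM⟩ := hcpt.exists_bound_of_continuousOn hc.continuousOn
    exact ⟨max M 0, le_max_right _ _, fun c hc => (hM c hc).trans (le_max_left _ _)⟩
  choose M hM0 hM using hbd
  let T : ℝ := ∑ k ∈ Finset.range (n + 1), 2 ^ k * M k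
  have hT0 : 0 ≤ T := Finset.sum_nonneg fun k _ => mul_nonneg (by positivity) (hM0 k)
  let e₁ : ℝ × ℝ := (1, 0)
  let e₂ : ℝ × ℝ := (0, 1)
  let val (c : ℝ × ℝ) (k : ℕ) (S : Finset (Fin k)) : ℝ :=
    iteratedFDeriv ℝ k G c (S.piecewise (fun _ => e₁) (fun _ => e₂))
  have hval : ∀ c ∈ square, ∀ k S, |val c k S| ≤ M k := by
    intro c hc k S
    refine ((iteratedFDeriv ℝ k G c).le_opNorm _).trans ?_
    refine (mul_le_of_le_one_right (norm_nonneg _) ?_).trans (hM k c hc)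
    refine Finset.prod_le_one (fun _ _ => norm_nonneg _) fun i _ => ?_
    by_cases hi : i ∈ S <;> simp [hi, e₁, e₂, Prod.norm_def]
  -- An index `m` consists of the total degree and the exponent of the first variable. If the
  -- exponent exceeds the degree, `powersetCard` is empty and the coefficient is zero, so summing
  -- over a full square of indices is harmless.
  let coef (c : ℝ × ℝ) (m : ℕ × ℕ) : ℝ := if m.1 < n + 1 then
    (m.1.factorial : ℝ)⁻¹ * ∑ S ∈ Finset.powersetCard m.2 (Finset.univ : Finset (Fin m.1)),
      val c m.1 S else 0
  refine ⟨T + M (n + 1), add_nonneg hT0 (hM0 _), coef, ?_, ?_⟩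
  · intro c hc m
    by_cases hm : m.1 < n + 1
    · simp only [coef, hm, if_true]
      have h1 : |∑ S ∈ Finset.powersetCard m.2 (Finset.univ : Finset (Fin m.1)), val c m.1 S| ≤
          2 ^ m.1 * M m.1 := by
        refine (Finset.abs_sum_le_sum_abs _ _).trans ?_
        refine (Finset.sum_le_sum fun S _ => hval c hc m.1 S).trans ?_
        rw [Finset.sum_const, nsmul_eq_mul, Finset.card_powersetCard, Finset.card_univ,
          Fintype.card_fin]
        have : ((m.1.choose m.2 : ℕ) : ℝ) ≤ 2 ^ m.1 := by
          exact_mod_cast Nat.choose_le_two_pow m.1 m.2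
        exact mul_le_mul_of_nonneg_right this (hM0 _)
      have h2 : 2 ^ m.1 * M m.1 ≤ T :=
        Finset.single_le_sum (f := fun k => 2 ^ k * M k)
          (fun k _ => mul_nonneg (by positivity) (hM0 k)) (Finset.mem_range.mpr hm)
      rw [abs_mul]
      have h3 : |((m.1.factorial : ℝ))⁻¹| ≤ 1 := by
        rw [abs_of_nonneg (by positivity)]
        exact inv_le_one_of_one_le₀ (by exact_mod_cast Nat.one_le_iff_ne_zero.mpr (Nat.factorial_ne_zero _))
      calc _ ≤ 1 * (2 ^ m.1 * M m.1) := mul_le_mul h3 h1 (abs_nonneg _) zero_le_one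
        _ ≤ T + M (n + 1) := by linarith [hM0 (n + 1)]
    · simp only [coef, hm, if_false, abs_zero]
      exact add_nonneg hT0 (hM0 _)
  · intro c hc p hp s hs
    have hs0 : 0 ≤ s := (norm_nonneg _).trans hs
    set y := p - c with hy
    have hy' : y = y.1 • e₁ + y.2 • e₂ := by ext <;> simp [e₁, e₂]
    have hseg : ∀ t ∈ Icc (0 : ℝ) 1, c + t • y ∈ square := by
      intro t ht
      have hconv : Convex ℝ square := (convex_Icc 0 1).prod (convex_Icc 0 1)
      have := hconv.add_smul_sub_mem hc hp ht
      exact this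
    have hexp := map_add_eq_sum_add_integral_iteratedFDeriv (f := G) (x := c) (y := y) (n := n)
      (fun t _ => (hG.of_le (by exact_mod_cast le_top)).contDiffAt)
    have hcy : c + y = p := by simp [hy]
    rw [hcy] at hexp
    have hterm : ∀ k ∈ Finset.range (n + 1), ((k.factorial : ℝ))⁻¹ •
        iteratedFDeriv ℝ k G c (fun _ => y) = ∑ a ∈ Finset.range (n + 1),
          coef c (k, a) * (y.1 ^ a * y.2 ^ (k - a)) := by
      intro k hk
      have hk' : k < n + 1 := Finset.mem_range.mp hk
      have h1 : iteratedFDeriv ℝ k G c (fun _ => y) = ∑ S ∈ (Finset.univ : Finset (Fin k)).powerset,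
          val c k S * (y.1 ^ S.card * y.2 ^ (k - S.card)) := by
        have : (fun _ : Fin k => y) = (fun _ => y.1 • e₁) + (fun _ => y.2 • e₂) := by
          funext i; exact hy'
        rw [this, ContinuousMultilinearMap.map_add_univ, Finset.powerset_univ]
        refine Finset.sum_congr rfl fun S _ => ?_
        have h2 : S.piecewise (fun _ : Fin k => y.1 • e₁) (fun _ => y.2 • e₂) =
            fun i => (S.piecewise (fun _ => y.1) (fun _ => y.2) i : ℝ) •
              (S.piecewise (fun _ : Fin k => e₁) (fun _ => e₂) i) := by
          funext i
          by_cases hi : i ∈ S <;> simp [hi]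
        rw [h2, ContinuousMultilinearMap.map_smul_univ, smul_eq_mul, mul_comm]
        congr 1
        rw [Finset.prod_piecewise]
        simp [Finset.card_sdiff, Finset.inter_univ]
      rw [h1, Finset.sum_powerset, Finset.card_univ, Fintype.card_fin, smul_eq_mul, Finset.mul_sum]
      rw [Finset.sum_subset (s₂ := Finset.range (n + 1))
        (Finset.range_subset_range.mpr (by omega))]
      · refine Finset.sum_congr rfl fun a _ => ?_
        simp only [coef, hk', if_true]
        rw [mul_assoc, Finset.sum_mul]
        congr 1
        refine Finset.sum_congr rfl fun S hS => ?_
        rw [(Finset.mem_powersetCard.mp hS).2]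
      · intro a _ ha
        have : Finset.powersetCard a (Finset.univ : Finset (Fin k)) = ∅ :=
          Finset.powersetCard_eq_empty.mpr (by simpa using ha)
        simp [this]
    rw [Finset.sum_congr rfl hterm, ← Finset.sum_product'] at hexp
    have hy1 : p.1 - c.1 = y.1 := rfl
    have hy2 : p.2 - c.2 = y.2 := rfl
    rw [hexp, hy1, hy2, add_sub_cancel_left, smul_eq_mul, abs_mul]
    have hint : |∫ t in (0 : ℝ)..1, (1 - t) ^ n • iteratedFDeriv ℝ (n + 1) G (c + t • y)
        (fun _ => y)| ≤ M (n + 1) * s ^ (n + 1) := by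
      have := intervalIntegral.norm_integral_le_of_norm_le_const (a := (0 : ℝ)) (b := 1)
        (f := fun t => (1 - t) ^ n • iteratedFDeriv ℝ (n + 1) G (c + t • y) (fun _ => y))
        (C := M (n + 1) * s ^ (n + 1)) ?_
      · simpa using this
      · intro t ht
        rw [uIoc_of_le zero_le_one] at ht
        have ht' : t ∈ Icc (0 : ℝ) 1 := ⟨ht.1.le, ht.2⟩
        rw [norm_smul]
        have h1 : ‖(1 - t) ^ n‖ ≤ 1 := by
          rw [norm_pow]
          refine pow_le_one₀ (norm_nonneg _) ?_
          rw [Real.norm_eq_abs, abs_le]; constructor <;> linarith [ht.1, ht.2]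
        have h2 : ‖iteratedFDeriv ℝ (n + 1) G (c + t • y) (fun _ => y)‖ ≤
            M (n + 1) * s ^ (n + 1) := by
          refine ((iteratedFDeriv ℝ (n + 1) G _).le_opNorm _).trans ?_
          refine mul_le_mul (hM _ _ (hseg t ht')) ?_ (by positivity) (hM0 _)
          simpa using pow_le_pow_left₀ (norm_nonneg _) hs (n + 1)
        calc _ ≤ 1 * (M (n + 1) * s ^ (n + 1)) := mul_le_mul h1 h2 (norm_nonneg _) zero_le_one
          _ = _ := one_mul _
    have h3 : |((n.factorial : ℝ))⁻¹| ≤ 1 := by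
      rw [abs_of_nonneg (by positivity)]
      exact inv_le_one_of_one_le₀ (by exact_mod_cast Nat.one_le_iff_ne_zero.mpr (Nat.factorial_ne_zero _))
    calc _ ≤ 1 * (M (n + 1) * s ^ (n + 1)) := mul_le_mul h3 hint (abs_nonneg _) zero_le_one
      _ ≤ _ := by
        rw [one_mul]
        exact mul_le_mul_of_nonneg_right (by linarith) (by positivity)

/-- Siegel's lemma over the reals. -/
theorem exists_small_combination {ι κ : Type} [Fintype ι] [Fintype κ] [Nonempty κ]
    (hcard : Fintype.card ι = 2 * Fintype.card κ) (c : ι → κ → ℝ) {C : ℝ} (hC : 0 ≤ C)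
    (hc : ∀ i j, |c i j| ≤ C) (H : ℕ) (hH : 1 ≤ H) :
    ∃ q : ι → ℤ, q ≠ 0 ∧ (∀ i, |q i| ≤ H) ∧
      ∀ j, |∑ i, (q i : ℝ) * c i j| ≤ 8 * Fintype.card ι * (C + 1) / H := by
  classical
  set W : ℝ := 8 * Fintype.card ι * (C + 1) with hW
  have hι : 0 < Fintype.card ι := by rw [hcard]; have := Fintype.card_pos (α := κ); omega
  have hι' : (0 : ℝ) < Fintype.card ι := by exact_mod_cast hι
  have hWpos : 0 < W := by positivity
  have hHpos : (0 : ℝ) < H := by exact_mod_cast hH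
  let S (q : ι → Fin (H + 1)) (j : κ) : ℝ := ∑ i, ((q i : ℕ) : ℝ) * c i j
  -- The scaled sums are at most `H ^ 2 / 8` in absolute value, so their floors lie in `[-h, h]`,
  -- while `2 * h + 1 < (H + 1) ^ 2`. With twice as many unknowns as conditions, there are fewer
  -- boxes than vectors.
  let h : ℤ := (H : ℤ) ^ 2 / 4 + 1
  have hSb : ∀ q j, |S q j * (H / W)| ≤ (H : ℝ) ^ 2 / 8 := by
    intro q j
    have h1 : |S q j| ≤ Fintype.card ι * (H * C) := by
      refine (Finset.abs_sum_le_sum_abs _ _).trans ?_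
      have : ∀ i ∈ (Finset.univ : Finset ι), |((q i : ℕ) : ℝ) * c i j| ≤ H * C := by
        intro i _
        rw [abs_mul]
        refine mul_le_mul ?_ (hc i j) (abs_nonneg _) hHpos.le
        rw [abs_of_nonneg (by positivity)]
        exact_mod_cast Nat.lt_succ_iff.mp (q i).2
      refine (Finset.sum_le_sum this).trans ?_
      simp
    rw [abs_mul, abs_of_pos (by positivity : (0 : ℝ) < H / W)]
    calc |S q j| * (H / W) ≤ (Fintype.card ι * (H * C)) * (H / W) := by gcongr
      _ ≤ (Fintype.card ι * (H * (C + 1))) * (H / W) := by gcongr; linarith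
      _ = (H : ℝ) ^ 2 / 8 := by rw [hW]; field_simp
  have hfl : ∀ q j, ⌊S q j * (H / W)⌋ ∈ Finset.Icc (-h) h := by
    intro q j
    have h1 := abs_le.mp (hSb q j)
    have h2 : (H : ℝ) ^ 2 / 4 ≤ h := by
      have : (H : ℤ) ^ 2 ≤ 4 * h := by simp only [h]; omega
      have : ((H : ℤ) ^ 2 : ℝ) ≤ ((4 * h : ℤ) : ℝ) := by exact_mod_cast this
      push_cast at this; linarith
    have h3 : (0 : ℝ) ≤ (H : ℝ) ^ 2 := by positivity
    rw [Finset.mem_Icc]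
    constructor
    · rw [Int.le_floor]; push_cast; linarith
    · have := Int.floor_le (S q j * (H / W))
      have : (⌊S q j * (H / W)⌋ : ℝ) ≤ (h : ℝ) := by linarith
      exact_mod_cast this
  have hh : (Finset.Icc (-h) h).card < (H + 1) ^ 2 := by
    rw [Int.card_Icc]
    have : h + 1 - -h < ((H : ℤ) + 1) ^ 2 := by
      simp only [h]
      have h4 : (H : ℤ) ^ 2 / 4 * 4 ≤ (H : ℤ) ^ 2 := Int.ediv_mul_le _ (by norm_num)
      have h5 : (1 : ℤ) ≤ H := by exact_mod_cast hH
      nlinarith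
    zify
    have h6 : 0 ≤ (H : ℤ) ^ 2 / 4 := by positivity
    rw [Int.toNat_of_nonneg (by simp only [h]; omega)]
    exact this
  have hlt : (Fintype.piFinset fun _ : κ => Finset.Icc (-h) h).card <
      (Finset.univ : Finset (ι → Fin (H + 1))).card := by
    rw [Fintype.card_piFinset, Finset.prod_const, Finset.card_univ, Finset.card_univ,
      Fintype.card_fun, Fintype.card_fin, hcard, pow_mul]
    exact Nat.pow_lt_pow_left hh (Fintype.card_pos).ne'
  obtain ⟨q₁, -, q₂, -, hne, heq⟩ := Finset.exists_ne_map_eq_of_card_lt_of_maps_to hlt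
    (f := fun q j => ⌊S q j * (H / W)⌋) (fun q _ => by
      simpa only [Finset.mem_coe, Fintype.mem_piFinset] using hfl q)
  refine ⟨fun i => ((q₁ i : ℕ) : ℤ) - ((q₂ i : ℕ) : ℤ), ?_, ?_, ?_⟩
  · intro e
    apply hne
    funext i
    have := congrFun e i
    simp only [Pi.zero_apply] at this
    exact Fin.ext (by omega)
  · intro i
    have h1 := (q₁ i).2
    have h2 := (q₂ i).2
    change |((q₁ i : ℕ) : ℤ) - ((q₂ i : ℕ) : ℤ)| ≤ H
    rw [abs_le]; constructor <;> omega
  · intro j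
    have e := congrFun heq j
    have h1 := Int.abs_sub_lt_one_of_floor_eq_floor e
    have h2 : ∑ i, ((((q₁ i : ℕ) : ℤ) - ((q₂ i : ℕ) : ℤ) : ℤ) : ℝ) * c i j = S q₁ j - S q₂ j := by
      rw [← Finset.sum_sub_distrib]
      refine Finset.sum_congr rfl fun i _ => ?_
      push_cast; ring
    rw [h2]
    rw [← sub_mul, abs_mul, abs_of_pos (by positivity : (0 : ℝ) < H / W)] at h1
    rw [le_div_iff₀ hHpos]
    have h3 : |S q₁ j - S q₂ j| * (H / W) * W < 1 * W := by gcongr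
    rw [mul_assoc, div_mul_cancel₀ _ hWpos.ne', one_mul] at h3
    exact h3.le

/-- The Schwartz–Zippel bound for a polynomial of degree less than `d` in each of three variables;
distinct exponents keep it nonzero. -/
theorem card_zeros_le (d : ℕ) (q : Fin d × Fin d × Fin d → ℤ) (hq : q ≠ 0) (S : Finset ℤ)
    (hS : S.Nonempty) :
    ((Fintype.piFinset fun _ : Fin 3 => S).filter fun f =>
      ∑ m, q m * (f 0 ^ (m.1 : ℕ) * f 1 ^ (m.2.1 : ℕ) * f 2 ^ (m.2.2 : ℕ)) = 0).card ≤
      3 * d * S.card ^ 2 := by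
  classical
  let ex (m : Fin d × Fin d × Fin d) : Fin 3 →₀ ℕ :=
    Finsupp.equivFunOnFinite.symm ![(m.1 : ℕ), (m.2.1 : ℕ), (m.2.2 : ℕ)]
  have hex : Function.Injective ex := by
    intro m m' e
    have e' := Finsupp.equivFunOnFinite.symm.injective e
    have h0 := congrFun e' 0
    have h1 := congrFun e' 1
    have h2 := congrFun e' 2
    simp at h0 h1 h2
    exact Prod.ext (Fin.ext h0) (Prod.ext (Fin.ext h1) (Fin.ext h2))
  let p : MvPolynomial (Fin 3) ℤ := ∑ m, MvPolynomial.monomial (ex m) (q m)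
  have hp : p ≠ 0 := by
    obtain ⟨m, hm⟩ := Function.ne_iff.mp hq
    intro e
    apply hm
    have := congrArg (MvPolynomial.coeff (ex m)) e
    simpa [p, MvPolynomial.coeff_sum, MvPolynomial.coeff_monomial, hex.eq_iff] using this
  have hdeg : p.totalDegree ≤ 3 * d := by
    refine MvPolynomial.totalDegree_finsetSum_le fun m _ => ?_
    refine (MvPolynomial.totalDegree_monomial_le _ _).trans ?_
    rw [Finsupp.sum_fintype _ _ (fun _ => rfl), Fin.sum_univ_three]
    simp only [ex, Finsupp.equivFunOnFinite_symm_apply_apply]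
    have h0 := m.1.2
    have h1 := m.2.1.2
    have h2 := m.2.2.2
    simp
    omega
  have heval : ∀ f : Fin 3 → ℤ, MvPolynomial.eval f p =
      ∑ m, q m * (f 0 ^ (m.1 : ℕ) * f 1 ^ (m.2.1 : ℕ) * f 2 ^ (m.2.2 : ℕ)) := by
    intro f
    simp only [p, map_sum, MvPolynomial.eval_monomial]
    refine Finset.sum_congr rfl fun m _ => ?_
    rw [Finsupp.prod_fintype _ _ (fun _ => pow_zero _), Fin.prod_univ_three]
    simp [ex]
  have hz := MvPolynomial.schwartz_zippel_totalDegree hp S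
  simp only [heval] at hz
  have hS0 : (0 : ℚ≥0) < S.card := by exact_mod_cast hS.card_pos
  rw [div_le_div_iff₀ (by positivity) hS0] at hz
  have hz' : ((Fintype.piFinset fun _ : Fin 3 => S).filter fun f =>
      ∑ m, q m * (f 0 ^ (m.1 : ℕ) * f 1 ^ (m.2.1 : ℕ) * f 2 ^ (m.2.2 : ℕ)) = 0).card * S.card ≤
      p.totalDegree * S.card ^ 3 := by exact_mod_cast hz
  have : p.totalDegree * S.card ^ 3 ≤ (3 * d * S.card ^ 2) * S.card := by
    calc _ ≤ (3 * d) * S.card ^ 3 := Nat.mul_le_mul_right _ hdeg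
      _ = _ := by ring
  exact Nat.le_of_mul_le_mul_right (hz'.trans this) hS.card_pos

/-- An auxiliary polynomial for the points of a small piece of a surface. -/
theorem exists_aux_polynomial {A B C D : ℝ × ℝ → ℝ} (hA : ContDiff ℝ ∞ A) (hB : ContDiff ℝ ∞ B)
    (hC : ContDiff ℝ ∞ C) (hD : ContDiff ℝ ∞ D) {e d k : ℕ} (he : 1 ≤ e)
    (hd : d = 2 * e ^ 2) (hk : k = 2 * e ^ 3) :
    ∃ C₁ : ℝ, 0 ≤ C₁ ∧ ∀ L : ℕ, 1 ≤ L → ∀ H : ℕ, 1 ≤ H → ∀ c ∈ square,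
      ∃ q : Fin d × Fin d × Fin d → ℤ, q ≠ 0 ∧
        ∀ p ∈ square, ‖p - c‖ ≤ 1 / L →
          |∑ m, (q m : ℝ) * (A p ^ (m.1 : ℕ) * B p ^ (m.2.1 : ℕ) * C p ^ (m.2.2 : ℕ) *
            D p ^ (3 * d - m.1 - m.2.1 - m.2.2))| ≤
          C₁ * (1 / H + H / (L : ℝ) ^ k) := by
  classical
  have hk1 : 1 ≤ k := by rw [hk]; have := Nat.one_le_pow 3 e he; omega
  let I := Fin d × Fin d × Fin d
  let G (m : I) (p : ℝ × ℝ) : ℝ := A p ^ (m.1 : ℕ) * B p ^ (m.2.1 : ℕ) * C p ^ (m.2.2 : ℕ) *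
    D p ^ (3 * d - m.1 - m.2.1 - m.2.2)
  have hG : ∀ m, ContDiff ℝ ∞ (G m) := fun m =>
    (((hA.pow _).mul (hB.pow _)).mul (hC.pow _)).mul (hD.pow _)
  choose M hM0 coef hcoef happ using fun m => exists_taylor_coeff (hG m) (k - 1)
  have hk' : k - 1 + 1 = k := by omega
  rw [hk'] at happ
  let R : Finset (ℕ × ℕ) := Finset.range k ×ˢ Finset.range k
  let N : ℝ := ∑ m, M m
  have hN0 : 0 ≤ N := Finset.sum_nonneg fun m _ => hM0 m
  have hMN : ∀ m, M m ≤ N := fun m => Finset.single_le_sum (fun m _ => hM0 m) (Finset.mem_univ m)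
  have hRne : Nonempty R := ⟨⟨(0, 0), by simp [R]; omega⟩⟩
  have hRcard : Fintype.card R = k * k := by simp [R]
  -- There are `d ^ 3 = 8 * e ^ 6` monomials against `k ^ 2 = 4 * e ^ 6` Taylor coefficients; `d`
  -- and `k` are shaped for this ratio.
  have hIR : Fintype.card I = 2 * Fintype.card R := by
    rw [hRcard]; simp only [I, Fintype.card_prod, Fintype.card_fin, hd, hk]; ring
  refine ⟨(k * k : ℕ) * (8 * Fintype.card I * (N + 1)) + N, by positivity, ?_⟩
  intro L hL H hH c hc
  obtain ⟨q, hq0, hqH, hq⟩ := exists_small_combination hIR (fun m (j : R) => coef m c j) hN0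
    (fun m j => (hcoef m c hc j).trans (hMN m)) H hH
  refine ⟨q, hq0, fun p hp hpc => ?_⟩
  have hL' : (1 : ℝ) ≤ L := by exact_mod_cast hL
  have hH' : (1 : ℝ) ≤ H := by exact_mod_cast hH
  let mon (j : ℕ × ℕ) : ℝ := (p.1 - c.1) ^ j.2 * (p.2 - c.2) ^ (j.1 - j.2)
  have hmon : ∀ j, |mon j| ≤ 1 := by
    intro j
    have h1 : |p.1 - c.1| ≤ 1 := by
      rw [abs_le]; constructor <;> linarith [hp.1.1, hp.1.2, hc.1.1, hc.1.2]
    have h2 : |p.2 - c.2| ≤ 1 := by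
      rw [abs_le]; constructor <;> linarith [hp.2.1, hp.2.2, hc.2.1, hc.2.2]
    simp only [mon, abs_mul, abs_pow]
    exact mul_le_one₀ (pow_le_one₀ (abs_nonneg _) h1) (by positivity) (pow_le_one₀ (abs_nonneg _) h2)
  have hsplit : ∑ m, (q m : ℝ) * G m p = ∑ j : R, (∑ m, (q m : ℝ) * coef m c j) * mon j +
      ∑ m, (q m : ℝ) * (G m p - ∑ j ∈ R, coef m c j * mon j) := by
    have : ∑ j : R, (∑ m, (q m : ℝ) * coef m c j) * mon j =
        ∑ m, (q m : ℝ) * ∑ j ∈ R, coef m c j * mon j := by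
      simp_rw [Finset.sum_mul, Finset.mul_sum]
      rw [Finset.sum_comm]
      refine Finset.sum_congr rfl fun m _ => ?_
      rw [← Finset.sum_coe_sort R]
      exact Finset.sum_congr rfl fun j _ => by ring
    rw [this, ← Finset.sum_add_distrib]
    exact Finset.sum_congr rfl fun m _ => by ring
  change |∑ m, (q m : ℝ) * G m p| ≤ _
  rw [hsplit]
  have h1 : |∑ j : R, (∑ m, (q m : ℝ) * coef m c j) * mon j| ≤
      (k * k : ℕ) * (8 * Fintype.card I * (N + 1)) * (1 / H) := by
    refine (Finset.abs_sum_le_sum_abs _ _).trans ?_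
    have : ∀ j ∈ (Finset.univ : Finset R), |(∑ m, (q m : ℝ) * coef m c j) * mon j| ≤
        8 * Fintype.card I * (N + 1) / H := by
      intro j _
      rw [abs_mul]
      calc _ ≤ (8 * Fintype.card I * (N + 1) / H) * 1 :=
            mul_le_mul (hq j) (hmon j) (abs_nonneg _) (by positivity)
        _ = _ := mul_one _
    refine (Finset.sum_le_sum this).trans (le_of_eq ?_)
    rw [Finset.sum_const, nsmul_eq_mul, Finset.card_univ, hRcard]; ring
  have h2 : |∑ m, (q m : ℝ) * (G m p - ∑ j ∈ R, coef m c j * mon j)| ≤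
      N * (H / (L : ℝ) ^ k) := by
    refine (Finset.abs_sum_le_sum_abs _ _).trans ?_
    rw [Finset.sum_mul]
    refine Finset.sum_le_sum fun m _ => ?_
    have h3 := happ m c hc p hp _ hpc
    have h4 : |(q m : ℝ)| ≤ H := by exact_mod_cast hqH m
    rw [abs_mul]
    calc _ ≤ (H : ℝ) * (M m * (1 / L) ^ k) := mul_le_mul h4 h3 (abs_nonneg _) (by positivity)
      _ = M m * (H / (L : ℝ) ^ k) := by rw [div_pow, one_pow]; ring
  refine (abs_add_le _ _).trans ((add_le_add h1 h2).trans ?_)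
  have h5 : 0 ≤ (k * k : ℕ) * (8 * Fintype.card I * (N + 1)) * (H / (L : ℝ) ^ k) := by positivity
  have h6 : 0 ≤ N * (1 / H) := by positivity
  linarith

/-- Finitely many smooth surfaces, given in projective coordinates, miss many integer points. -/
theorem exists_integer_point_off_surfaces {ι : Type} [Fintype ι] {A B C D : ι → ℝ × ℝ → ℝ}
    (hA : ∀ i, ContDiff ℝ ∞ (A i)) (hB : ∀ i, ContDiff ℝ ∞ (B i))
    (hC : ∀ i, ContDiff ℝ ∞ (C i)) (hD : ∀ i, ContDiff ℝ ∞ (D i)) (e₀ : ℕ) {C₀ : ℝ}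
    (hC₀ : 0 < C₀) (L₀ : ℕ) :
    ∃ L : ℕ, L₀ ≤ L ∧ ∃ f : Fin 3 → ℤ, (∀ j, (L : ℤ) ^ 4 ≤ f j ∧ f j < 2 * (L : ℤ) ^ 4) ∧
      ∀ i, ∀ p ∈ square, D i p * f 0 = A i p → D i p * f 1 = B i p → D i p * f 2 = C i p →
        C₀ * (L : ℝ) ^ e₀ * |D i p| < 1 := by
  classical
  -- Since `k = e * d`, this choice gives `2 * s ≤ k`. With `H = L ^ s`, both `1 / H` and `H / L ^
  -- k` are then at most `L ^ (-s)`, one factor `L` better than the loss `L ^ (3 * d * e₀)` from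
  -- clearing denominators.
  obtain ⟨e, he⟩ : ∃ e, e = 6 * e₀ + 2 := ⟨_, rfl⟩
  obtain ⟨d, hd⟩ : ∃ d, d = 2 * e ^ 2 := ⟨_, rfl⟩
  obtain ⟨k, hk⟩ : ∃ k, k = 2 * e ^ 3 := ⟨_, rfl⟩
  obtain ⟨s, hs⟩ : ∃ s, s = 3 * d * e₀ + 1 := ⟨_, rfl⟩
  have hks : s + s ≤ k := by
    have : e ^ 3 = e ^ 2 * (6 * e₀ + 2) := by rw [pow_succ, he]
    have h1 : 1 ≤ e ^ 2 := Nat.one_le_pow _ _ (by omega)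
    rw [hs, hk, hd, this]; nlinarith
  choose C₁ hC₁0 hC₁ using fun i => exists_aux_polynomial (hA i) (hB i) (hC i) (hD i) (show 1 ≤ e by omega) hd hk
  let T : ℝ := ∑ i, C₁ i
  have hT : ∀ i, C₁ i ≤ T := fun i =>
    Finset.single_le_sum (fun i _ => hC₁0 i) (Finset.mem_univ i)
  have hT0 : 0 ≤ T := Finset.sum_nonneg fun i _ => hC₁0 i
  obtain ⟨L₁, hL₁⟩ := exists_nat_gt (2 * T * C₀ ^ (3 * d))
  obtain ⟨L, hL⟩ : ∃ L, L = L₀ + L₁ + 3 * d * Fintype.card ι + 1 := ⟨_, rfl⟩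
  have hL1 : 1 ≤ L := by omega
  have hLr : (1 : ℝ) ≤ L := by exact_mod_cast hL1
  have hLpos : (0 : ℝ) < L := by linarith
  refine ⟨L, by omega, ?_⟩
  have hcorner : ∀ a : Fin L × Fin L, (((a.1 : ℕ) : ℝ) / L, ((a.2 : ℕ) : ℝ) / L) ∈ square := by
    intro a
    have h1 : ∀ x : Fin L, ((x : ℕ) : ℝ) / L ∈ Icc (0 : ℝ) 1 := by
      intro x
      refine ⟨by positivity, ?_⟩
      rw [div_le_one hLpos]; exact_mod_cast x.2.le
    exact ⟨h1 a.1, h1 a.2⟩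
  choose q hq0 hq using fun (i : ι) (a : Fin L × Fin L) =>
    hC₁ i L hL1 (L ^ s) (Nat.one_le_pow _ _ hL1) _ (hcorner a)
  let S : Finset ℤ := Finset.Ico ((L : ℤ) ^ 4) (2 * (L : ℤ) ^ 4)
  have hScard : S.card = L ^ 4 := by
    simp only [S, Int.card_Ico]
    have : 2 * (L : ℤ) ^ 4 - (L : ℤ) ^ 4 = ((L ^ 4 : ℕ) : ℤ) := by push_cast; ring
    rw [this, Int.toNat_natCast]
  have hSne : S.Nonempty := by
    rw [← Finset.card_pos, hScard]; positivity
  let bad (x : ι × (Fin L × Fin L)) : Finset (Fin 3 → ℤ) :=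
    (Fintype.piFinset fun _ : Fin 3 => S).filter fun f =>
      ∑ m, q x.1 x.2 m * (f 0 ^ (m.1 : ℕ) * f 1 ^ (m.2.1 : ℕ) * f 2 ^ (m.2.2 : ℕ)) = 0
  -- There is one polynomial for each surface and each of the `L ^ 2` cells, and each has at most `3
  -- * d * L ^ 8` zeros among the `L ^ 12` points of the box.
  have hbad : (Finset.univ.biUnion bad).card < (Fintype.piFinset fun _ : Fin 3 => S).card := by
    have h1 : (Finset.univ.biUnion bad).card ≤
        ∑ x : ι × (Fin L × Fin L), 3 * d * S.card ^ 2 :=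
      Finset.card_biUnion_le.trans (Finset.sum_le_sum fun x _ =>
        card_zeros_le d (q x.1 x.2) (hq0 x.1 x.2) S hSne)
    refine h1.trans_lt ?_
    rw [Finset.sum_const, Finset.card_univ, Fintype.card_piFinset, Finset.prod_const,
      Finset.card_univ, Fintype.card_fin, hScard, smul_eq_mul, Fintype.card_prod,
      Fintype.card_prod, Fintype.card_fin]
    have h2 : 3 * d * Fintype.card ι < L := by omega
    have h3 : 3 * d * Fintype.card ι < L * L := by nlinarith
    calc Fintype.card ι * (L * L) * (3 * d * (L ^ 4) ^ 2)
        = (3 * d * Fintype.card ι) * L ^ 10 := by ring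
      _ < (L * L) * L ^ 10 := Nat.mul_lt_mul_of_pos_right h3 (by positivity)
      _ = (L ^ 4) ^ 3 := by ring
  obtain ⟨f, hfS, hfb⟩ := Finset.exists_mem_notMem_of_card_lt_card hbad
  refine ⟨f, fun j => Finset.mem_Ico.mp (Fintype.mem_piFinset.mp hfS j), ?_⟩
  intro i p hp h0 h1 h2
  by_contra! hge
  apply hfb
  have hcell : ∀ x ∈ Icc (0 : ℝ) 1, ∃ a : Fin L, |x - ((a : ℕ) : ℝ) / L| ≤ 1 / L := by
    intro x hx
    have hx0 : 0 ≤ x * L := mul_nonneg hx.1 hLpos.le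
    have key : ∀ n : ℕ, (n : ℝ) ≤ x * L → x * L ≤ n + 1 → |x - (n : ℝ) / L| ≤ 1 / L := by
      intro n hn1 hn2
      have e1 : x - (n : ℝ) / L = (x * L - n) / L := by field_simp
      rw [e1, abs_div, abs_of_pos hLpos]
      gcongr
      rw [abs_le]; constructor <;> linarith
    by_cases hlt : ⌊x * L⌋₊ < L
    · exact ⟨⟨_, hlt⟩, key _ (Nat.floor_le hx0) (Nat.lt_floor_add_one _).le⟩
    · have h3 : (L : ℝ) ≤ x * L := by
        calc (L : ℝ) ≤ (⌊x * L⌋₊ : ℝ) := by exact_mod_cast not_lt.mp hlt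
          _ ≤ x * L := Nat.floor_le hx0
      have h4 : x * L ≤ L := by nlinarith [hx.2]
      refine ⟨⟨L - 1, by omega⟩, key _ ?_ ?_⟩
      · have : ((L - 1 : ℕ) : ℝ) ≤ L := by exact_mod_cast Nat.sub_le _ _
        linarith
      · rw [Nat.cast_sub hL1]; push_cast; linarith
  obtain ⟨a₁, ha₁⟩ := hcell p.1 hp.1
  obtain ⟨a₂, ha₂⟩ := hcell p.2 hp.2
  refine Finset.mem_biUnion.mpr ⟨(i, (a₁, a₂)), Finset.mem_univ _, Finset.mem_filter.mpr ⟨hfS, ?_⟩⟩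
  have hnear := hq i (a₁, a₂) p hp (by
    rw [Prod.norm_def]
    exact max_le ha₁ ha₂)
  have hsum : ∑ m, (q i (a₁, a₂) m : ℝ) * (A i p ^ (m.1 : ℕ) * B i p ^ (m.2.1 : ℕ) *
      C i p ^ (m.2.2 : ℕ) * D i p ^ (3 * d - m.1 - m.2.1 - m.2.2)) = D i p ^ (3 * d) *
      ((∑ m, q i (a₁, a₂) m * (f 0 ^ (m.1 : ℕ) * f 1 ^ (m.2.1 : ℕ) * f 2 ^ (m.2.2 : ℕ)) : ℤ) :
        ℝ) := by
    push_cast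
    rw [Finset.mul_sum]
    refine Finset.sum_congr rfl fun m _ => ?_
    have e1 : D i p ^ (3 * d) = D i p ^ (m.1 : ℕ) * D i p ^ (m.2.1 : ℕ) * D i p ^ (m.2.2 : ℕ) *
        D i p ^ (3 * d - m.1 - m.2.1 - m.2.2) := by
      have h3 := m.1.2
      have h4 := m.2.1.2
      have h5 := m.2.2.2
      rw [← pow_add, ← pow_add, ← pow_add]
      congr 1
      omega
    rw [← h0, ← h1, ← h2, e1, mul_pow, mul_pow, mul_pow]
    ring
  rw [hsum, abs_mul, abs_pow] at hnear
  -- The polynomial takes an integer value at `f`. If that were nonzero, the auxiliary estimate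
  -- would make `|D i p| ^ (3 * d)` smaller than the assumed lower bound on `|D i p|` allows.
  by_contra hne
  have hone : (1 : ℝ) ≤ |((∑ m, q i (a₁, a₂) m * (f 0 ^ (m.1 : ℕ) * f 1 ^ (m.2.1 : ℕ) *
      f 2 ^ (m.2.2 : ℕ)) : ℤ) : ℝ)| := by
    exact_mod_cast Int.one_le_abs hne
  have hDlow : 1 ≤ C₀ ^ (3 * d) * (L : ℝ) ^ (s - 1) * |D i p| ^ (3 * d) := by
    have := one_le_pow₀ hge (n := 3 * d)
    rw [mul_pow, mul_pow, ← pow_mul] at this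
    have e1 : e₀ * (3 * d) = s - 1 := by rw [hs, Nat.add_sub_cancel]; ring
    rwa [e1] at this
  have hup : |D i p| ^ (3 * d) ≤ T * (2 / (L : ℝ) ^ s) := by
    calc |D i p| ^ (3 * d) ≤ |D i p| ^ (3 * d) * _ := le_mul_of_one_le_right (by positivity) hone
      _ ≤ _ := hnear
      _ ≤ T * (1 / ((L ^ s : ℕ) : ℝ) + ((L ^ s : ℕ) : ℝ) / (L : ℝ) ^ k) := by
        gcongr; exact hT i
      _ ≤ T * (2 / (L : ℝ) ^ s) := by
        gcongr
        have h3 : ((L ^ s : ℕ) : ℝ) / (L : ℝ) ^ k ≤ 1 / (L : ℝ) ^ s := by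
          rw [div_le_div_iff₀ (by positivity) (by positivity)]
          push_cast
          rw [one_mul, ← pow_add]
          exact pow_le_pow_right₀ hLr hks
        push_cast at h3 ⊢
        calc _ ≤ 1 / (L : ℝ) ^ s + 1 / (L : ℝ) ^ s := by gcongr
          _ = _ := by ring
  have hfin : C₀ ^ (3 * d) * (L : ℝ) ^ (s - 1) * |D i p| ^ (3 * d) < 1 := by
    calc _ ≤ C₀ ^ (3 * d) * (L : ℝ) ^ (s - 1) * (T * (2 / (L : ℝ) ^ s)) := by gcongr
      _ = 2 * T * C₀ ^ (3 * d) / L := by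
        have e1 : (L : ℝ) ^ s = (L : ℝ) ^ (s - 1) * L := by
          rw [← pow_succ]; congr 1; omega
        rw [e1]; field_simp
      _ < 1 := by
        rw [div_lt_one hLpos]
        refine hL₁.trans_le ?_
        exact_mod_cast (by omega : L₁ ≤ L)
  linarith

end

section

/-! ### Lebesgue measure and the Jacobian of the action -/

instance : SigmaFinite (volume : Measure Heis) := inferInstanceAs (SigmaFinite (volume : Measure (ℂ × ℝ)))
instance : NullSingletonClass (volume : Measure Heis) := ⟨fun x => by
  have h : (volume : Measure (ℂ × ℝ)) ({x.z} ×ˢ {x.t}) = volume {x.z} * volume {x.t} :=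
    Measure.prod_prod _ _
  rw [Real.volume_singleton, mul_zero, singleton_prod_singleton] at h
  exact h⟩
instance : SecondCountableTopology Heis := inferInstanceAs (SecondCountableTopology (ℂ × ℝ))
instance : T2Space Heis := inferInstanceAs (T2Space (ℂ × ℝ))
instance : (volume : Measure Heis).OuterRegular := inferInstanceAs (volume : Measure (ℂ × ℝ)).OuterRegular
instance : (volume : Measure Heis).IsOpenPosMeasure := inferInstanceAs (volume : Measure (ℂ × ℝ)).IsOpenPosMeasure
instance : IsFiniteMeasureOnCompacts (volume : Measure Heis) := inferInstanceAs (IsFiniteMeasureOnCompacts (volume : Measure (ℂ × ℝ)))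

theorem continuous_z : Continuous z := continuous_fst (X := ℂ) (Y := ℝ)
theorem continuous_t : Continuous t := continuous_snd (X := ℂ) (Y := ℝ)
theorem continuous_mk {α : Type*} [TopologicalSpace α] {f : α → ℂ} {g : α → ℝ}
    (hf : Continuous f) (hg : Continuous g) : Continuous fun a => mk (f a) (g a) :=
  Continuous.prodMk hf hg

/-- Cartesian coordinates. -/
def cart (x : Fin 3 → ℝ) : Heis := mk ⟨x 0, x 1⟩ (x 2)

theorem measurePreserving_cart : MeasurePreserving cart := by
  have h1 := volume_preserving_piFinSuccAbove (fun _ : Fin 3 => ℝ) 2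
  have h2 : MeasurePreserving (Prod.swap : ℝ × (Fin 2 → ℝ) → (Fin 2 → ℝ) × ℝ) := Measure.measurePreserving_swap
  have h3 := Complex.volume_preserving_equiv_pi.symm.prod (MeasurePreserving.id (volume : Measure ℝ))
  have h4 := h3.comp (h2.comp h1)
  have e : (Prod.map Complex.measurableEquivPi.symm id ∘ Prod.swap ∘
      MeasurableEquiv.piFinSuccAbove (fun _ : Fin 3 => ℝ) 2 : (Fin 3 → ℝ) → ℂ × ℝ) = cart := by
    funext x
    refine Prod.ext (Complex.ext ?_ ?_) rfl
    · simp [cart, mk, Complex.measurableEquivPi_symm_apply]; rfl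
    · simp [cart, mk, Complex.measurableEquivPi_symm_apply]; rfl
  rw [e] at h4
  exact h4

def invFun (x : Fin 3 → ℝ) : Fin 3 → ℝ :=
  ![-(x 0 * (x 0 ^ 2 + x 1 ^ 2) + x 1 * x 2) / ((x 0 ^ 2 + x 1 ^ 2) ^ 2 + x 2 ^ 2),
    -(x 1 * (x 0 ^ 2 + x 1 ^ 2) - x 0 * x 2) / ((x 0 ^ 2 + x 1 ^ 2) ^ 2 + x 2 ^ 2),
    -x 2 / ((x 0 ^ 2 + x 1 ^ 2) ^ 2 + x 2 ^ 2)]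

theorem cart_invFun (x : Fin 3 → ℝ) : cart (invFun x) = inversion (cart x) := by
  have hn : ‖u (cart x)‖ ^ 2 = (x 0 ^ 2 + x 1 ^ 2) ^ 2 + x 2 ^ 2 := by
    rw [norm_sq_eq, u_re, u_im, norm_sq_eq]; simp [cart]; ring
  refine ext' (Complex.ext ?_ ?_) ?_
  · rw [inversion_z, Complex.div_re, Complex.normSq_eq_norm_sq, hn, ← add_div]
    simp [cart, invFun, norm_sq_eq]; ring
  · rw [inversion_z, Complex.div_im, Complex.normSq_eq_norm_sq, hn, ← sub_div]
    simp [cart, invFun, norm_sq_eq]; ring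
  · rw [inversion_t, hn]; simp [cart, invFun]

/-- Quotient rule: `P`, `Q` and `-t` are the numerators of `invFun`, `D` is the common denominator,
and `D0`, `D1`, `D2` are its partial derivatives. -/
def invJac (x : Fin 3 → ℝ) : Matrix (Fin 3) (Fin 3) ℝ :=
  let a := x 0
  let b := x 1
  let t := x 2
  let n := a ^ 2 + b ^ 2
  let D := n ^ 2 + t ^ 2
  let P := -(a * n + b * t)
  let Q := -(b * n - a * t)
  let D0 := 4 * a * n
  let D1 := 4 * b * n
  let D2 := 2 * t
  !![(-(3 * a ^ 2 + b ^ 2) * D - P * D0) / D ^ 2, (-(2 * a * b + t) * D - P * D1) / D ^ 2, (-b * D - P * D2) / D ^ 2;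
     (-(2 * a * b - t) * D - Q * D0) / D ^ 2, (-(a ^ 2 + 3 * b ^ 2) * D - Q * D1) / D ^ 2, (a * D - Q * D2) / D ^ 2;
     t * D0 / D ^ 2, t * D1 / D ^ 2, (-D + t * D2) / D ^ 2]

theorem det_invJac (x : Fin 3 → ℝ) (hD : (x 0 ^ 2 + x 1 ^ 2) ^ 2 + x 2 ^ 2 ≠ 0) :
    (invJac x).det = (((x 0 ^ 2 + x 1 ^ 2) ^ 2 + x 2 ^ 2) ^ 2)⁻¹ := by
  rw [Matrix.det_fin_three]
  simp only [invJac, Matrix.of_apply, Matrix.cons_val', Matrix.cons_val_zero, Matrix.cons_val_one, Matrix.cons_val, Matrix.cons_val_fin_one]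
  generalize x 0 = a at *
  generalize x 1 = b at *
  generalize x 2 = t at *
  field_simp
  ring

theorem hasFDerivAt_invFun (x : Fin 3 → ℝ) (hD : (x 0 ^ 2 + x 1 ^ 2) ^ 2 + x 2 ^ 2 ≠ 0) :
    HasFDerivAt invFun (LinearMap.toContinuousLinearMap (Matrix.toLin' (invJac x))) x := by
  have hp : ∀ i : Fin 3, HasFDerivAt (fun y : Fin 3 → ℝ => y i) (ContinuousLinearMap.proj (R := ℝ) (φ := fun _ : Fin 3 => ℝ) i) x :=
    fun i => hasFDerivAt_apply i x
  have hn := ((hp 0).pow 2).add ((hp 1).pow 2)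
  have hDD := (hn.pow 2).add ((hp 2).pow 2)
  have hI := (hasDerivAt_inv hD).comp_hasFDerivAt x hDD
  have h0 := (((hp 0).mul hn).add ((hp 1).mul (hp 2))).neg.mul hI
  have h1 := (((hp 1).mul hn).sub ((hp 0).mul (hp 2))).neg.mul hI
  have h2 := (hp 2).neg.mul hI
  rw [hasFDerivAt_pi']
  intro i
  fin_cases i
  · refine (h0.congr_fderiv ?_)
    ext v
    simp [invJac, dotProduct, Fin.sum_univ_three]
    field_simp
    ring
  · refine (h1.congr_fderiv ?_)
    ext v
    simp [invJac, dotProduct, Fin.sum_univ_three]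
    field_simp
    ring
  · refine (h2.congr_fderiv ?_)
    ext v
    simp [invJac, dotProduct, Fin.sum_univ_three]
    field_simp
    ring

theorem continuous_mul_left (g : Heis) : Continuous fun h : Heis => g * h :=
  continuous_mk (continuous_const.add continuous_z)
    ((continuous_const.add continuous_t).add
      (continuous_const.mul (Complex.continuous_im.comp (continuous_const.mul continuous_z))))

theorem continuous_mul : Continuous fun p : Heis × Heis => p.1 * p.2 := by
  have h1 := continuous_z.comp (continuous_fst (X := Heis) (Y := Heis))
  have h2 := continuous_z.comp (continuous_snd (X := Heis) (Y := Heis))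
  have h3 := continuous_t.comp (continuous_fst (X := Heis) (Y := Heis))
  have h4 := continuous_t.comp (continuous_snd (X := Heis) (Y := Heis))
  exact continuous_mk (h1.add h2) ((h3.add h4).add
    (continuous_const.mul (Complex.continuous_im.comp ((Complex.continuous_conj.comp h1).mul h2))))

theorem continuous_inv : Continuous fun h : Heis => h⁻¹ :=
  continuous_mk continuous_z.neg continuous_t.neg

theorem continuous_gauge : Continuous gauge := by
  unfold gauge
  exact (((continuous_z.norm).pow 4).add (continuous_t.pow 2)).rpow_const fun _ => Or.inr (by norm_num)

theorem continuous_kd : Continuous fun p : Heis × Heis => kd p.1 p.2 :=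
  continuous_gauge.comp
    (continuous_mul.comp ((continuous_inv.comp continuous_fst).prodMk continuous_snd))

theorem continuous_u : Continuous u := by
  have : u = fun h => ((‖h.z‖ ^ 2 : ℝ) : ℂ) + (h.t : ℂ) * Complex.I := by
    funext h; apply Complex.ext <;> simp [-Complex.ofReal_pow]
  rw [this]
  exact (Complex.continuous_ofReal.comp (continuous_z.norm.pow 2)).add
    ((Complex.continuous_ofReal.comp continuous_t).mul continuous_const)

theorem continuous_X : Continuous X :=
  continuous_const.prodMk (continuous_z.prodMk continuous_u)

theorem continuous_lift (A : V ≃ₗ[ℂ] V) : Continuous fun h => A (X h) :=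
  (LinearMap.continuous_of_finiteDimensional (A : V →ₗ[ℂ] V)).comp continuous_X

theorem continuous_den (A : V ≃ₗ[ℂ] V) : Continuous (den A) := continuous_fst.comp (continuous_lift A)

theorem measurable_mk {α : Type*} [MeasurableSpace α] {f : α → ℂ} {g : α → ℝ}
    (hf : Measurable f) (hg : Measurable g) : Measurable fun a => mk (f a) (g a) :=
  Measurable.prodMk hf hg

theorem measurable_act (A : V ≃ₗ[ℂ] V) : Measurable (act A) := by
  have h := continuous_lift A
  have h1 := h.fst.measurable
  have h2 := h.snd.fst.measurable
  have h3 := h.snd.snd.measurable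
  exact measurable_mk (h2.div h1) (Complex.measurable_im.comp (h3.div h1))

theorem continuousAt_act {A : V ≃ₗ[ℂ] V} {h : Heis} (h0 : den A h ≠ 0) : ContinuousAt (act A) h := by
  have hc := (continuous_lift A)
  have h1 := hc.fst.continuousAt (x := h)
  have h2 := (hc.snd.fst.continuousAt (x := h)).div h1 h0
  have h3 := Complex.continuous_im.continuousAt.comp ((hc.snd.snd.continuousAt (x := h)).div h1 h0)
  exact ContinuousAt.prodMk h2 h3

theorem measurePreserving_mul_left (g : Heis) : MeasurePreserving fun h : Heis => g * h := by
  have h1 : MeasurePreserving (fun w : ℂ => g.z + w) := measurePreserving_add_left volume g.z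
  refine h1.skew_product (μc := (volume : Measure ℝ)) (μd := (volume : Measure ℝ))
    (g := fun w s => g.t + s + 2 * (starRingEnd ℂ g.z * w).im) ?_ ?_
  · have : Continuous fun p : ℂ × ℝ => g.t + p.2 + 2 * (starRingEnd ℂ g.z * p.1).im := by fun_prop
    exact this.measurable
  · refine Filter.Eventually.of_forall fun w => ?_
    have e : (fun s : ℝ => g.t + s + 2 * (starRingEnd ℂ g.z * w).im) =
        fun s => (g.t + 2 * (starRingEnd ℂ g.z * w).im) + s := by funext s; ring
    rw [e]; exact (measurePreserving_add_left volume _).map_eq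

/-- The Jacobian of the action of `A`. -/
def jac (A : V ≃ₗ[ℂ] V) (x : Heis) : ℝ≥0∞ := ENNReal.ofReal ((‖den A x‖ ^ 4)⁻¹)

theorem measurable_jac (A : V ≃ₗ[ℂ] V) : Measurable (jac A) :=
  (((continuous_den A).norm.pow 4).measurable.inv).ennreal_ofReal

/-- Change of variables off the origin in Cartesian coordinates. The determinant is the inverse
square of `‖u‖ ^ 2`, hence equals `jac invl`. -/
theorem lintegral_inversion {f : Heis → ℝ≥0∞} (hf : Measurable f) :
    ∫⁻ x, f (act invl x) * jac invl x = ∫⁻ x, f x := by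
  have hone : (1 : Heis) = cart 0 := ext' (by apply Complex.ext <;> simp [cart]) (by simp [cart])
  have hinj : Function.Injective cart := by
    intro x y e
    have h1 := congrArg (fun h : Heis => h.z.re) e
    have h2 := congrArg (fun h : Heis => h.z.im) e
    have h3 := congrArg (fun h : Heis => h.t) e
    funext i; fin_cases i <;> assumption
  have hD : ∀ x ∈ ({0}ᶜ : Set (Fin 3 → ℝ)), (x 0 ^ 2 + x 1 ^ 2) ^ 2 + x 2 ^ 2 ≠ 0 := by
    intro x hx e
    apply hx
    have h2 : x 2 = 0 := by nlinarith [sq_nonneg (x 2), sq_nonneg (x 0 ^ 2 + x 1 ^ 2)]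
    have h01 : x 0 ^ 2 + x 1 ^ 2 = 0 := by
      have : (x 0 ^ 2 + x 1 ^ 2) ^ 2 = 0 := by rw [h2] at e; simpa using e
      exact pow_eq_zero_iff two_ne_zero |>.mp this
    have h0 : x 0 = 0 := by nlinarith [sq_nonneg (x 0), sq_nonneg (x 1)]
    have h1 : x 1 = 0 := by nlinarith [sq_nonneg (x 0), sq_nonneg (x 1)]
    funext i; fin_cases i <;> assumption
  have hcl : MeasurableSet ({0}ᶜ : Set (Fin 3 → ℝ)) := (measurableSet_singleton 0).compl
  have hae : ({0}ᶜ : Set (Fin 3 → ℝ)) =ᵐ[volume] univ := by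
    rw [ae_eq_univ, compl_compl]; exact measure_singleton 0
  have himg : invFun '' {0}ᶜ = {0}ᶜ := by
    have h1 : ∀ x, x ≠ 0 → invFun x ≠ 0 := by
      intro x hx e
      have h2 := cart_invFun x
      rw [e, ← hone] at h2
      exact hx (hinj ((inversion_eq_one.mp h2.symm).trans hone))
    ext y
    constructor
    · rintro ⟨x, hx, rfl⟩; exact h1 x hx
    · intro hy
      refine ⟨invFun y, h1 y hy, hinj ?_⟩
      rw [cart_invFun, cart_invFun, inversion_inversion]
  have hinjOn : InjOn invFun {0}ᶜ := by
    intro x _ y _ e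
    have := congrArg (fun w => inversion (cart w)) e
    simp only [cart_invFun, inversion_inversion] at this
    exact hinj this
  have key := lintegral_image_eq_lintegral_abs_det_fderiv_mul volume hcl
    (fun x hx => (hasFDerivAt_invFun x (hD x hx)).hasFDerivWithinAt) hinjOn (fun x => f (cart x))
  rw [himg, setLIntegral_congr hae, setLIntegral_univ] at key
  rw [measurePreserving_cart.lintegral_comp hf] at key
  have key2 := measurePreserving_cart.lintegral_comp (f := fun x => f (act invl x) * jac invl x)
    ((hf.comp (measurable_act invl)).mul (measurable_jac invl))
  rw [key, ← key2, ← setLIntegral_univ, ← setLIntegral_congr hae]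
  refine setLIntegral_congr_fun hcl fun x hx => ?_
  have hx1 : cart x ≠ 1 := fun e => hx (hinj (e.trans hone))
  have hn : ‖u (cart x)‖ ^ 2 = (x 0 ^ 2 + x 1 ^ 2) ^ 2 + x 2 ^ 2 := by
    rw [norm_sq_eq, u_re, u_im, norm_sq_eq]; simp [cart]; ring
  have hdet : (LinearMap.toContinuousLinearMap (Matrix.toLin' (invJac x))).det =
      (((x 0 ^ 2 + x 1 ^ 2) ^ 2 + x 2 ^ 2) ^ 2)⁻¹ := by
    rw [← det_invJac x (hD x hx)]
    exact LinearMap.det_toLin' (invJac x)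
  have hact : act invl (cart x) = cart (invFun x) := (act_invl hx1).trans (cart_invFun x).symm
  rw [hdet, hact, mul_comm, jac, den_invl,
    abs_of_nonneg (by positivity), ← hn, ← pow_mul]


/-- A null vector with vanishing first coordinate has vanishing second coordinate, so two of them
are orthogonal, and orthogonal lifts have distance zero. -/
theorem den_eq_zero_unique {A : V ≃ₗ[ℂ] V} (hA : A ∈ modular) {x y : Heis} (hx : den A x = 0)
    (hy : den A y = 0) : x = y := by
  have key : ∀ {w : Heis}, den A w = 0 → (A (X w)).2.1 = 0 := by
    intro w hw
    have h1 := form_map hA (X w) (X w)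
    rw [form_X_self] at h1
    have h2 : (A (X w)).1 = 0 := hw
    simp only [form, h2, map_zero, zero_mul, mul_zero, add_zero, zero_sub, neg_eq_zero,
      mul_eq_zero, OfNat.ofNat_ne_zero, false_or, map_eq_zero, or_self] at h1
    exact h1
  have h1 := form_map hA (X x) (X y)
  have hx' : (A (X x)).1 = 0 := hx
  have hy' : (A (X y)).1 = 0 := hy
  rw [form, hx', hy', key hx, key hy] at h1
  simp only [map_zero, zero_mul, mul_zero, add_zero, sub_zero] at h1
  have h2 := norm_form_X x y
  rw [← h1, norm_zero] at h2
  exact kd_eq_zero.mp (pow_eq_zero_iff two_ne_zero |>.mp h2.symm)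

theorem ae_den_ne_zero {A : V ≃ₗ[ℂ] V} (hA : A ∈ modular) : ∀ᵐ x : Heis, den A x ≠ 0 := by
  have h : ({x | den A x = 0} : Set Heis).Subsingleton := fun x hx y hy =>
    den_eq_zero_unique hA hx hy
  have := h.measure_zero volume
  filter_upwards [measure_eq_zero_iff_ae_notMem.mp this] with x hx
  exact hx

theorem countable_isInt : {c : ℂ | IsInt c}.Countable := by
  have : {c : ℂ | IsInt c} ⊆ range fun p : ℤ × ℤ => (⟨p.1, p.2⟩ : ℂ) := by
    rintro _ ⟨a, b, rfl⟩; exact ⟨(a, b), rfl⟩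
  exact (countable_range _).mono this

theorem countable_lattice : lattice.Countable :=
  countable_isInt.prod (countable_isInt.prod countable_isInt)

theorem countable_modular : (modular : Set (V ≃ₗ[ℂ] V)).Countable := by
  let F (A : V ≃ₗ[ℂ] V) : V × V × V := (A (1, 0, 0), A (0, 1, 0), A (0, 0, 1))
  have hF : Function.Injective F := by
    intro A B e
    have e1 : A (1, 0, 0) = B (1, 0, 0) := congrArg Prod.fst e
    have e2 : A (0, 1, 0) = B (0, 1, 0) := congrArg (fun p => p.2.1) e
    have e3 : A (0, 0, 1) = B (0, 0, 1) := congrArg (fun p => p.2.2) e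
    refine LinearEquiv.ext fun v => ?_
    have hv : v = v.1 • ((1, 0, 0) : V) + v.2.1 • ((0, 1, 0) : V) + v.2.2 • ((0, 0, 1) : V) := by
      simp
    rw [hv]
    simp only [map_add, map_smul, e1, e2, e3]
  have hmaps : MapsTo F modular (lattice ×ˢ lattice ×ˢ lattice) := by
    intro A hA
    exact ⟨map_lattice hA ⟨isInt_one, isInt_zero, isInt_zero⟩,
      map_lattice hA ⟨isInt_zero, isInt_one, isInt_zero⟩,
      map_lattice hA ⟨isInt_zero, isInt_zero, isInt_one⟩⟩
  exact (countable_lattice.prod (countable_lattice.prod countable_lattice)).preimage_of_injOn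
    hF.injOn |>.mono hmaps

theorem countable_integers : (integers : Set Heis).Countable := by
  have : (integers : Set Heis) ⊆ range fun p : ℤ × ℤ × ℤ => mk ⟨p.1, p.2.1⟩ p.2.2 := by
    rintro _ ⟨a, b, c, rfl⟩; exact ⟨(a, b, c), rfl⟩
  exact (countable_range _).mono this

instance : Countable integers := countable_integers.to_subtype

/-- The points at which all elements of the modular group are defined. -/
def generic : Set Heis := {x | ∀ A ∈ modular, den A x ≠ 0}

theorem measurableSet_generic : MeasurableSet generic := by
  have : generic = ⋂ A ∈ (modular : Set (V ≃ₗ[ℂ] V)), {x | den A x ≠ 0} := by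
    ext x; simp [generic]
  rw [this]
  exact MeasurableSet.biInter countable_modular fun A _ =>
    ((isClosed_singleton.preimage (continuous_den A)).measurableSet).compl

theorem ae_generic : ∀ᵐ x : Heis, x ∈ generic := by
  have := (ae_ball_iff countable_modular).mpr fun A (hA : A ∈ modular) => ae_den_ne_zero hA
  filter_upwards [this] with x hx
  exact hx

theorem act_mem_generic {A : V ≃ₗ[ℂ] V} (hA : A ∈ modular) {x : Heis} (hx : x ∈ generic) :
    act A x ∈ generic := by
  intro B hB e
  have h1 := den_mul (A := B) hA (hx A hA)
  rw [e, zero_mul] at h1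
  exact hx _ (mul_mem hB hA) h1

theorem generic_ne_one {x : Heis} (hx : x ∈ generic) : x ≠ 1 := by
  rintro rfl
  exact hx invl invl_mem (u_eq_zero.mpr rfl)

/-- The cocycle rule for `den` is the chain rule for `jac`, so only the generators have to be
checked. -/
theorem lintegral_act {A : V ≃ₗ[ℂ] V} (hA : A ∈ modular) {f : Heis → ℝ≥0∞} (hf : Measurable f) :
    ∫⁻ x, f (act A x) * jac A x = ∫⁻ x, f x := by
  refine modular_induction (p := fun A => ∀ f : Heis → ℝ≥0∞, Measurable f →
    ∫⁻ x, f (act A x) * jac A x = ∫⁻ x, f x) ?_ (fun f hf => lintegral_inversion hf) ?_ ?_ hA f hf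
  · intro f _; simp [jac]
  · intro g _ f hf
    simpa [jac] using (measurePreserving_mul_left g).lintegral_comp hf
  · intro B hB C hC ihB ihC f hf
    have h := ihC (fun x => f (act B x) * jac B x) ((hf.comp (measurable_act B)).mul (measurable_jac B))
    rw [← ihB f hf, ← h]
    refine lintegral_congr_ae ?_
    filter_upwards [ae_den_ne_zero hC] with x hx
    rw [act_mul hC hx, jac, den_mul hC hx, jac, jac, mul_assoc, ← ENNReal.ofReal_mul (by positivity),
      norm_mul, mul_pow, mul_inv]

theorem volume_gauge_le (ρ : ℝ) (hρ : 0 ≤ ρ) :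
    volume {x : Heis | gauge x ≤ ρ} ≤ ENNReal.ofReal (8 * ρ ^ 4) := by
  have hsub : {x : Heis | gauge x ≤ ρ} ⊆ (Metric.closedBall (0 : ℂ) ρ ×ˢ Icc (-ρ ^ 2) (ρ ^ 2) : Set (ℂ × ℝ)) := by
    intro x (hx : gauge x ≤ ρ)
    refine ⟨?_, abs_le.mp ?_⟩
    · rw [mem_closedBall_zero_iff]; exact (norm_z_le x).trans hx
    · exact (abs_t_le x).trans (pow_le_pow_left₀ (gauge_nonneg x) hx 2)
  refine (measure_mono hsub).trans ?_
  have h1 : volume (Metric.closedBall (0 : ℂ) ρ ×ˢ Icc (-ρ ^ 2) (ρ ^ 2) : Set (ℂ × ℝ)) =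
      volume (Metric.closedBall (0 : ℂ) ρ) * volume (Icc (-ρ ^ 2) (ρ ^ 2)) := Measure.prod_prod _ _
  refine h1.le.trans ?_
  rw [Complex.volume_closedBall, Real.volume_Icc, ← ENNReal.ofReal_pow hρ]
  have h2 : (NNReal.pi : ℝ≥0∞) ≤ ENNReal.ofReal 4 := by
    rw [ENNReal.ofReal, ENNReal.coe_le_coe, ← NNReal.coe_le_coe]
    simpa using Real.pi_le_four
  calc _ ≤ ENNReal.ofReal (ρ ^ 2) * ENNReal.ofReal 4 * ENNReal.ofReal (ρ ^ 2 - -ρ ^ 2) := by gcongr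
    _ = ENNReal.ofReal (8 * ρ ^ 4) := by
      rw [← ENNReal.ofReal_mul (by positivity), ← ENNReal.ofReal_mul (by positivity)]
      congr 1; ring

/-! ### The invariant measure on pairs of points -/

/-- The density of the invariant measure on pairs of points. -/
def pairDensity (p : Heis × Heis) : ℝ≥0∞ := ENNReal.ofReal ((kd p.1 p.2 ^ 8)⁻¹)

theorem measurable_pairDensity : Measurable pairDensity :=
  ((continuous_kd.pow 8).measurable.inv).ennreal_ofReal

/-- The measure `dx dy / d(x, y)⁸`, which is invariant under the modular group. -/
def pairMeasure : Measure (Heis × Heis) := (volume.prod volume).withDensity pairDensity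

theorem pairMeasure_apply {s : Set (Heis × Heis)} (hs : MeasurableSet s) :
    pairMeasure s = ∫⁻ x, ∫⁻ y, s.indicator pairDensity (x, y) := by
  rw [pairMeasure, withDensity_apply _ hs, ← lintegral_indicator hs,
    lintegral_prod _ (measurable_pairDensity.indicator hs).aemeasurable]

/-- The exponent 8 is forced: `kd ^ 2` changes by one factor `‖den‖` for each point, and each
Jacobian is `‖den‖ ^ (-4)`. -/
theorem pairDensity_act {A : V ≃ₗ[ℂ] V} (hA : A ∈ modular) {x y : Heis} (hx : den A x ≠ 0)
    (hy : den A y ≠ 0) :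
    pairDensity (x, y) = pairDensity (act A x, act A y) * jac A y * jac A x := by
  rw [pairDensity, pairDensity, jac, jac, ← ENNReal.ofReal_mul (by positivity),
    ← ENNReal.ofReal_mul (by positivity)]
  congr 1
  have e : kd x y ^ 8 = (kd x y ^ 2) ^ 4 := by ring
  simp only
  rw [e, ← kd_act hA hx hy]
  rw [mul_pow, mul_pow, mul_inv, mul_inv]
  ring

theorem measurable_act_prod (A : V ≃ₗ[ℂ] V) :
    Measurable fun p : Heis × Heis => (act A p.1, act A p.2) :=
  ((measurable_act A).comp measurable_fst).prodMk ((measurable_act A).comp measurable_snd)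

theorem pairMeasure_preimage_act {A : V ≃ₗ[ℂ] V} (hA : A ∈ modular) {s : Set (Heis × Heis)}
    (hs : MeasurableSet s) :
    pairMeasure {p | (act A p.1, act A p.2) ∈ s} = pairMeasure s := by
  have h := pairMeasure_apply (s := {p | (act A p.1, act A p.2) ∈ s}) (measurable_act_prod A hs)
  rw [pairMeasure_apply hs, h]
  have hm := measurable_pairDensity.indicator hs
  have hΦ : Measurable fun x => ∫⁻ y, s.indicator pairDensity (x, y) := hm.lintegral_prod_right'
  rw [← lintegral_act hA hΦ]
  refine lintegral_congr_ae ?_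
  filter_upwards [ae_den_ne_zero hA] with x hx
  have h1 : Measurable fun y => s.indicator pairDensity (act A x, y) := hm.comp measurable_prodMk_left
  have hmeas : Measurable fun y => s.indicator pairDensity (act A x, act A y) * jac A y :=
    (h1.comp (measurable_act A)).mul (measurable_jac A)
  rw [← lintegral_act hA h1, ← lintegral_mul_const _ hmeas]
  refine lintegral_congr_ae ?_
  filter_upwards [ae_den_ne_zero hA] with y hy
  by_cases hmem : (act A x, act A y) ∈ s
  · rw [indicator_of_mem hmem, indicator_of_mem (by exact hmem), pairDensity_act hA hx hy]
  · rw [indicator_of_notMem hmem, indicator_of_notMem (by exact hmem), zero_mul, zero_mul]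

/-- With `x` translated to the origin, the density `gauge ^ (-8)` is the Jacobian of the inversion,
so the integral is the volume of the ball of radius `1 / c`. -/
theorem lintegral_pairDensity_le (x : Heis) {c : ℝ} (hc : 0 < c) :
    ∫⁻ y, {y | c ≤ kd x y}.indicator (fun y => pairDensity (x, y)) y ≤
      ENNReal.ofReal (8 * (1 / c) ^ 4) := by
  have hms : MeasurableSet {h : Heis | gauge h ≤ 1 / c} :=
    (isClosed_le continuous_gauge continuous_const).measurableSet
  have hm2 : MeasurableSet {h : Heis | c ≤ gauge h} :=
    (isClosed_le continuous_const continuous_gauge).measurableSet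
  have hmf : Measurable ({h : Heis | c ≤ gauge h}.indicator
      fun h => ENNReal.ofReal ((gauge h ^ 8)⁻¹)) :=
    (((continuous_gauge.pow 8).measurable.inv).ennreal_ofReal).indicator hm2
  have h1 := (measurePreserving_mul_left x⁻¹).lintegral_comp hmf
  refine (le_of_eq ?_).trans (volume_gauge_le (1 / c) (by positivity))
  have h0 : ∫⁻ y, {y | c ≤ kd x y}.indicator (fun y => pairDensity (x, y)) y =
      ∫⁻ y, ({h : Heis | c ≤ gauge h}.indicator
      fun h => ENNReal.ofReal ((gauge h ^ 8)⁻¹)) (x⁻¹ * y) := lintegral_congr fun y => rfl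
  rw [h0, h1, ← lintegral_indicator_one hms, ← lintegral_act invl_mem (measurable_one.indicator hms)]
  refine lintegral_congr_ae ?_
  filter_upwards [ae_generic] with y hy
  have hy1 := generic_ne_one hy
  have hpos := gauge_pos hy1
  have hiff : act invl y ∈ {h : Heis | gauge h ≤ 1 / c} ↔ y ∈ {h : Heis | c ≤ gauge h} := by
    rw [act_invl hy1, mem_ofPred_eq, gauge_inversion, mem_ofPred_eq, one_div,
      inv_le_inv₀ hpos hc]
  by_cases hmem : y ∈ {h : Heis | c ≤ gauge h}
  · rw [indicator_of_mem hmem, indicator_of_mem (hiff.mpr hmem), Pi.one_apply, one_mul, jac,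
      den_invl, ← gauge_sq, ← pow_mul]
  · rw [indicator_of_notMem hmem, indicator_of_notMem (fun h => hmem (hiff.mp h)), zero_mul]

end

section

/-! ### Neighbourhoods of a piecewise smooth boundary -/

theorem volume_closedBall_le (a : ℂ × ℝ) {R : ℝ} (hR : 0 ≤ R) :
    volume (Metric.closedBall a R) ≤ ENNReal.ofReal (8 * R ^ 3) := by
  have h1 : volume (Metric.closedBall a R) =
      volume (Metric.closedBall a.1 R) * volume (Metric.closedBall a.2 R) := by
    rw [← closedBall_prod_same]; exact Measure.prod_prod _ _
  rw [h1, Complex.volume_closedBall, Real.volume_closedBall, ← ENNReal.ofReal_pow hR]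
  have h2 : (NNReal.pi : ℝ≥0∞) ≤ ENNReal.ofReal 4 := by
    rw [ENNReal.ofReal, ENNReal.coe_le_coe, ← NNReal.coe_le_coe]
    simpa using Real.pi_le_four
  calc _ ≤ ENNReal.ofReal (R ^ 2) * ENNReal.ofReal 4 * ENNReal.ofReal (2 * R) := by gcongr
    _ = ENNReal.ofReal (8 * R ^ 3) := by
      rw [← ENNReal.ofReal_mul (by positivity), ← ENNReal.ofReal_mul (by positivity)]
      congr 1; ring

/-- By the Lipschitz bound, `O(ρ⁻²)` balls of radius `O(ρ)` cover the thickened surface, and each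
has volume `O(ρ³)`. -/
theorem exists_volume_thickening_surface_le {f : ℝ × ℝ → ℂ × ℝ} (hf : ContDiff ℝ ∞ f) :
    ∃ C : ℝ, 0 ≤ C ∧ ∀ ρ : ℝ, 0 < ρ → ρ ≤ 1 →
      volume {a : ℂ × ℝ | ∃ p ∈ Icc (0 : ℝ) 1 ×ˢ Icc (0 : ℝ) 1, dist a (f p) ≤ 3 * ρ} ≤
        ENNReal.ofReal (C * ρ) := by
  obtain ⟨Λ, hΛ⟩ := (hf.contDiffOn (s := Icc (0 : ℝ) 1 ×ˢ Icc (0 : ℝ) 1)).exists_lipschitzOnWith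
    (by simp) ((convex_Icc _ _).prod (convex_Icc _ _)) (isCompact_Icc.prod isCompact_Icc)
  refine ⟨9 * (8 * (3 + Λ) ^ 3), by positivity, fun ρ hρ hρ1 => ?_⟩
  obtain ⟨m, hm⟩ : ∃ m : ℕ, 1 / ρ ≤ m ∧ (m : ℝ) < 1 / ρ + 1 :=
    ⟨⌈1 / ρ⌉₊, Nat.le_ceil _, Nat.ceil_lt_add_one (by positivity)⟩
  have hm0 : (0 : ℝ) < m := lt_of_lt_of_le (by positivity) hm.1
  have hmρ : 1 / (m : ℝ) ≤ ρ := by rw [div_le_iff₀ hm0, mul_comm]; exact (div_le_iff₀ hρ).mp hm.1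
  let q (j : ℕ × ℕ) : ℝ × ℝ := (j.1 / m, j.2 / m)
  have hround : ∀ s : ℝ, s ∈ Icc (0 : ℝ) 1 → ∃ j ∈ Finset.range (m + 1), (j : ℝ) / m ∈ Icc (0 : ℝ) 1 ∧
      |s - j / m| ≤ 1 / m := by
    intro s hs
    have h0 : 0 ≤ s * m := mul_nonneg hs.1 hm0.le
    have h1 := Nat.floor_le h0
    have h2 := Nat.lt_floor_add_one (s * m)
    have h3 : s * m ≤ m := mul_le_of_le_one_left hm0.le hs.2
    refine ⟨⌊s * m⌋₊, ?_, ⟨by positivity, ?_⟩, ?_⟩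
    · rw [Finset.mem_range, Nat.lt_succ_iff]
      exact Nat.floor_le_of_le h3
    · rw [div_le_one hm0]; linarith
    · have : s - ⌊s * m⌋₊ / m = (s * m - ⌊s * m⌋₊) / m := by field_simp
      rw [this, abs_of_nonneg (div_nonneg (by linarith) hm0.le)]
      gcongr; linarith
  have hsub : {a : ℂ × ℝ | ∃ p ∈ Icc (0 : ℝ) 1 ×ˢ Icc (0 : ℝ) 1, dist a (f p) ≤ 3 * ρ} ⊆
      ⋃ j ∈ Finset.range (m + 1) ×ˢ Finset.range (m + 1),
        Metric.closedBall (f (q j)) ((3 + Λ) * ρ) := by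
    rintro a ⟨p, hp, hd⟩
    obtain ⟨j1, hj1, hj1', h1⟩ := hround p.1 hp.1
    obtain ⟨j2, hj2, hj2', h2⟩ := hround p.2 hp.2
    simp only [mem_iUnion]
    refine ⟨(j1, j2), Finset.mem_product.mpr ⟨hj1, hj2⟩, ?_⟩
    rw [Metric.mem_closedBall]
    have h3 := hΛ.dist_le_mul p hp (q (j1, j2)) ⟨hj1', hj2'⟩
    have h4 : dist p (q (j1, j2)) ≤ ρ := by
      rw [Prod.dist_eq]
      exact max_le (by rw [Real.dist_eq]; exact h1.trans hmρ) (by rw [Real.dist_eq]; exact h2.trans hmρ)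
    have h5 : (Λ : ℝ) * dist p (q (j1, j2)) ≤ Λ * ρ := by gcongr
    linarith [dist_triangle a (f p) (f (q (j1, j2)))]
  refine (measure_mono hsub).trans ((measure_biUnion_finset_le _ _).trans ?_)
  refine (Finset.sum_le_sum fun j _ => volume_closedBall_le (f (q j))
    (R := (3 + Λ) * ρ) (by positivity)).trans ?_
  rw [Finset.sum_const, nsmul_eq_mul, Finset.card_product, Finset.card_range,
    ← ENNReal.ofReal_natCast, ← ENNReal.ofReal_mul (by positivity)]
  refine ENNReal.ofReal_le_ofReal ?_
  push_cast
  have h6 : ((m : ℝ) + 1) * ρ ≤ 3 := by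
    have : (m : ℝ) * ρ ≤ 1 + ρ := by
      have := hm.2.le
      calc (m : ℝ) * ρ ≤ (1 / ρ + 1) * ρ := by gcongr
        _ = 1 + ρ := by field_simp
    linarith
  have h7 : 0 ≤ ((m : ℝ) + 1) * ρ := by positivity
  have h8 : (((m : ℝ) + 1) * ρ) ^ 2 ≤ 9 := by nlinarith
  calc ((m : ℝ) + 1) * (m + 1) * (8 * ((3 + Λ) * ρ) ^ 3)
      = (((m : ℝ) + 1) * ρ) ^ 2 * (8 * (3 + Λ) ^ 3 * ρ) := by ring
    _ ≤ 9 * (8 * (3 + Λ) ^ 3 * ρ) := by gcongr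
    _ = _ := by ring

theorem exists_frontier_mem_segment {A : Set (ℂ × ℝ)} {a x : ℂ × ℝ} (ha : a ∈ A) (hx : x ∉ A) :
    ∃ p ∈ frontier A, dist a p ≤ dist a x := by
  by_contra! hcon
  have hseg : segment ℝ a x ⊆ interior A ∪ (closure A)ᶜ := by
    intro p hp
    have h1 : dist a p ≤ dist a x := by
      have := dist_add_dist_of_mem_segment hp
      linarith [dist_nonneg (x := p) (y := x)]
    by_contra h2
    rw [mem_union, not_or, mem_compl_iff, not_not] at h2
    exact (hcon p ⟨h2.2, h2.1⟩).not_ge h1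
  have h3 := (convex_segment (𝕜 := ℝ) a x).isPreconnected _ _ isOpen_interior isClosed_closure.isOpen_compl hseg
    ⟨a, left_mem_segment ℝ a x, (hseg (left_mem_segment ℝ a x)).resolve_right
      fun h => h (subset_closure ha)⟩
    ⟨x, right_mem_segment ℝ a x, (hseg (right_mem_segment ℝ a x)).resolve_left
      fun h => hx (interior_subset h)⟩
  obtain ⟨p, -, hp1, hp2⟩ := h3
  exact hp2 (subset_closure (interior_subset hp1))

/-! ### Measure and topology of a small domain -/

/-- The domains of the theorem, with an explicit bound on their radius. -/
structure IsSmallDomain (K : Set Heis) (r : ℝ) : Prop where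
  dom : IsFundamentalDomain K
  pos : 0 < r
  lt_one : r < 1
  gauge_le : ∀ h ∈ K, gauge h ≤ r

theorem exists_isSmallDomain {K : Set Heis} (hK : IsFundamentalDomain K) (hrad : rad K < 1) :
    ∃ r, IsSmallDomain K r := by
  have hle : ∀ h ∈ K, ENNReal.ofReal h.gauge ≤ rad K := fun h hh =>
    le_iSup₂ (f := fun (h : Heis) (_ : h ∈ K) => ENNReal.ofReal h.gauge) h hh
  obtain ⟨s, hs1, hs2⟩ := exists_between hrad
  have hst : s ≠ ⊤ := (hs2.trans ENNReal.one_lt_top).ne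
  refine ⟨s.toReal, hK, ?_, ?_, fun h hh => ?_⟩
  · exact ENNReal.toReal_pos (ne_bot_of_gt hs1) hst
  · simpa using (ENNReal.toReal_lt_toReal hst ENNReal.one_ne_top).mpr hs2
  · exact (ENNReal.ofReal_le_iff_le_toReal hst).mp ((hle h hh).trans hs1.le)

variable {K : Set Heis} {r : ℝ}

/-- The points of `K` that avoid its boundary and the exceptional points of the modular group. -/
def core (K : Set Heis) : Set Heis := interior K ∩ generic

theorem core_subset : core K ⊆ K := fun _ h => interior_subset h.1

theorem measurableSet_core : MeasurableSet (core K) :=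
  isOpen_interior.measurableSet.inter measurableSet_generic

namespace IsSmallDomain

variable (D : IsSmallDomain K r)
include D

theorem digit_unique {g h : Heis} (hg : g ∈ integers) (hh : h ∈ integers) {x : Heis}
    (h1 : g⁻¹ * x ∈ K) (h2 : h⁻¹ * x ∈ K) : g = h := by
  rw [← floor_eq D.dom hg ⟨_, h1, mul_inv_cancel_left g x⟩,
    floor_eq D.dom hh ⟨_, h2, mul_inv_cancel_left h x⟩]

theorem exists_digit (x : Heis) : ∃ g ∈ integers, g⁻¹ * x ∈ K :=
  ⟨_, (floor_spec D.dom x).1, floor_inv_mul_mem D.dom x⟩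

/-- A point of gauge less than `1 - r` has a digit of gauge less than 1, and the only such integer
is the identity. -/
theorem one_mem_interior : (1 : Heis) ∈ interior K := by
  have hopen : IsOpen {h : Heis | gauge h < 1 - r} := isOpen_lt continuous_gauge continuous_const
  refine mem_interior.mpr ⟨{h | gauge h < 1 - r}, fun h hh => ?_, hopen, by simpa using D.lt_one⟩
  obtain ⟨g, hg, hgK⟩ := D.exists_digit h
  have h1 : gauge g < 1 := by
    have := gauge_mul_le h (g⁻¹ * h)⁻¹
    rw [gauge_inv, mul_inv_rev, inv_inv, mul_inv_cancel_left] at this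
    have hh' : gauge h < 1 - r := hh
    linarith [D.gauge_le _ hgK]
  have h2 : g = 1 := by
    by_contra h; exact absurd (one_le_gauge hg h) (not_le.mpr h1)
  simpa [h2] using hgK

theorem isCompact_closure : IsCompact (closure K) := by
  have hc : IsCompact (Metric.closedBall (0 : ℂ) 1 ×ˢ Icc (-1 : ℝ) 1 : Set (ℂ × ℝ)) :=
    (isCompact_closedBall _ _).prod isCompact_Icc
  have hsub : K ⊆ (Metric.closedBall (0 : ℂ) 1 ×ˢ Icc (-1 : ℝ) 1 : Set (ℂ × ℝ)) := by
    intro x hx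
    have h1 := (D.gauge_le x hx).trans D.lt_one.le
    refine ⟨?_, abs_le.mp ?_⟩
    · rw [mem_closedBall_zero_iff]; exact (norm_z_le x).trans h1
    · exact (abs_t_le x).trans (pow_le_one₀ (gauge_nonneg x) h1)
  exact IsCompact.closure_of_subset (X := ℂ × ℝ) hc hsub

theorem gauge_le_closure {x : Heis} (hx : x ∈ closure K) : gauge x ≤ r :=
  closure_minimal (t := {h | gauge h ≤ r}) (fun h hh => D.gauge_le h hh)
    (isClosed_le continuous_gauge continuous_const) hx

/-- On bounded sets a small gauge distance gives a small Euclidean distance, here with factor 3, and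
the segment from a point of `K` to a point outside meets the frontier. -/
theorem exists_volume_boundary_le : ∃ C : ℝ, 0 ≤ C ∧ ∀ ρ : ℝ, 0 < ρ → ρ ≤ 1 →
    volume (frontier K ∪ {a | a ∈ K ∧ ∃ x ∉ K, kd a x < ρ}) ≤ ENNReal.ofReal (C * ρ) := by
  obtain ⟨n, f, hf, hfr⟩ := D.dom.boundary
  choose C hC0 hC using fun i => exists_volume_thickening_surface_le (hf i)
  refine ⟨∑ i, C i, Finset.sum_nonneg fun i _ => hC0 i, fun ρ hρ hρ1 => ?_⟩
  have hsub : frontier K ∪ {a | a ∈ K ∧ ∃ x ∉ K, kd a x < ρ} ⊆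
      ⋃ i, ({a : ℂ × ℝ | ∃ p ∈ Icc (0 : ℝ) 1 ×ˢ Icc (0 : ℝ) 1, dist a (f i p) ≤ 3 * ρ} : Set (ℂ × ℝ)) := by
    have key : ∀ a q : Heis, q ∈ frontier K → dist (α := ℂ × ℝ) a q ≤ 3 * ρ → a ∈
      ⋃ i, ({a : ℂ × ℝ | ∃ p ∈ Icc (0 : ℝ) 1 ×ˢ Icc (0 : ℝ) 1, dist a (f i p) ≤ 3 * ρ} : Set (ℂ × ℝ)) := by
      intro a q hq hd
      rw [hfr] at hq
      obtain ⟨i, p, hp, e⟩ := mem_iUnion.mp hq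
      refine mem_iUnion.mpr ⟨i, p, hp, ?_⟩
      rw [e]; exact hd
    rintro a (ha | ⟨ha, x, hx, hd⟩)
    · exact key a a ha ((dist_self (α := ℂ × ℝ) a).trans_le (by positivity))
    · obtain ⟨q, hq, hdq⟩ := exists_frontier_mem_segment (A := K) ha hx
      refine key a q hq (hdq.trans ?_)
      have hz : (a⁻¹ * x).z = x.z - a.z := by simp; ring
      have ht : x.t - a.t = (a⁻¹ * x).t + 2 * (starRingEnd ℂ a.z * (a⁻¹ * x).z).im := by
        simp; ring
      have h1 : ‖(a⁻¹ * x).z‖ ≤ ρ := (norm_z_le _).trans hd.le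
      have h2 : |(a⁻¹ * x).t| ≤ ρ := (abs_t_le _).trans (by
        have h0 := gauge_nonneg (a⁻¹ * x)
        have : gauge (a⁻¹ * x) < ρ := hd
        nlinarith)
      have h3 : |(starRingEnd ℂ a.z * (a⁻¹ * x).z).im| ≤ ρ := by
        refine (Complex.abs_im_le_norm _).trans ?_
        rw [norm_mul, Complex.norm_conj]
        have h4 : ‖a.z‖ ≤ 1 := (norm_z_le a).trans ((D.gauge_le a ha).trans D.lt_one.le)
        calc _ ≤ 1 * ρ := mul_le_mul h4 h1 (norm_nonneg _) zero_le_one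
          _ = ρ := one_mul ρ
      have h5 : dist a.z x.z ≤ 3 * ρ := by
        rw [dist_comm, dist_eq_norm, ← hz]; linarith
      have h6 : dist a.t x.t ≤ 3 * ρ := by
        rw [dist_comm, Real.dist_eq, ht]
        refine (abs_add_le _ _).trans ?_
        rw [abs_mul, abs_two]; linarith
      exact max_le h5 h6
  refine (measure_mono hsub).trans ((measure_iUnion_fintype_le _ _).trans ?_)
  refine (Finset.sum_le_sum fun i _ => hC i ρ hρ hρ1).trans ?_
  rw [← ENNReal.ofReal_sum_of_nonneg fun i _ => mul_nonneg (hC0 i) hρ.le, Finset.sum_mul]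

theorem volume_frontier : volume (frontier K) = 0 := by
  obtain ⟨C, hC0, hC⟩ := D.exists_volume_boundary_le
  refine le_antisymm (ENNReal.le_of_forall_pos_le_add fun ε hε _ => ?_) zero_le
  have h := hC (min 1 (ε / (C + 1))) (lt_min one_pos (by positivity)) (min_le_left _ _)
  refine (measure_mono subset_union_left).trans (h.trans ?_)
  rw [zero_add, ← ENNReal.ofReal_coe_nnreal]
  refine ENNReal.ofReal_le_ofReal ?_
  calc C * min 1 (ε / (C + 1)) ≤ (C + 1) * (ε / (C + 1)) :=
        mul_le_mul (by linarith) (min_le_right _ _) (by positivity) (by positivity)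
    _ = ε := by field_simp

theorem volume_diff_core : volume (K \ core K) = 0 := by
  refine measure_mono_null (t := frontier K ∪ genericᶜ) ?_
    (measure_union_null D.volume_frontier (mem_ae_iff.mp ae_generic))
  rintro x ⟨hx, hn⟩
  by_cases hg : x ∈ generic
  · exact Or.inl ⟨subset_closure hx, fun hi => hn ⟨hi, hg⟩⟩
  · exact Or.inr hg

theorem volume_core_pos : 0 < volume (core K) := by
  have h1 : 0 < volume (interior K) := isOpen_interior.measure_pos _ ⟨1, D.one_mem_interior⟩
  refine h1.trans_le (measure_mono_ae ?_)
  filter_upwards [ae_generic] with x hx hi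
  exact ⟨hi, hx⟩

theorem volume_lt_top : volume K < ⊤ :=
  (measure_mono subset_closure).trans_lt D.isCompact_closure.measure_lt_top

theorem nullMeasurableSet : NullMeasurableSet K := by
  refine NullMeasurableSet.congr (s := core K) measurableSet_core.nullMeasurableSet ?_
  refine (ae_eq_set).mpr ⟨?_, D.volume_diff_core⟩
  rw [sdiff_eq_empty.mpr core_subset, measure_empty]

end IsSmallDomain

end

section

/-! ### A finiteness property of the modular group -/

theorem finite_isInt_norm_le (R : ℝ) : {c : ℂ | IsInt c ∧ ‖c‖ ≤ R}.Finite := by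
  refine (((finite_Icc (-⌈R⌉) ⌈R⌉).prod (finite_Icc (-⌈R⌉) ⌈R⌉)).image
    fun p : ℤ × ℤ => (⟨p.1, p.2⟩ : ℂ)).subset ?_
  rintro _ ⟨⟨a, b, rfl⟩, h⟩
  have key : ∀ m : ℤ, |(m : ℝ)| ≤ R → m ∈ Icc (-⌈R⌉) ⌈R⌉ := by
    intro m hm
    have h1 := hm.trans (Int.le_ceil R)
    rw [← Int.cast_abs, Int.cast_le] at h1
    exact abs_le.mp h1
  exact ⟨(a, b), ⟨key a ((Complex.abs_re_le_norm _).trans h), key b ((Complex.abs_im_le_norm _).trans h)⟩, rfl⟩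

theorem finite_lattice_norm_le (R : ℝ) : {v : V | v ∈ lattice ∧ ‖v‖ ≤ R}.Finite := by
  refine ((finite_isInt_norm_le R).prod ((finite_isInt_norm_le R).prod
    (finite_isInt_norm_le R))).subset ?_
  rintro v ⟨⟨h1, h2, h3⟩, h⟩
  have h4 := (norm_snd_le v).trans h
  exact ⟨⟨h1, (norm_fst_le v).trans h⟩, ⟨h2, (norm_fst_le v.2).trans h4⟩,
    ⟨h3, (norm_snd_le v.2).trans h4⟩⟩

theorem snd_eq_zero_of_form_self {v : V} (hv : form v v = 0) (h1 : v.1 = 0) : v.2.1 = 0 := by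
  simp only [form, h1, map_zero, zero_mul, mul_zero, add_zero, zero_sub, neg_eq_zero,
    mul_eq_zero, OfNat.ofNat_ne_zero, false_or, map_eq_zero, or_self] at hv
  exact hv

/-- A null vector `v` with `v.1 ≠ 0` is `v.1 • X c`, and its forms with `X a` and `X b` have norms
`‖v.1‖ * kd c a ^ 2` and `‖v.1‖ * kd c b ^ 2`. Integrality gives `1 ≤ ‖v.1‖`, which keeps `c` near
`a`. As `a` and `b` are separated, `c` is at least `1 / 2` away from one of them, which bounds
`‖v.1‖`. -/
theorem norm_le_of_form_le {v : V} (hv : v ∈ lattice) (h0 : form v v = 0) {a b : Heis} {C : ℝ}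
    (hC : 1 ≤ C) (ha : gauge a ≤ 1) (hab : 1 ≤ kd a b) (hfa : ‖form v (X a)‖ ≤ C)
    (hfb : ‖form v (X b)‖ ≤ C) : ‖v‖ ≤ 4 * C * (1 + C) ^ 2 := by
  have hbig : C ≤ 4 * C * (1 + C) ^ 2 := by nlinarith [sq_nonneg C]
  by_cases h1 : v.1 = 0
  · have h2 := snd_eq_zero_of_form_self h0 h1
    have h3 : ‖v.2.2‖ ≤ C := by
      have : form v (X a) = starRingEnd ℂ v.2.2 := by simp [form, X, h1, h2]
      rwa [this, Complex.norm_conj] at hfa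
    refine norm_prod_le_iff.mpr ⟨?_, norm_prod_le_iff.mpr ⟨?_, h3.trans hbig⟩⟩
    · rw [h1, norm_zero]; linarith
    · rw [h2, norm_zero]; linarith
  · obtain ⟨c, hc⟩ : ∃ c, v = v.1 • X c := ⟨_, eq_smul_X h0 h1⟩
    have hn : 1 ≤ ‖v.1‖ := hv.1.one_le_norm h1
    have key : ∀ k, ‖form v (X k)‖ = ‖v.1‖ * kd c k ^ 2 := by
      intro k
      conv_lhs => rw [hc]
      rw [form_smul_left, norm_mul, norm_form_X, Complex.norm_conj]
    rw [key] at hfa hfb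
    have hca : kd c a ≤ C := by nlinarith [kd_nonneg c a, sq_nonneg (kd c a - 1)]
    have hgc : gauge c ≤ 1 + C := by
      have := gauge_le_add_kd a c
      rw [kd_comm] at this; linarith
    have hV1 : ‖v.1‖ ≤ 4 * C := by
      have h3 := kd_triangle a c b
      rw [kd_comm a c] at h3
      rcases le_total (1 / 2) (kd c a) with h | h
      · have h5 : 1 / 4 ≤ kd c a ^ 2 := by nlinarith
        nlinarith [mul_le_mul_of_nonneg_left h5 (norm_nonneg v.1)]
      · have h5 : 1 / 4 ≤ kd c b ^ 2 := by nlinarith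
        nlinarith [mul_le_mul_of_nonneg_left h5 (norm_nonneg v.1)]
    have hz : ‖c.z‖ ≤ (1 + C) ^ 2 := (norm_z_le c).trans (hgc.trans (by nlinarith))
    have hu : ‖u c‖ ≤ (1 + C) ^ 2 := by
      rw [← gauge_sq]; exact pow_le_pow_left₀ (gauge_nonneg c) hgc 2
    rw [hc, norm_smul]
    refine mul_le_mul hV1 ?_ (norm_nonneg _) (by positivity)
    refine norm_prod_le_iff.mpr ⟨?_, norm_prod_le_iff.mpr ⟨hz, hu⟩⟩
    rw [X, norm_one]; nlinarith

/-- The elements of the modular group that neither move nor distort a fixed configuration of pairs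
of points much. -/
def moderate (C : ℝ) : Set (V ≃ₗ[ℂ] V) :=
  {A | A ∈ modular ∧ ∃ a b : Heis, den A a ≠ 0 ∧ den A b ≠ 0 ∧ gauge a ≤ 1 ∧ gauge (act A a) ≤ 1 ∧
    gauge b ≤ 3 ∧ gauge (act A b) ≤ 3 ∧ 1 ≤ kd a b ∧ 1 ≤ kd (act A a) (act A b) ∧
    C⁻¹ ≤ ‖den A a‖ ∧ ‖den A a‖ ≤ C}

theorem linearEquiv_ext_three {A B : V ≃ₗ[ℂ] V} (e1 : A (1, 0, 0) = B (1, 0, 0))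
    (e2 : A (1, 1, 1) = B (1, 1, 1)) (e3 : A (0, 0, 1) = B (0, 0, 1)) : A = B := by
  refine LinearEquiv.ext fun v => ?_
  have hv : v = (v.1 - v.2.1) • ((1, 0, 0) : V) + v.2.1 • ((1, 1, 1) : V) +
      (v.2.2 - v.2.1) • ((0, 0, 1) : V) := by simp
  rw [hv]
  simp only [map_add, map_smul, e1, e2, e3]

/-- Discreteness of the modular group. An element is determined by the images of three null lattice
vectors: the lifts of the origin and of `(1, 0)`, and the vector at infinity. Invariance of the form
bounds the forms of these images with two separated points, which leaves finitely many lattice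
vectors. -/
theorem finite_moderate {C : ℝ} (hC : 1 ≤ C) : (moderate C).Finite := by
  have hfin := finite_lattice_norm_le (4 * (4096 * C) * (1 + 4096 * C) ^ 2)
  refine Finite.of_finite_image (f := fun A : V ≃ₗ[ℂ] V => (A (1, 0, 0), A (1, 1, 1), A (0, 0, 1)))
    ((hfin.prod (hfin.prod hfin)).subset ?_) ?_
  · rintro _ ⟨A, ⟨hA, a, b, ha0, hb0, ha, ha', hb, hb', hab, hab', hd1, hd2⟩, rfl⟩
    -- The bound on `den` at `a` passes to `b` by `kd_act`, since the pair and its image have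
    -- comparable distances; 256 is not sharp.
    have hsb : ‖den A b‖ * C * 256 ≥ 1 ∧ C > 0 ∧ 0 < ‖den A b‖ := by
      have h1 := kd_act hA ha0 hb0
      have h2 : kd (act A a) (act A b) ≤ 4 := (kd_le_add _ _).trans (by linarith)
      have h3 : 0 < ‖den A b‖ := norm_pos_iff.mpr hb0
      have h4 : 0 < ‖den A a‖ := norm_pos_iff.mpr ha0
      refine ⟨?_, by linarith, h3⟩
      have h5 : kd (act A a) (act A b) ^ 2 ≤ 16 := by nlinarith
      have h6 : 1 ≤ kd a b ^ 2 := by nlinarith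
      have h7 : ‖den A a‖ * ‖den A b‖ ≤ C * ‖den A b‖ := by gcongr
      nlinarith [mul_pos h4 h3]
    have hda : 1 ≤ ‖den A a‖ * C := by
      rw [inv_le_iff_one_le_mul₀ (by linarith)] at hd1; linarith
    have key : ∀ e : V, e ∈ lattice → form e e = 0 → (∀ k, gauge k ≤ 3 → ‖form e (X k)‖ ≤ 16) →
        A e ∈ {v : V | v ∈ lattice ∧ ‖v‖ ≤ 4 * (4096 * C) * (1 + 4096 * C) ^ 2} := by
      intro e he h0 hk
      refine ⟨map_lattice hA he, ?_⟩
      have hform : ∀ k, den A k ≠ 0 → ‖den A k‖ * ‖form (A e) (X (act A k))‖ = ‖form e (X k)‖ := by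
        intro k hk0
        rw [← form_map hA e (X k), act_spec hA hk0, form_smul_right, norm_mul]
      have h1 := hform a ha0
      have h2 := hform b hb0
      have h3 := hk a (by linarith)
      have h4 := hk b hb
      refine norm_le_of_form_le (a := act A a) (b := act A b) (map_lattice hA he)
        (by rw [form_map hA, h0]) (by linarith) ha' hab' ?_ ?_
      · have h5 := norm_nonneg (form (A e) (X (act A a)))
        nlinarith [mul_nonneg (by linarith : (0 : ℝ) ≤ C) h5]
      · have h5 := norm_nonneg (form (A e) (X (act A b)))
        calc ‖form (A e) (X (act A b))‖ ≤ (‖den A b‖ * C * 256) * ‖form (A e) (X (act A b))‖ :=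
              le_mul_of_one_le_left h5 hsb.1
          _ = 256 * C * (‖den A b‖ * ‖form (A e) (X (act A b))‖) := by ring
          _ ≤ 256 * C * 16 := by rw [h2]; gcongr
          _ = _ := by ring
    refine ⟨key _ ⟨isInt_one, isInt_zero, isInt_zero⟩ (by simp [form]) fun k hk => ?_,
      key _ ⟨isInt_one, isInt_one, isInt_one⟩ ?_ fun k hk => ?_,
      key _ ⟨isInt_zero, isInt_zero, isInt_one⟩ (by simp [form]) fun k hk => ?_⟩
    · have : form (1, 0, 0) (X k) = u k := by simp [form, X]
      rw [this, ← gauge_sq]; nlinarith [gauge_nonneg k]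
    · simp [form]; norm_num
    · have h1 : ((1, 1, 1) : V) = X (mk 1 0) := by
        refine Prod.ext rfl (Prod.ext rfl ?_)
        apply Complex.ext <;> simp [X]
      have h2 : gauge (mk 1 0) = 1 := by simp [gauge]
      rw [h1, norm_form_X]
      have := kd_le_add (mk 1 0) k
      nlinarith [kd_nonneg (mk 1 0) k]
    · have : form (0, 0, 1) (X k) = 1 := by simp [form, X]
      rw [this, norm_one]; norm_num
  · intro A _ B _ e
    exact linearEquiv_ext_three (congrArg Prod.fst e) (congrArg (fun p => p.2.1) e)
      (congrArg (fun p => p.2.2) e)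

/-! ### Words and orbits -/

/-- One step of the Gauss map with digit `g`, as an element of the modular group. -/
def step (g : Heis) : V ≃ₗ[ℂ] V := transl g⁻¹ * invl

theorem step_mem {g : Heis} (hg : g ∈ integers) : step g ∈ modular :=
  mul_mem (transl_mem (inv_mem hg)) invl_mem

theorem den_step (g x : Heis) : den (step g) x = u x := rfl

theorem act_step (g : Heis) {x : Heis} (hx : x ≠ 1) : act (step g) x = g⁻¹ * inversion x := by
  have h := act_mul (A := transl g⁻¹) invl_mem (h := x) (by rwa [den_invl, Ne, u_eq_zero])
  rw [step, h, act_transl, act_invl hx]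

/-- The product of the steps along a word. -/
def mat : List integers → (V ≃ₗ[ℂ] V)
  | [] => 1
  | g :: w => mat w * step g

theorem mat_mem : ∀ w : List integers, mat w ∈ modular
  | [] => one_mem _
  | g :: w => mul_mem (mat_mem w) (step_mem g.2)

theorem mat_append (w v : List integers) : mat (w ++ v) = mat v * mat w := by
  induction w with
  | nil => simp [mat]
  | cons g w ih => rw [List.cons_append, mat, ih, mat, mul_assoc]

/-- The points of the core of `K` whose orbit starts with a given word of digits and stays in the
core. -/
def orb (K : Set Heis) : List integers → Set Heis
  | [] => core K
  | g :: w => {x | x ∈ core K ∧ act (step g) x ∈ orb K w}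

variable {K : Set Heis} {r : ℝ}

theorem orb_subset_core : ∀ w, orb K w ⊆ core K
  | [] => fun _ h => h
  | _ :: _ => fun _ h => h.1

theorem measurableSet_orb : ∀ w, MeasurableSet (orb K w)
  | [] => measurableSet_core
  | g :: w => measurableSet_core.inter (measurable_act (step g) (measurableSet_orb w))

theorem den_ne_zero (w : List integers) {x : Heis} (hx : x ∈ generic) : den (mat w) x ≠ 0 :=
  hx _ (mat_mem w)

theorem act_mat_mem_generic (w : List integers) {x : Heis} (hx : x ∈ generic) :
    act (mat w) x ∈ generic := act_mem_generic (mat_mem w) hx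

theorem act_append (w v : List integers) {x : Heis} (hx : x ∈ generic) :
    act (mat (w ++ v)) x = act (mat v) (act (mat w) x) := by
  rw [mat_append, act_mul (mat_mem w) (den_ne_zero w hx)]

theorem den_append (w v : List integers) {x : Heis} (hx : x ∈ generic) :
    den (mat (w ++ v)) x = den (mat v) (act (mat w) x) * den (mat w) x := by
  rw [mat_append, den_mul (mat_mem w) (den_ne_zero w hx), mul_comm]

theorem mem_orb_append (w v : List integers) {x : Heis} :
    x ∈ orb K (w ++ v) ↔ x ∈ orb K w ∧ act (mat w) x ∈ orb K v := by
  induction w generalizing x with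
  | nil =>
    simp only [List.nil_append, mat, act_one]
    exact ⟨fun h => ⟨orb_subset_core v h, h⟩, fun h => h.2⟩
  | cons g w ih =>
    have e : x ∈ core K → act (mat (g :: w)) x = act (mat w) (act (step g) x) := fun hx => by
      rw [mat, act_mul (step_mem g.2) (hx.2 _ (step_mem g.2))]
    constructor
    · rintro ⟨h1, h2⟩
      rw [e h1]
      exact ⟨⟨h1, (ih.mp h2).1⟩, (ih.mp h2).2⟩
    · rintro ⟨⟨h1, h2⟩, h3⟩
      rw [e h1] at h3
      exact ⟨h1, ih.mpr ⟨h2, h3⟩⟩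

theorem act_mem_core {w : List integers} {x : Heis} (hx : x ∈ orb K w) : act (mat w) x ∈ core K := by
  have := (mem_orb_append w []).mp (by rwa [List.append_nil])
  exact this.2

theorem act_mat_inv (w : List integers) {x : Heis} (hx : x ∈ generic) :
    act (mat w)⁻¹ (act (mat w) x) = x := (den_inv (mat_mem w) (den_ne_zero w hx)).2

theorem act_inv_mat (w : List integers) {x : Heis} (hx : x ∈ generic) :
    act (mat w) (act (mat w)⁻¹ x) = x := by
  have := (den_inv (inv_mem (mat_mem w)) (hx _ (inv_mem (mat_mem w)))).2
  rwa [inv_inv] at this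

/-- A lower bound for the distance in a pair of points that is preserved by the Gauss map. -/
def sep (r : ℝ) : ℝ := min 1 (1 / r - r)

namespace IsSmallDomain

variable (D : IsSmallDomain K r)
include D

theorem sep_pos : 0 < sep r := by
  refine lt_min one_pos ?_
  have := one_lt_one_div D.pos D.lt_one
  linarith [D.lt_one]

theorem gauge_le_one {x : Heis} (hx : x ∈ K) : gauge x ≤ 1 := (D.gauge_le x hx).trans D.lt_one.le

theorem orb_unique {w v : List integers} (hl : w.length = v.length) {x : Heis}
    (hw : x ∈ orb K w) (hv : x ∈ orb K v) : w = v := by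
  induction w generalizing v x with
  | nil => exact (List.length_eq_zero_iff.mp hl.symm).symm
  | cons g w ih =>
    cases v with
    | nil => simp at hl
    | cons h v =>
      have hx1 := generic_ne_one hw.1.2
      have h1 := interior_subset (orb_subset_core w hw.2).1
      have h2 := interior_subset (orb_subset_core v hv.2).1
      rw [act_step _ hx1] at h1 h2
      have e : g = h := Subtype.ext (D.digit_unique g.2 h.2 h1 h2)
      subst e
      rw [ih (by simpa using hl) hw.2 hv.2]

theorem orb_prefix {w v : List integers} (hl : w.length ≤ v.length) {x : Heis}
    (hw : x ∈ orb K w) (hv : x ∈ orb K v) : ∃ v', v = w ++ v' := by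
  refine ⟨v.drop w.length, ?_⟩
  have h1 : x ∈ orb K (v.take w.length) :=
    ((mem_orb_append (v.take w.length) (v.drop w.length)).mp (by rwa [List.take_append_drop])).1
  have h2 := D.orb_unique (by simpa using hl) hw h1
  conv_lhs => rw [← List.take_append_drop w.length v, ← h2]

theorem den_le {w : List integers} {x : Heis} (hw : x ∈ orb K w) :
    ‖den (mat w) x‖ ≤ (r ^ 2) ^ w.length := by
  induction w generalizing x with
  | nil => simp [mat]
  | cons g w ih =>
    rw [mat, den_mul (step_mem g.2) (hw.1.2 _ (step_mem g.2)), norm_mul, den_step, ← gauge_sq,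
      List.length_cons, pow_succ (r ^ 2)]
    exact mul_le_mul (ih hw.2)
      (pow_le_pow_left₀ (gauge_nonneg x) (D.gauge_le x (core_subset hw.1)) 2)
      (by positivity) (by positivity)

/-- One step divides the distance `d` by `gauge x * gauge y ≤ r * (r + d)`. The function `d / (r *
(r + d))` increases in `d`, and at `d = sep r` it is at least `sep r` because `r * (r + sep r) ≤ 1`.
-/
theorem sep_le_kd_act {w : List integers} {x y : Heis} (hx : x ∈ orb K w) (hy : y ∈ generic)
    (h : sep r ≤ kd x y) : sep r ≤ kd (act (mat w) x) (act (mat w) y) := by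
  induction w generalizing x y with
  | nil => simpa [mat] using h
  | cons g w ih =>
    rw [mat, act_mul (step_mem g.2) (hx.1.2 _ (step_mem g.2)),
      act_mul (step_mem g.2) (hy _ (step_mem g.2))]
    refine ih hx.2 (act_mem_generic (step_mem g.2) hy) ?_
    have hx1 := generic_ne_one hx.1.2
    have hy1 := generic_ne_one hy
    rw [act_step _ hx1, act_step _ hy1, kd_left]
    have h1 := kd_inversion hx1 hy1
    have h2 := D.gauge_le x (core_subset hx.1)
    have h3 := gauge_le_add_kd x y
    have h4 := gauge_pos hx1
    have h5 := gauge_pos hy1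
    have h6 := D.sep_pos
    have h7 : r * (r + sep r) ≤ 1 := by
      have : sep r ≤ 1 / r - r := min_le_right _ _
      calc r * (r + sep r) ≤ r * (1 / r) := by
            have := D.pos; gcongr; linarith
        _ = 1 := by have := D.pos; field_simp
    have hr := D.pos
    by_contra! hlt
    have h8 : kd x y < sep r * (r * (r + kd x y)) := by
      calc kd x y = _ := h1.symm
        _ < sep r * (gauge x * gauge y) := by gcongr
        _ ≤ sep r * (r * (r + kd x y)) := by gcongr; linarith
    have h9 : sep r * (r * (r + kd x y)) ≤ kd x y * (r * (r + sep r)) := by nlinarith [sq_nonneg r]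
    nlinarith [kd_nonneg x y]

theorem one_le_kd {x b : Heis} (hx : x ∈ K) (hb : 2 ≤ gauge b) : 1 ≤ kd x b := by
  have := gauge_le_add_kd x b
  linarith [D.gauge_le_one hx]

theorem kd_le_four {x b : Heis} (hx : x ∈ K) (hb : gauge b ≤ 3) : kd x b ≤ 4 := by
  have := kd_le_add x b
  linarith [D.gauge_le_one hx]

theorem sep_le_kd {x b : Heis} (hx : x ∈ K) (hb : 2 ≤ gauge b) : sep r ≤ kd x b :=
  (min_le_left _ _).trans (D.one_le_kd hx hb)

end IsSmallDomain

/-- A shell of points that are far from `K`. -/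
def shell : Set Heis := {b | 2 ≤ gauge b ∧ gauge b ≤ 3}

theorem measurableSet_shell : MeasurableSet shell :=
  ((isClosed_le continuous_const continuous_gauge).inter
    (isClosed_le continuous_gauge continuous_const)).measurableSet

theorem volume_shell_pos : 0 < volume shell := by
  have hopen : IsOpen {h : Heis | 2 < gauge h ∧ gauge h < 3} :=
    (isOpen_lt continuous_const continuous_gauge).inter (isOpen_lt continuous_gauge continuous_const)
  have hmem : (mk (5 / 2) 0) ∈ {h : Heis | 2 < gauge h ∧ gauge h < 3} := by
    have h2 : gauge (mk (5 / 2) 0) ^ 2 = 25 / 4 := by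
      have h3 := norm_u_sq (mk (5 / 2) 0)
      rw [← gauge_sq] at h3
      have h4 : ‖(mk (5 / 2) 0).z‖ = 5 / 2 := by simp
      rw [h4, t_mk] at h3
      nlinarith [sq_nonneg (gauge (mk (5 / 2) 0))]
    have h3 := gauge_nonneg (mk (5 / 2) 0)
    exact ⟨by nlinarith, by nlinarith⟩
  exact (hopen.measure_pos _ ⟨_, hmem⟩).trans_le
    (measure_mono fun h hh => ⟨hh.1.le, hh.2.le⟩)

theorem volume_shell_lt_top : volume shell < ⊤ :=
  (measure_mono fun _ h => h.2).trans_lt ((volume_gauge_le 3 (by norm_num)).trans_lt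
    ENNReal.ofReal_lt_top)

theorem exists_generic_shell : ∃ b ∈ shell, b ∈ generic := by
  by_contra! h
  refine volume_shell_pos.ne' (measure_mono_null (t := genericᶜ) (fun b hb => h b hb) ?_)
  exact mem_ae_iff.mp ae_generic

end

section

/-! ### Measures of families of bounded multiplicity -/

/-- Integration of the counting function of the family, which is at most `n` and vanishes off `T`.
-/
theorem tsum_measure_le_of_encard_le {α ι : Type*} [MeasurableSpace α] {μ : Measure α} [Countable ι]
    {S : ι → Set α} (hS : ∀ i, MeasurableSet (S i)) {T : Set α} (hT : MeasurableSet T) (n : ℕ)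
    (h : ∀ᵐ p ∂μ, {i | p ∈ S i}.encard ≤ n ∧ ∀ i, p ∈ S i → p ∈ T) :
    ∑' i, μ (S i) ≤ n * μ T := by
  have h1 : ∑' i, μ (S i) = ∫⁻ p, ∑' i, (S i).indicator 1 p ∂μ := by
    rw [lintegral_tsum fun i => (measurable_one.indicator (hS i)).aemeasurable]
    exact tsum_congr fun i => (lintegral_indicator_one (hS i)).symm
  rw [h1, ← lintegral_indicator_one hT, ← lintegral_const_mul _ (measurable_one.indicator hT)]
  refine lintegral_mono_ae ?_
  filter_upwards [h] with p hp
  have h2 : ∑' i, (S i).indicator (1 : α → ℝ≥0∞) p = ∑' i, ({i | p ∈ S i} : Set ι).indicator 1 i := rfl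
  rw [h2, ← tsum_subtype {i | p ∈ S i} (1 : ι → ℝ≥0∞)]
  have h3 : ∑' i : {i | p ∈ S i}, (1 : ι → ℝ≥0∞) i = ({i | p ∈ S i}.encard : ℝ≥0∞) :=
    ENNReal.tsum_set_one _
  rw [h3]
  by_cases hpT : p ∈ T
  · rw [indicator_of_mem hpT, Pi.one_apply, mul_one]
    calc _ ≤ (((n : ℕ∞)) : ℝ≥0∞) := ENat.toENNReal_le.mpr hp.1
      _ = n := ENat.toENNReal_coe n
  · have : {i | p ∈ S i} = ∅ := eq_empty_of_forall_notMem fun i hi => hpT (hp.2 i hi)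
    rw [this]; simp

theorem ae_act_notMem {A : V ≃ₗ[ℂ] V} (hA : A ∈ modular) {s : Set Heis} (hs : volume s = 0) :
    ∀ᵐ x : Heis, act A x ∉ s := by
  obtain ⟨s', hss', hs'm, hs'0⟩ := exists_measurable_superset_of_null hs
  have h2 := lintegral_act hA (f := s'.indicator 1) (measurable_one.indicator hs'm)
  have hmeas : Measurable fun x => s'.indicator (1 : Heis → ℝ≥0∞) (act A x) * jac A x :=
    ((measurable_one.indicator hs'm).comp (measurable_act A)).mul (measurable_jac A)
  rw [lintegral_indicator_one hs'm, hs'0, lintegral_eq_zero_iff hmeas] at h2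
  filter_upwards [h2, ae_generic] with x hx hg hxs
  have h5 : jac A x ≠ 0 := by
    have : 0 < ‖den A x‖ := norm_pos_iff.mpr (hg A hA)
    rw [jac, Ne, ENNReal.ofReal_eq_zero, not_le]; positivity
  simp only [Pi.zero_apply, mul_eq_zero, h5, or_false] at hx
  simp [indicator_of_mem (hss' hxs)] at hx

/-- For `x` in the unit ball and `y` in the shell the distance lies between 1 and 4, so there the
pair measure is comparable to product measure. -/
theorem volume_mul_shell_le {E : Set Heis} (hE : MeasurableSet E) (h1 : ∀ x ∈ E, gauge x ≤ 1) :
    volume E * volume shell ≤ ENNReal.ofReal (4 ^ 8) * pairMeasure (E ×ˢ shell) := by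
  rw [pairMeasure, withDensity_apply _ (hE.prod measurableSet_shell),
    ← lintegral_const_mul _ measurable_pairDensity, ← Measure.prod_prod, ← setLIntegral_one]
  refine setLIntegral_mono (measurable_pairDensity.const_mul _) fun p hp => ?_
  have h2 : kd p.1 p.2 ≤ 4 := (kd_le_add _ _).trans (by linarith [h1 _ hp.1, hp.2.2])
  have h3 : 1 ≤ kd p.1 p.2 := by
    have := gauge_le_add_kd p.1 p.2
    linarith [h1 _ hp.1, hp.2.1]
  rw [pairDensity, ← ENNReal.ofReal_mul (by positivity), ENNReal.one_le_ofReal,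
    ← div_eq_mul_inv, one_le_div (by positivity)]
  exact pow_le_pow_left₀ (by positivity) h2 8

theorem ae_pairMeasure_generic : ∀ᵐ p ∂pairMeasure, p.1 ∈ generic ∧ p.2 ∈ generic := by
  refine (withDensity_absolutelyContinuous _ _).ae_le ?_
  exact (Measure.quasiMeasurePreserving_fst.ae ae_generic).and
    (Measure.quasiMeasurePreserving_snd.ae ae_generic)

/-! ### Bounded distortion and bounded multiplicity -/

variable {K : Set Heis} {r : ℝ}

/-- A bound for the distortion of the branches of the Gauss map. -/
def distortion (r : ℝ) : ℝ := 16 * (1 + 2 / sep r) ^ 2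

theorem norm_den_mat_pos {w : List integers} {x : Heis} (hx : x ∈ orb K w) : 0 < ‖den (mat w) x‖ :=
  norm_pos_iff.mpr (den_ne_zero w (orb_subset_core w hx).2)

namespace IsSmallDomain

variable (D : IsSmallDomain K r)
include D

theorem sq_pos : 0 < r ^ 2 := pow_pos D.pos 2

theorem sq_lt_one : r ^ 2 < 1 := pow_lt_one₀ D.pos.le D.lt_one two_ne_zero

theorem distortion_pos : 0 < distortion r := by
  have := D.sep_pos
  unfold distortion; positivity

/-- A reference point `b` in the shell gives two instances of `kd_act` that share the factor `den
(mat w) b`. The image of `b` stays `sep r` away from the image of `x`, and both images of `x` and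
`x'` lie in `K`, so their distances to the image of `b` are comparable. The factor 16 is the square
of `4 / 1`, from distances between `K` and the shell. -/
theorem den_le_distortion {w : List integers} {x x' : Heis} (hx : x ∈ orb K w) (hx' : x' ∈ orb K w) :
    ‖den (mat w) x‖ ≤ distortion r * ‖den (mat w) x'‖ := by
  obtain ⟨b, hb, hbg⟩ := exists_generic_shell
  have hs := D.sep_pos
  have e1 := kd_act (mat_mem w) (den_ne_zero w (orb_subset_core w hx).2) (den_ne_zero w hbg)
  have e2 := kd_act (mat_mem w) (den_ne_zero w (orb_subset_core w hx').2) (den_ne_zero w hbg)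
  have hxK := core_subset (orb_subset_core w hx)
  have hxK' := core_subset (orb_subset_core w hx')
  have h1 := D.sep_le_kd_act hx hbg (D.sep_le_kd hxK hb.1)
  have h2 := D.kd_le_four hxK hb.2
  have h3 := D.one_le_kd hxK' hb.1
  have hb0 : 0 < ‖den (mat w) b‖ := norm_pos_iff.mpr (den_ne_zero w hbg)
  have hq := norm_den_mat_pos hx
  have hq' := norm_den_mat_pos hx'
  set k := act (mat w) x
  set k' := act (mat w) x'
  set y := act (mat w) b
  have h4 : kd k' y ≤ kd k y * (1 + 2 / sep r) := by
    have h5 := kd_triangle k' k y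
    have h6 := kd_le_add k' k
    have h7 := D.gauge_le_one (core_subset (act_mem_core hx))
    have h8 := D.gauge_le_one (core_subset (act_mem_core hx'))
    have h9 : 2 ≤ kd k y * (2 / sep r) := by
      rw [mul_div_assoc', le_div_iff₀ hs]; linarith
    have h10 : kd k' k ≤ 2 := h6.trans (by linarith)
    linarith
  have hky : 0 < kd k y := hs.trans_le h1
  have hM : 0 < kd k y ^ 2 * ‖den (mat w) b‖ := by positivity
  refine le_of_mul_le_mul_left ?_ hM
  have h11 : kd k' y ^ 2 ≤ (kd k y * (1 + 2 / sep r)) ^ 2 := pow_le_pow_left₀ (kd_nonneg _ _) h4 2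
  calc kd k y ^ 2 * ‖den (mat w) b‖ * ‖den (mat w) x‖ = kd x b ^ 2 := by rw [← e1]; ring
    _ ≤ 16 * kd x' b ^ 2 := by nlinarith [kd_nonneg x b]
    _ = 16 * (kd k' y ^ 2 * (‖den (mat w) x'‖ * ‖den (mat w) b‖)) := by rw [e2]
    _ ≤ 16 * ((kd k y * (1 + 2 / sep r)) ^ 2 * (‖den (mat w) x'‖ * ‖den (mat w) b‖)) := by gcongr
    _ = _ := by unfold distortion; ring

theorem den_append_le {w v : List integers} {x : Heis} (hx : x ∈ orb K (w ++ v)) :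
    ‖den (mat (w ++ v)) x‖ ≤ (r ^ 2) ^ v.length * ‖den (mat w) x‖ := by
  have h := (mem_orb_append w v).mp hx
  rw [den_append w v (orb_subset_core w h.1).2, norm_mul]
  exact mul_le_mul_of_nonneg_right (D.den_le h.2) (norm_nonneg _)

theorem den_append_lt {w v : List integers} (hv : v ≠ []) {x : Heis} (hx : x ∈ orb K (w ++ v)) :
    ‖den (mat (w ++ v)) x‖ < ‖den (mat w) x‖ := by
  have h := (mem_orb_append w v).mp hx
  refine (D.den_append_le hx).trans_lt ?_
  refine mul_lt_of_lt_one_left (norm_den_mat_pos h.1) (pow_lt_one₀ D.sq_pos.le D.sq_lt_one ?_)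
  simpa using hv

theorem mat_injective {w v : List integers} {x : Heis} (hw : x ∈ orb K w) (hv : x ∈ orb K v)
    (e : mat w = mat v) : w = v := by
  wlog hl : w.length ≤ v.length generalizing w v
  · exact (this hv hw e.symm (le_of_not_ge hl)).symm
  obtain ⟨v', rfl⟩ := D.orb_prefix hl hw hv
  by_contra hne
  have := D.den_append_lt (w := w) (v := v') (by rintro rfl; simp at hne) hv
  rw [e] at this
  exact this.false

/-- For two words of similar size that end at the same pair `(k, y)`, the quotient `(mat w)⁻¹ * mat
w0` sends one separated bounded pair to another and has `den` bounded above and below. It lies in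
the finite set `moderate C`, and it determines `w` by `mat_injective`. -/
theorem exists_encard_words_le {C : ℝ} (hC : 1 ≤ C) : ∃ N : ℕ, ∀ δ : ℝ, 0 < δ →
    ∀ k ∈ generic, ∀ y ∈ generic, {w | act (mat w)⁻¹ k ∈ orb K w ∧ act (mat w)⁻¹ y ∈ shell ∧
      δ ≤ ‖den (mat w) (act (mat w)⁻¹ k)‖ ∧ ‖den (mat w) (act (mat w)⁻¹ k)‖ ≤ C * δ}.encard ≤ N := by
  have hfin := finite_moderate hC
  refine ⟨(moderate C).ncard, fun δ hδ k hk y hy => ?_⟩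
  set W := {w | act (mat w)⁻¹ k ∈ orb K w ∧ act (mat w)⁻¹ y ∈ shell ∧
      δ ≤ ‖den (mat w) (act (mat w)⁻¹ k)‖ ∧ ‖den (mat w) (act (mat w)⁻¹ k)‖ ≤ C * δ}
  rcases W.eq_empty_or_nonempty with h0 | ⟨w0, hw0⟩
  · rw [h0]; simp
  rw [hfin.cast_ncard_eq]
  refine encard_le_encard_of_injOn (f := fun w => (mat w)⁻¹ * mat w0) ?_ ?_
  · intro w hw
    obtain ⟨h1, h2, h3, h4⟩ := hw
    obtain ⟨g1, g2, g3, g4⟩ := hw0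
    have hAm : (mat w)⁻¹ * mat w0 ∈ modular := mul_mem (inv_mem (mat_mem w)) (mat_mem w0)
    have hag : act (mat w0)⁻¹ k ∈ generic := (orb_subset_core w0 g1).2
    have hbg : act (mat w0)⁻¹ y ∈ generic := act_mem_generic (inv_mem (mat_mem w0)) hy
    have ea : act ((mat w)⁻¹ * mat w0) (act (mat w0)⁻¹ k) = act (mat w)⁻¹ k := by
      rw [act_mul (mat_mem w0) (den_ne_zero w0 hag), act_inv_mat w0 hk]
    have eb : act ((mat w)⁻¹ * mat w0) (act (mat w0)⁻¹ y) = act (mat w)⁻¹ y := by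
      rw [act_mul (mat_mem w0) (den_ne_zero w0 hbg), act_inv_mat w0 hy]
    have hwg : act (mat w)⁻¹ k ∈ generic := (orb_subset_core w h1).2
    have ed : ‖den ((mat w)⁻¹ * mat w0) (act (mat w0)⁻¹ k)‖ * ‖den (mat w) (act (mat w)⁻¹ k)‖ =
        ‖den (mat w0) (act (mat w0)⁻¹ k)‖ := by
      have h5 := (den_inv (mat_mem w) (den_ne_zero w hwg)).1
      rw [act_inv_mat w hk] at h5
      have h6 : ‖den (mat w) (act (mat w)⁻¹ k)‖ ≠ 0 := (norm_den_mat_pos h1).ne'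
      rw [den_mul (mat_mem w0) (den_ne_zero w0 hag), act_inv_mat w0 hk, h5, norm_mul, norm_inv]
      field_simp
    refine ⟨hAm, act (mat w0)⁻¹ k, act (mat w0)⁻¹ y, hag _ hAm, hbg _ hAm,
      D.gauge_le_one (core_subset (orb_subset_core w0 g1)), ?_, g2.2, ?_, ?_, ?_, ?_, ?_⟩
    · rw [ea]; exact D.gauge_le_one (core_subset (orb_subset_core w h1))
    · rw [eb]; exact h2.2
    · exact D.one_le_kd (core_subset (orb_subset_core w0 g1)) g2.1
    · rw [ea, eb]; exact D.one_le_kd (core_subset (orb_subset_core w h1)) h2.1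
    · rw [inv_le_iff_one_le_mul₀ (by linarith)]
      have hq := norm_den_mat_pos h1
      set t := ‖den ((mat w)⁻¹ * mat w0) (act (mat w0)⁻¹ k)‖
      have ht : 0 ≤ t := norm_nonneg _
      by_contra! hlt
      nlinarith [mul_le_mul_of_nonneg_left h4 ht]
    · have hq := norm_den_mat_pos h1
      set t := ‖den ((mat w)⁻¹ * mat w0) (act (mat w0)⁻¹ k)‖
      have ht : 0 ≤ t := norm_nonneg _
      nlinarith [mul_le_mul_of_nonneg_left h3 ht]
  · intro w hw v hv e
    have e' : mat w = mat v := inv_injective (mul_right_cancel e)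
    refine D.mat_injective hw.1 ?_ e'
    rw [e']; exact hv.1

/-- The words along one orbit are nested and each letter shrinks `den` by at least `r ^ 2`, so a
window of bounded ratio contains boundedly many of them. -/
theorem exists_encard_prefixes_le {C : ℝ} (hC : 0 < C) : ∃ N : ℕ, ∀ δ : ℝ, 0 < δ → ∀ x,
    {w | x ∈ orb K w ∧ δ ≤ ‖den (mat w) x‖ ∧ ‖den (mat w) x‖ ≤ C * δ}.encard ≤ N := by
  obtain ⟨L, hL⟩ := exists_pow_lt_of_lt_one (inv_pos.mpr hC) D.sq_lt_one
  refine ⟨L, fun δ hδ x => ?_⟩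
  set W := {w | x ∈ orb K w ∧ δ ≤ ‖den (mat w) x‖ ∧ ‖den (mat w) x‖ ≤ C * δ}
  rcases W.eq_empty_or_nonempty with h0 | hne
  · rw [h0]; simp
  obtain ⟨w0, hw0, hmin⟩ := WellFounded.has_min (measure (List.length (α := integers))).wf W hne
  have hcard : (Finset.Ico w0.length (w0.length + L) : Set ℕ).encard = L := by
    rw [encard_coe_eq_coe_finsetCard]; simp
  rw [← hcard]
  refine encard_le_encard_of_injOn (f := List.length) ?_ fun w hw v hv e => D.orb_unique e hw.1 hv.1
  intro w hw
  have hl : w0.length ≤ w.length := not_lt.mp (hmin w hw)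
  obtain ⟨v, rfl⟩ := D.orb_prefix hl hw0.1 hw.1
  refine Finset.mem_coe.mpr (Finset.mem_Ico.mpr ⟨hl, ?_⟩)
  rw [List.length_append]
  by_contra! hge
  have h1 := D.den_append_le hw.1
  have h2 : (r ^ 2) ^ v.length ≤ (r ^ 2) ^ L :=
    pow_le_pow_of_le_one D.sq_pos.le D.sq_lt_one.le (by omega)
  have h3 : (r ^ 2) ^ v.length * ‖den (mat w0) x‖ < C⁻¹ * (C * δ) := by
    calc _ ≤ (r ^ 2) ^ L * ‖den (mat w0) x‖ := by gcongr
      _ < C⁻¹ * ‖den (mat w0) x‖ := by gcongr; exact norm_den_mat_pos hw0.1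
      _ ≤ _ := by gcongr; exact hw0.2.2
  rw [inv_mul_cancel_left₀ hC.ne'] at h3
  linarith [hw.2.1]

/-- Each set `E w` is paired with the shell and pushed forward by `mat w`, which preserves the pair
measure. The images lie over `N` at distance at least `sep r`, a set of pair measure `O(volume N)`,
and by `exists_encard_words_le` they overlap boundedly often. -/
theorem exists_volume_hitting_le : ∃ C : ℝ, 0 ≤ C ∧ ∀ N : Set Heis, MeasurableSet N → ∀ j : ℕ,
    volume {x | ∃ w, x ∈ orb K w ∧ act (mat w) x ∈ N ∧ (r ^ 2) ^ (j + 1) < ‖den (mat w) x‖ ∧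
      ‖den (mat w) x‖ ≤ (r ^ 2) ^ j} ≤ ENNReal.ofReal C * volume N := by
  obtain ⟨n, hn⟩ := D.exists_encard_words_le (C := (r ^ 2)⁻¹)
    (one_le_inv₀ D.sq_pos |>.mpr D.sq_lt_one.le)
  let C : ℝ≥0∞ := (volume shell)⁻¹ * (ENNReal.ofReal (4 ^ 8) *
    (n * ENNReal.ofReal (8 * (1 / sep r) ^ 4)))
  have hCtop : C ≠ ⊤ := by
    refine ENNReal.mul_ne_top (ENNReal.inv_ne_top.mpr volume_shell_pos.ne') ?_
    exact ENNReal.mul_ne_top ENNReal.ofReal_ne_top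
      (ENNReal.mul_ne_top (ENNReal.natCast_ne_top n) ENNReal.ofReal_ne_top)
  refine ⟨C.toReal, ENNReal.toReal_nonneg, fun N hN j => ?_⟩
  rw [ENNReal.ofReal_toReal hCtop]
  let E (w : List integers) : Set Heis := {x | x ∈ orb K w ∧ act (mat w) x ∈ N ∧
    (r ^ 2) ^ (j + 1) < ‖den (mat w) x‖ ∧ ‖den (mat w) x‖ ≤ (r ^ 2) ^ j}
  have hEm : ∀ w, MeasurableSet (E w) := fun w => (measurableSet_orb w).inter
    ((measurable_act _ hN).inter
      ((isOpen_lt continuous_const (continuous_den _).norm).measurableSet.inter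
        (isClosed_le (continuous_den _).norm continuous_const).measurableSet))
  have hEle : ∀ w, ∀ x ∈ E w, gauge x ≤ 1 := fun w x hx =>
    D.gauge_le_one (core_subset (orb_subset_core w hx.1))
  let S (w : List integers) : Set (Heis × Heis) :=
    {p | (act (mat w)⁻¹ p.1, act (mat w)⁻¹ p.2) ∈ E w ×ˢ shell}
  have hSm : ∀ w, MeasurableSet (S w) := fun w =>
    measurable_act_prod (mat w)⁻¹ ((hEm w).prod measurableSet_shell)
  have hSE : ∀ w, pairMeasure (S w) = pairMeasure (E w ×ˢ shell) := fun w =>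
    pairMeasure_preimage_act (inv_mem (mat_mem w)) ((hEm w).prod measurableSet_shell)
  let T : Set (Heis × Heis) := {p | p.1 ∈ N ∧ sep r ≤ kd p.1 p.2}
  have hTm : MeasurableSet T := (measurable_fst hN).inter
    (isClosed_le continuous_const continuous_kd).measurableSet
  have hT : pairMeasure T ≤ ENNReal.ofReal (8 * (1 / sep r) ^ 4) * volume N := by
    rw [pairMeasure_apply hTm]
    calc _ = ∫⁻ x, N.indicator (fun x => ∫⁻ y, {y | sep r ≤ kd x y}.indicator
          (fun y => pairDensity (x, y)) y) x := by
          refine lintegral_congr fun x => ?_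
          by_cases hx : x ∈ N
          · rw [indicator_of_mem hx]
            refine lintegral_congr fun y => ?_
            by_cases hy : sep r ≤ kd x y
            · rw [indicator_of_mem (show (x, y) ∈ T from ⟨hx, hy⟩), indicator_of_mem (by exact hy)]
            · rw [indicator_of_notMem (fun h : (x, y) ∈ T => hy h.2), indicator_of_notMem (by exact hy)]
          · rw [indicator_of_notMem hx]
            simp only [indicator_of_notMem (fun h : (x, _) ∈ T => hx h.1), lintegral_zero]
      _ ≤ ∫⁻ x, N.indicator (fun _ => ENNReal.ofReal (8 * (1 / sep r) ^ 4)) x := by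
          refine lintegral_mono fun x => indicator_le_indicator ?_
          exact lintegral_pairDensity_le x D.sep_pos
      _ = _ := lintegral_indicator_const hN _
  have key : ∑' w, pairMeasure (S w) ≤ n * pairMeasure T := by
    refine tsum_measure_le_of_encard_le hSm hTm n ?_
    filter_upwards [ae_pairMeasure_generic] with p hp
    have hsub : ∀ w, p ∈ S w → act (mat w) (act (mat w)⁻¹ p.1) = p.1 := fun w _ =>
      act_inv_mat w hp.1
    constructor
    · refine (encard_le_encard fun w hw => ?_).trans
        (hn ((r ^ 2) ^ (j + 1)) (pow_pos D.sq_pos _) p.1 hp.1 p.2 hp.2)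
      refine ⟨hw.1.1, hw.2, hw.1.2.2.1.le, ?_⟩
      rw [pow_succ' (r ^ 2), inv_mul_cancel_left₀ D.sq_pos.ne']
      exact hw.1.2.2.2
    · intro w hw
      have h1 := hw.1.2.1
      rw [hsub w hw] at h1
      refine ⟨h1, ?_⟩
      have h2 := D.sep_le_kd_act hw.1.1 (act_mem_generic (inv_mem (mat_mem w)) hp.2)
        (D.sep_le_kd (core_subset (orb_subset_core w hw.1.1)) hw.2.1)
      rwa [hsub w hw, act_inv_mat w hp.2] at h2
  have hset : {x | ∃ w, x ∈ orb K w ∧ act (mat w) x ∈ N ∧ (r ^ 2) ^ (j + 1) < ‖den (mat w) x‖ ∧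
      ‖den (mat w) x‖ ≤ (r ^ 2) ^ j} = ⋃ w, E w := by
    ext x; rw [mem_iUnion]; rfl
  rw [hset]
  calc volume (⋃ w, E w) ≤ ∑' w, volume (E w) := measure_iUnion_le _
    _ ≤ ∑' w, (volume shell)⁻¹ * (ENNReal.ofReal (4 ^ 8) * pairMeasure (S w)) := by
        refine ENNReal.tsum_le_tsum fun w => ?_
        rw [hSE, ← ENNReal.div_eq_inv_mul, ENNReal.le_div_iff_mul_le
          (Or.inl volume_shell_pos.ne') (Or.inl volume_shell_lt_top.ne)]
        exact volume_mul_shell_le (hEm w) (hEle w)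
    _ = (volume shell)⁻¹ * (ENNReal.ofReal (4 ^ 8) * ∑' w, pairMeasure (S w)) := by
        rw [ENNReal.tsum_mul_left, ENNReal.tsum_mul_left]
    _ ≤ (volume shell)⁻¹ * (ENNReal.ofReal (4 ^ 8) *
          (n * (ENNReal.ofReal (8 * (1 / sep r) ^ 4) * volume N))) := by
        gcongr; exact key.trans (by gcongr)
    _ = C * volume N := by simp only [C]; ring

end IsSmallDomain
end

section

variable {K : Set Heis} {r : ℝ}

/-! ### Stable branches -/

/-- Along the orbit of `x` that is described by `w`, the domain contains balls around the orbit
whose radii are comparable to the contraction of the remaining inverse branches. -/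
def IsFine (K : Set Heis) (ρ : ℝ) (x : Heis) (w : List integers) : Prop :=
  ∀ w₁ w₂, w = w₁ ++ w₂ → ∀ y, kd (act (mat w₁) x) y < ρ * ‖den (mat w₂) (act (mat w₁) x)‖ → y ∈ K

theorem act_cons (g : integers) (w : List integers) {x : Heis} (hx : x ∈ generic) :
    act (mat (g :: w)) x = act (mat w) (act (step g) x) := by
  rw [mat, act_mul (step_mem g.2) (hx _ (step_mem g.2))]

theorem IsFine.tail {ρ : ℝ} {x : Heis} {g : integers} {w : List integers} (hx : x ∈ generic)
    (h : IsFine K ρ x (g :: w)) : IsFine K ρ (act (step g) x) w := by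
  rintro w₁ w₂ rfl y hy
  rw [← act_cons g w₁ hx] at hy
  exact h (g :: w₁) w₂ rfl y hy

theorem continuous_kd_right (x : Heis) : Continuous fun y => kd x y :=
  continuous_gauge.comp (continuous_mul_left x⁻¹)

theorem continuous_kd_left (x : Heis) : Continuous fun y => kd y x := by
  simp only [kd_comm _ x]; exact continuous_kd_right x

theorem mem_interior_of_ball {x y : Heis} {ρ : ℝ} (h : ∀ y, kd x y < ρ → y ∈ K) (hy : kd x y < ρ) :
    y ∈ interior K :=
  mem_interior.mpr ⟨{y | kd x y < ρ}, h,
    isOpen_lt (continuous_kd_right x) continuous_const, hy⟩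

namespace IsSmallDomain

variable (D : IsSmallDomain K r)
include D

/-- Backward induction along the word. The inverse branch contracts by about `den`, and fineness
keeps a ball of that size around the orbit inside `K`, so the pulled back point never leaves `K`. -/
theorem mem_orb_of_isFine {ρ ρ' : ℝ} (h1 : ρ' ≤ ρ / 8) (h2 : ρ' ≤ sep r / 2) (h3 : ρ' ≤ 1 / r - 1)
    (hρ : 0 < ρ) {w : List integers} {x : Heis} (hx : x ∈ orb K w) (hf : IsFine K ρ x w) {k : Heis}
    (hk : k ∈ generic) (hd : kd (act (mat w) x) k < ρ') :
    act (mat w)⁻¹ k ∈ orb K w ∧ kd x (act (mat w)⁻¹ k) ≤ kd (act (mat w) x) k := by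
  induction w generalizing x with
  | nil =>
    simp only [mat, act_one, inv_one] at hd ⊢
    refine ⟨⟨?_, hk⟩, le_rfl⟩
    refine mem_interior_of_ball (x := x) (ρ := ρ) (fun y hy => hf [] [] rfl y ?_) (by linarith)
    simpa [mat] using hy
  | cons g w ih =>
    have hxg := hx.1.2
    rw [act_cons g w hxg] at hd
    obtain ⟨hy1, hd1⟩ := ih hx.2 (hf.tail hxg) hd
    set y := act (mat (g :: w))⁻¹ k with hy
    have hyg : y ∈ generic := act_mem_generic (inv_mem (mat_mem _)) hk
    have hyk : act (mat (g :: w)) y = k := act_inv_mat _ hk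
    have hyw : act (step g) y = act (mat w)⁻¹ k := by
      rw [← hyk, act_cons g w hyg, act_mat_inv w (act_mem_generic (step_mem g.2) hyg)]
    rw [← hyw] at hy1 hd1
    have hx1 := generic_ne_one hxg
    have hyne := generic_ne_one hyg
    have hgx := gauge_pos hx1
    have hgy := gauge_pos hyne
    have hxr := D.gauge_le x (core_subset hx.1)
    have hdx : kd (inversion x) (inversion y) ≤ kd (act (mat w) (act (step g) x)) k := by
      rwa [act_step _ hx1, act_step _ hyne, kd_left, ← act_step g hx1] at hd1
    have hy1' : gauge y ≤ 1 := by
      have h4 := gauge_le_add_kd (inversion y) (inversion x)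
      rw [kd_comm, gauge_inversion, gauge_inversion] at h4
      have h5 : 1 / r ≤ (gauge x)⁻¹ := by rw [one_div]; exact inv_anti₀ hgx hxr
      have h6 : 1 ≤ (gauge y)⁻¹ := by linarith
      exact (one_le_inv₀ hgy).mp h6
    have hdxy : kd x y ≤ kd (act (mat w) (act (step g) x)) k := by
      rw [← kd_inversion hx1 hyne]
      refine (mul_le_of_le_one_right (kd_nonneg _ _) ?_).trans hdx
      exact mul_le_one₀ (hxr.trans D.lt_one.le) hgy.le hy1'
    rw [act_cons g w hxg]
    refine ⟨⟨⟨?_, hyg⟩, hy1⟩, hdxy⟩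
    -- It is not yet known that `y` lies in `orb K (g :: w)`, so `den_le_distortion` is unavailable.
    -- The comparison with a far point `b` is repeated, now with `d` at most half the distance
    -- between the images of `x` and `b`.
    obtain ⟨b, hb, hbg⟩ := exists_generic_shell
    have hs := D.sep_pos
    have e1 := kd_act (mat_mem (g :: w)) (den_ne_zero _ hxg) (den_ne_zero _ hbg)
    have e2 := kd_act (mat_mem (g :: w)) (den_ne_zero _ hyg) (den_ne_zero _ hbg)
    have e3 := kd_act (mat_mem (g :: w)) (den_ne_zero _ hxg) (den_ne_zero _ hyg)
    have h4 := D.sep_le_kd_act hx hbg (D.sep_le_kd (core_subset hx.1) hb.1)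
    have h5 := D.one_le_kd (core_subset hx.1) hb.1
    have h6 : kd y b ≤ 4 := (kd_le_add _ _).trans (by linarith [hb.2])
    have hqx : 0 < ‖den (mat (g :: w)) x‖ := norm_pos_iff.mpr (den_ne_zero _ hxg)
    have hqy : 0 < ‖den (mat (g :: w)) y‖ := norm_pos_iff.mpr (den_ne_zero _ hyg)
    have hqb : 0 < ‖den (mat (g :: w)) b‖ := norm_pos_iff.mpr (den_ne_zero _ hbg)
    rw [← act_cons g w hxg] at hd
    rw [hyk] at e2 e3
    refine mem_interior_of_ball (x := x) (ρ := ρ * ‖den (mat (g :: w)) x‖)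
      (fun z hz => hf [] (g :: w) rfl z (by simpa [mat] using hz)) ?_
    set A := mat (g :: w)
    set d := kd (act A x) k
    have hd0 : 0 ≤ d := kd_nonneg _ _
    have h7 : kd (act A x) (act A b) / 2 ≤ kd k (act A b) := by
      have := kd_triangle (act A x) k (act A b)
      linarith
    have hP : 0 < kd (act A x) (act A b) := hs.trans_le h4
    -- 64 is 4, from halving the distance in `h7`, times 16, from `kd y b ≤ 4` and `1 ≤ kd x b`. The
    -- radius loses its square root 8, hence `ρ / 8` in the hypotheses.
    have h8 : ‖den A y‖ ≤ 64 * ‖den A x‖ := by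
      refine le_of_mul_le_mul_left ?_ (by positivity : 0 < kd (act A x) (act A b) ^ 2 * ‖den A b‖ / 4)
      have h9 : (kd (act A x) (act A b) / 2) ^ 2 ≤ kd k (act A b) ^ 2 :=
        pow_le_pow_left₀ (by positivity) h7 2
      calc kd (act A x) (act A b) ^ 2 * ‖den A b‖ / 4 * ‖den A y‖
          = (kd (act A x) (act A b) / 2) ^ 2 * (‖den A y‖ * ‖den A b‖) := by ring
        _ ≤ kd k (act A b) ^ 2 * (‖den A y‖ * ‖den A b‖) := by gcongr
        _ = kd y b ^ 2 := e2
        _ ≤ 16 * kd x b ^ 2 := by nlinarith [kd_nonneg y b]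
        _ = _ := by rw [← e1]; ring
    have h9 : kd x y ^ 2 ≤ (8 * ‖den A x‖ * d) ^ 2 := by
      rw [← e3]
      calc d ^ 2 * (‖den A x‖ * ‖den A y‖) ≤ d ^ 2 * (‖den A x‖ * (64 * ‖den A x‖)) := by gcongr
        _ = _ := by ring
    have h10 : kd x y ≤ 8 * ‖den A x‖ * d := le_of_sq_le_sq h9 (by positivity)
    calc kd x y ≤ 8 * ‖den A x‖ * d := h10
      _ < 8 * ‖den A x‖ * (ρ / 8) := by gcongr; linarith
      _ = ρ * ‖den A x‖ := by ring

/-! ### Most points lie on stable branches of a prescribed size -/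

theorem ae_exists_next : ∀ᵐ x : Heis, ∀ w, x ∈ orb K w → ∃ g, x ∈ orb K (w ++ [g]) := by
  have h1 := (ae_ball_iff countable_modular).mpr fun A (hA : A ∈ modular) =>
    ae_act_notMem hA D.volume_diff_core
  filter_upwards [h1] with x hx w hw
  have hk := act_mem_core hw
  obtain ⟨g, hg, hgK⟩ := D.exists_digit (inversion (act (mat w) x))
  refine ⟨⟨g, hg⟩, (mem_orb_append _ _).mpr ⟨hw, hk, ?_⟩⟩
  have h2 := hx _ (mat_mem (w ++ [⟨g, hg⟩]))
  have hxg := (orb_subset_core w hw).2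
  rw [act_append _ _ hxg, act_cons _ _ hk.2, mat, act_one] at h2
  rw [← act_step g (generic_ne_one hk.2)] at hgK
  by_contra h3
  exact h2 ⟨hgK, h3⟩

theorem ae_exists_orb : ∀ᵐ x : Heis, x ∈ core K → ∀ n, ∃ w, w.length = n ∧ x ∈ orb K w := by
  filter_upwards [D.ae_exists_next] with x hx hxc n
  induction n with
  | zero => exact ⟨[], rfl, hxc⟩
  | succ n ih =>
    obtain ⟨w, rfl, hw⟩ := ih
    obtain ⟨g, hg⟩ := hx w hw
    exact ⟨w ++ [g], by simp, hg⟩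

/-- There are infinitely many words of length `n`, so `den` has no uniform lower bound. At each
point the word is unique and `den` is nonzero, so the decreasing sets have empty intersection. -/
theorem tendsto_volume_den_le (n : ℕ) : Filter.Tendsto (fun J : ℕ =>
    volume {x | ∃ w, w.length = n ∧ x ∈ orb K w ∧ ‖den (mat w) x‖ ≤ (r ^ 2) ^ J}) Filter.atTop
      (nhds 0) := by
  let s (J : ℕ) : Set Heis := {x | ∃ w, w.length = n ∧ x ∈ orb K w ∧ ‖den (mat w) x‖ ≤ (r ^ 2) ^ J}
  have hm : ∀ J, MeasurableSet (s J) := by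
    intro J
    have : s J = ⋃ w : List integers, ⋃ _ : w.length = n,
        orb K w ∩ {x | ‖den (mat w) x‖ ≤ (r ^ 2) ^ J} := by
      ext x; simp [s, and_left_comm]
    rw [this]
    exact MeasurableSet.iUnion fun w => MeasurableSet.iUnion fun _ => (measurableSet_orb w).inter
      (isClosed_le (continuous_den _).norm continuous_const).measurableSet
  have hanti : Antitone s := by
    rintro J J' hJ x ⟨w, hw, hx, hle⟩
    exact ⟨w, hw, hx, hle.trans (pow_le_pow_of_le_one D.sq_pos.le D.sq_lt_one.le hJ)⟩
  have hfin : ∃ J, volume (s J) ≠ ⊤ := ⟨0, ((measure_mono (show s 0 ⊆ K from fun x ⟨w, _, hx, _⟩ =>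
    core_subset (orb_subset_core w hx))).trans_lt D.volume_lt_top).ne⟩
  have h := tendsto_measure_iInter_atTop (fun J => (hm J).nullMeasurableSet) hanti hfin
  have h0 : ⋂ J, s J = ∅ := by
    refine eq_empty_of_forall_notMem fun x hx => ?_
    rw [mem_iInter] at hx
    obtain ⟨w, hw, hxw, -⟩ := hx 0
    obtain ⟨J, hJ⟩ := exists_pow_lt_of_lt_one (norm_den_mat_pos hxw) D.sq_lt_one
    obtain ⟨v, hv, hxv, hle⟩ := hx J
    obtain rfl := D.orb_unique (hw.trans hv.symm) hxw hxv
    exact hle.not_gt hJ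
  rwa [h0, measure_empty] at h

/-- A digit can shrink `den` by more than `(r ^ 2) ^ I` only when the orbit has come close to the
origin. If `den (mat w) x` has scale `i`, it has entered the ball `N (J - 1 - i)`. The hitting bound
is summed over the scales as a geometric series. -/
theorem exists_volume_jump_le : ∃ C : ℝ, 0 ≤ C ∧ ∀ I J : ℕ,
    volume {x | ∃ w g, x ∈ orb K (w ++ [g]) ∧ (r ^ 2) ^ J < ‖den (mat w) x‖ * (r ^ 2) ^ I ∧
      ‖den (mat (w ++ [g])) x‖ ≤ (r ^ 2) ^ J} ≤ ENNReal.ofReal (C * (r ^ 2) ^ I) := by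
  obtain ⟨C, hC0, hC⟩ := D.exists_volume_hitting_le
  have hθ := D.sq_pos
  have hθ1 := D.sq_lt_one
  refine ⟨C * 8 / (1 - r ^ 2), by have := sub_pos.mpr hθ1; positivity, fun I J => ?_⟩
  let N (l : ℕ) : Set Heis := {k | gauge k ^ 2 ≤ (r ^ 2) ^ l}
  have hNm : ∀ l, MeasurableSet (N l) := fun l =>
    (isClosed_le (continuous_gauge.pow 2) continuous_const).measurableSet
  have hNv : ∀ l, volume (N l) ≤ ENNReal.ofReal (8 * (r ^ 2) ^ l) := by
    intro l
    have h1 : N l ⊆ {k | gauge k ≤ r ^ l} := fun k hk => by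
      have hk' : gauge k ^ 2 ≤ (r ^ 2) ^ l := hk
      rw [pow_right_comm] at hk'
      exact le_of_sq_le_sq hk' (pow_nonneg D.pos.le l)
    refine (measure_mono h1).trans ((volume_gauge_le _ (pow_nonneg D.pos.le l)).trans ?_)
    refine ENNReal.ofReal_le_ofReal ?_
    have h2 : (r ^ l) ^ 4 = ((r ^ 2) ^ l) * (r ^ 2) ^ l := by ring
    rw [h2]
    have := pow_le_one₀ (n := l) hθ.le hθ1.le
    have h3 : 0 ≤ (r ^ 2) ^ l := by positivity
    nlinarith
  have hsub : {x | ∃ w g, x ∈ orb K (w ++ [g]) ∧ (r ^ 2) ^ J < ‖den (mat w) x‖ * (r ^ 2) ^ I ∧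
      ‖den (mat (w ++ [g])) x‖ ≤ (r ^ 2) ^ J} ⊆ ⋃ l ∈ Finset.Ico I J,
        {x | ∃ w, x ∈ orb K w ∧ act (mat w) x ∈ N l ∧ (r ^ 2) ^ ((J - 1 - l) + 1) < ‖den (mat w) x‖ ∧
      ‖den (mat w) x‖ ≤ (r ^ 2) ^ (J - 1 - l)} := by
    rintro x ⟨w, g, hx, h1, h2⟩
    have hxw := ((mem_orb_append _ _).mp hx)
    have hq := norm_den_mat_pos hxw.1
    obtain ⟨i, hi1, hi2⟩ := exists_nat_pow_near_of_lt_one hq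
      ((D.den_le hxw.1).trans (pow_le_one₀ hθ.le hθ1.le)) hθ hθ1
    have hiI : i + I < J := by
      by_contra! hge
      have h3 := pow_le_pow_of_le_one hθ.le hθ1.le hge
      have h4 : ‖den (mat w) x‖ * (r ^ 2) ^ I ≤ (r ^ 2) ^ i * (r ^ 2) ^ I := by gcongr
      rw [← pow_add] at h4
      linarith
    refine mem_biUnion (x := J - 1 - i) (Finset.mem_coe.mpr (Finset.mem_Ico.mpr ⟨by omega, by omega⟩))
      ⟨w, hxw.1, ?_, ?_⟩
    · have h5 := den_append w [g] (orb_subset_core w hxw.1).2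
      have h6 : den (mat [g]) (act (mat w) x) = u (act (mat w) x) := by simp [mat, den_step]
      rw [h5, h6, norm_mul, ← gauge_sq] at h2
      show gauge _ ^ 2 ≤ _
      by_contra! h7
      have h8 : (r ^ 2) ^ J = (r ^ 2) ^ (J - 1 - i) * (r ^ 2) ^ (i + 1) := by
        rw [← pow_add]; congr 1; omega
      rw [h8] at h2
      exact h2.not_gt (mul_lt_mul h7 hi1.le (by positivity) (by positivity))
    · have : J - 1 - (J - 1 - i) = i := by omega
      rw [this]; exact ⟨hi1, hi2⟩
  refine (measure_mono hsub).trans ((measure_biUnion_finset_le _ _).trans ?_)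
  calc _ ≤ ∑ l ∈ Finset.Ico I J, ENNReal.ofReal C * ENNReal.ofReal (8 * (r ^ 2) ^ l) :=
        Finset.sum_le_sum fun l _ => (hC (N l) (hNm l) _).trans (by gcongr; exact hNv l)
    _ = ENNReal.ofReal (∑ l ∈ Finset.Ico I J, C * (8 * (r ^ 2) ^ l)) := by
        rw [ENNReal.ofReal_sum_of_nonneg fun l _ => by positivity]
        exact Finset.sum_congr rfl fun l _ => (ENNReal.ofReal_mul hC0).symm
    _ ≤ _ := by
        refine ENNReal.ofReal_le_ofReal ?_
        rw [← Finset.mul_sum, ← Finset.mul_sum]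
        calc C * (8 * ∑ l ∈ Finset.Ico I J, (r ^ 2) ^ l) ≤ C * (8 * ((r ^ 2) ^ I / (1 - r ^ 2))) := by
              gcongr; exact geom_sum_Ico_le_of_lt_one hθ.le hθ1
          _ = _ := by ring

/-- If fineness fails after a prefix of scale `i`, then at that moment the orbit is within `σ * (r ^
2) ^ (J - i)` of the complement of `K`. The hitting bound and the boundary estimate make the
failures at this scale `O(σ * (r ^ 2) ^ (J - i))`, which is summable. -/
theorem exists_volume_not_fine_le : ∃ C : ℝ, 0 ≤ C ∧ ∀ (I : ℕ) (σ : ℝ), 0 < σ → σ ≤ 1 → ∀ J : ℕ,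
    volume {x | ∃ w, x ∈ orb K w ∧ (r ^ 2) ^ J < ‖den (mat w) x‖ ∧
      ‖den (mat w) x‖ * (r ^ 2) ^ I ≤ (r ^ 2) ^ J ∧ ¬ IsFine K (σ * (r ^ 2) ^ (I + 1)) x w} ≤
        ENNReal.ofReal (C * σ) := by
  obtain ⟨C, hC0, hC⟩ := D.exists_volume_hitting_le
  obtain ⟨C', hC'0, hC'⟩ := D.exists_volume_boundary_le
  have hθ := D.sq_pos
  have hθ1 := D.sq_lt_one
  refine ⟨C * C' / (1 - r ^ 2), by have := sub_pos.mpr hθ1; positivity, fun I σ hσ hσ1 J => ?_⟩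
  let N (l : ℕ) : Set Heis := core K ∩ {a | ∃ x ∉ K, kd a x < σ * (r ^ 2) ^ l}
  have hNm : ∀ l, MeasurableSet (N l) := by
    intro l
    refine measurableSet_core.inter (IsOpen.measurableSet ?_)
    have : {a | ∃ x ∉ K, kd a x < σ * (r ^ 2) ^ l} = ⋃ x ∈ Kᶜ, {a | kd a x < σ * (r ^ 2) ^ l} := by
      ext a; simp
    rw [this]
    exact isOpen_biUnion fun x _ => isOpen_lt
      (continuous_kd_left x) continuous_const
  have hNv : ∀ l, volume (N l) ≤ ENNReal.ofReal (C' * (σ * (r ^ 2) ^ l)) := by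
    intro l
    refine (measure_mono ?_).trans (hC' (σ * (r ^ 2) ^ l) (by positivity) ?_)
    · exact fun a ha => Or.inr ⟨core_subset ha.1, ha.2⟩
    · exact mul_le_one₀ hσ1 (by positivity) (pow_le_one₀ hθ.le hθ1.le)
  have hsub : {x | ∃ w, x ∈ orb K w ∧ (r ^ 2) ^ J < ‖den (mat w) x‖ ∧
      ‖den (mat w) x‖ * (r ^ 2) ^ I ≤ (r ^ 2) ^ J ∧ ¬ IsFine K (σ * (r ^ 2) ^ (I + 1)) x w} ⊆
      ⋃ l ∈ Finset.Ico 0 (J + 1), {x | ∃ w, x ∈ orb K w ∧ act (mat w) x ∈ N l ∧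
        (r ^ 2) ^ ((J - l) + 1) < ‖den (mat w) x‖ ∧ ‖den (mat w) x‖ ≤ (r ^ 2) ^ (J - l)} := by
    rintro x ⟨w, hx, h1, h2, h3⟩
    simp only [IsFine, not_forall] at h3
    obtain ⟨w₁, w₂, rfl, y, hy, hyK⟩ := h3
    have hxw := ((mem_orb_append _ _).mp hx)
    have hq := norm_den_mat_pos hxw.1
    obtain ⟨i, hi1, hi2⟩ := exists_nat_pow_near_of_lt_one hq
      ((D.den_le hxw.1).trans (pow_le_one₀ hθ.le hθ1.le)) hθ hθ1
    have hle : ‖den (mat (w₁ ++ w₂)) x‖ ≤ ‖den (mat w₁) x‖ := (D.den_append_le hx).trans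
      (mul_le_of_le_one_left (norm_nonneg _) (pow_le_one₀ hθ.le hθ1.le))
    have hiJ : i ≤ J := by
      by_contra! hge
      have h4 := pow_le_pow_of_le_one hθ.le hθ1.le hge.le
      linarith
    refine mem_biUnion (x := J - i) (Finset.mem_coe.mpr (Finset.mem_Ico.mpr ⟨by omega, by omega⟩))
      ⟨w₁, hxw.1, ⟨act_mem_core hxw.1, y, hyK, hy.trans_le ?_⟩, ?_⟩
    · have h5 := den_append w₁ w₂ (orb_subset_core w₁ hxw.1).2
      rw [h5, norm_mul] at h2
      set e := ‖den (mat w₂) (act (mat w₁) x)‖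
      have he : 0 ≤ e := norm_nonneg _
      rw [mul_assoc]
      refine mul_le_mul_of_nonneg_left ?_ hσ.le
      have h6 : (r ^ 2) ^ J = (r ^ 2) ^ (J - i) * (r ^ 2) ^ i := by
        rw [← pow_add]; congr 1; omega
      refine le_of_mul_le_mul_right ?_ (pow_pos hθ i)
      calc (r ^ 2) ^ (I + 1) * e * (r ^ 2) ^ i = e * (r ^ 2) ^ (i + 1) * (r ^ 2) ^ I := by ring
        _ ≤ e * ‖den (mat w₁) x‖ * (r ^ 2) ^ I := by gcongr
        _ ≤ (r ^ 2) ^ J := h2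
        _ = _ := h6
    · have : J - (J - i) = i := by omega
      rw [this]; exact ⟨hi1, hi2⟩
  refine (measure_mono hsub).trans ((measure_biUnion_finset_le _ _).trans ?_)
  calc _ ≤ ∑ l ∈ Finset.Ico 0 (J + 1), ENNReal.ofReal C * ENNReal.ofReal (C' * (σ * (r ^ 2) ^ l)) :=
        Finset.sum_le_sum fun l _ => (hC (N l) (hNm l) _).trans (by gcongr; exact hNv l)
    _ = ENNReal.ofReal (∑ l ∈ Finset.Ico 0 (J + 1), C * (C' * (σ * (r ^ 2) ^ l))) := by
        rw [ENNReal.ofReal_sum_of_nonneg fun l _ => by positivity]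
        exact Finset.sum_congr rfl fun l _ => (ENNReal.ofReal_mul hC0).symm
    _ ≤ _ := by
        refine ENNReal.ofReal_le_ofReal ?_
        rw [← Finset.mul_sum, ← Finset.mul_sum, ← Finset.mul_sum]
        calc C * (C' * (σ * ∑ l ∈ Finset.Ico 0 (J + 1), (r ^ 2) ^ l))
            ≤ C * (C' * (σ * ((r ^ 2) ^ 0 / (1 - r ^ 2)))) := by
              gcongr; exact geom_sum_Ico_le_of_lt_one hθ.le hθ1
          _ = _ := by rw [pow_zero]; ring

/-- Half of the points lie on stable branches of a prescribed large size. -/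
theorem exists_volume_fine_ge : ∃ ρ : ℝ, 0 < ρ ∧ ∃ I : ℕ, ∀ n : ℕ, ∃ J₀ : ℕ, ∀ J ≥ J₀,
    volume (core K) / 2 ≤ volume {x | ∃ w : List integers, n ≤ w.length ∧ x ∈ orb K w ∧
      IsFine K ρ x w ∧ (r ^ 2) ^ J < ‖den (mat w) x‖ ∧
        ‖den (mat w) x‖ * (r ^ 2) ^ I ≤ (r ^ 2) ^ J} := by
  obtain ⟨C, hC0, hC⟩ := D.exists_volume_jump_le
  obtain ⟨C', hC'0, hC'⟩ := D.exists_volume_not_fine_le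
  have hθ := D.sq_pos
  have hθ1 := D.sq_lt_one
  have hvt : volume (core K) ≠ ⊤ := ((measure_mono core_subset).trans_lt D.volume_lt_top).ne
  set v := (volume (core K)).toReal with hv
  have hv0 : 0 < v := ENNReal.toReal_pos D.volume_core_pos.ne' hvt
  have hvv : volume (core K) = ENNReal.ofReal v := (ENNReal.ofReal_toReal hvt).symm
  -- Three exceptional sets, each allotted a sixth of the volume: large jumps, branches that are not
  -- fine, and words shorter than `n`.
  obtain ⟨I, hI⟩ := exists_pow_lt_of_lt_one (show 0 < v / (6 * (C + 1)) by positivity) hθ1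
  have hI' : C * (r ^ 2) ^ I ≤ v / 6 := by
    calc C * (r ^ 2) ^ I ≤ (C + 1) * (v / (6 * (C + 1))) := by gcongr; linarith
      _ = v / 6 := by field_simp
  let σ : ℝ := min 1 (v / (6 * (C' + 1)))
  have hσ0 : 0 < σ := lt_min one_pos (by positivity)
  have hσ' : C' * σ ≤ v / 6 := by
    calc C' * σ ≤ (C' + 1) * (v / (6 * (C' + 1))) := by
          gcongr
          · linarith
          · exact min_le_right _ _
      _ = v / 6 := by field_simp
  refine ⟨σ * (r ^ 2) ^ (I + 1), by positivity, I, fun n => ?_⟩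
  have h0 : (0 : ℝ≥0∞) < ENNReal.ofReal (v / 6) := ENNReal.ofReal_pos.mpr (by positivity)
  obtain ⟨J₀, hJ₀⟩ := Filter.eventually_atTop.mp
    ((D.tendsto_volume_den_le n).eventually_lt_const h0)
  refine ⟨J₀ + 1, fun J hJ => ?_⟩
  have hb3 := hJ₀ J (by omega)
  have hb1 := (hC I J).trans (ENNReal.ofReal_le_ofReal hI')
  have hb2 := (hC' I σ hσ0 (min_le_left _ _) J).trans (ENNReal.ofReal_le_ofReal hσ')
  set S := {x | ∃ w : List integers, n ≤ w.length ∧ x ∈ orb K w ∧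
      IsFine K (σ * (r ^ 2) ^ (I + 1)) x w ∧ (r ^ 2) ^ J < ‖den (mat w) x‖ ∧
        ‖den (mat w) x‖ * (r ^ 2) ^ I ≤ (r ^ 2) ^ J}
  set B1 := {x | ∃ w g, x ∈ orb K (w ++ [g]) ∧ (r ^ 2) ^ J < ‖den (mat w) x‖ * (r ^ 2) ^ I ∧
      ‖den (mat (w ++ [g])) x‖ ≤ (r ^ 2) ^ J}
  set B2 := {x | ∃ w, x ∈ orb K w ∧ (r ^ 2) ^ J < ‖den (mat w) x‖ ∧
      ‖den (mat w) x‖ * (r ^ 2) ^ I ≤ (r ^ 2) ^ J ∧ ¬ IsFine K (σ * (r ^ 2) ^ (I + 1)) x w}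
  set B3 := {x | ∃ w, w.length = n ∧ x ∈ orb K w ∧ ‖den (mat w) x‖ ≤ (r ^ 2) ^ J}
  have hcov : ∀ᵐ x : Heis, x ∈ core K → x ∈ S ∪ (B1 ∪ B2 ∪ B3) := by
    filter_upwards [D.ae_exists_orb] with x hx hxc
    have hx := hx hxc
    -- The word wanted is the last one before `den` drops to the threshold. It is found by deleting
    -- the last digit at the first time below the threshold.
    let P (m : ℕ) : Prop := ∃ w, w.length = m ∧ x ∈ orb K w ∧ ‖den (mat w) x‖ ≤ (r ^ 2) ^ J
    have hPJ : ∃ m, P m := by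
      obtain ⟨w, hw, hxw⟩ := hx J
      exact ⟨J, w, hw, hxw, by rw [← hw]; exact D.den_le hxw⟩
    classical
    obtain ⟨w', hw', hxw', hle'⟩ := Nat.find_spec hPJ
    have hne : w' ≠ [] := by
      rintro rfl
      simp only [mat, den_one, norm_one] at hle'
      exact hle'.not_gt (pow_lt_one₀ hθ.le hθ1 (by omega))
    obtain ⟨w, g, rfl⟩ : ∃ w g, w' = w ++ [g] := ⟨_, _, (List.dropLast_append_getLast hne).symm⟩
    have hxw := ((mem_orb_append _ _).mp hxw').1
    have hgt : (r ^ 2) ^ J < ‖den (mat w) x‖ := by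
      by_contra! hle
      have := Nat.find_min' hPJ ⟨w, rfl, hxw, hle⟩
      rw [← hw'] at this
      simp at this
    by_cases h1 : ‖den (mat w) x‖ * (r ^ 2) ^ I ≤ (r ^ 2) ^ J
    · by_cases h2 : IsFine K (σ * (r ^ 2) ^ (I + 1)) x w
      · by_cases h3 : n ≤ w.length
        · exact Or.inl ⟨w, h3, hxw, h2, hgt, h1⟩
        · obtain ⟨z, hz, hxz⟩ := hx n
          refine Or.inr (Or.inr ⟨z, hz, hxz, ?_⟩)
          obtain ⟨z', rfl⟩ := D.orb_prefix (w := w ++ [g]) (v := z) (by simp; omega) hxw' hxz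
          exact ((D.den_append_le hxz).trans
            (mul_le_of_le_one_left (norm_nonneg _) (pow_le_one₀ hθ.le hθ1.le))).trans hle'
      · exact Or.inr (Or.inl (Or.inr ⟨w, hxw, hgt, h1, h2⟩))
    · exact Or.inr (Or.inl (Or.inl ⟨w, g, hxw', not_le.mp h1, hle'⟩))
  have hB : volume (B1 ∪ B2 ∪ B3) ≤ ENNReal.ofReal (v / 2) := by
    calc _ ≤ volume B1 + volume B2 + volume B3 :=
          (measure_union_le _ _).trans (by gcongr; exact measure_union_le _ _)
      _ ≤ ENNReal.ofReal (v / 6) + ENNReal.ofReal (v / 6) + ENNReal.ofReal (v / 6) := by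
          gcongr
      _ = ENNReal.ofReal (v / 2) := by
          rw [← ENNReal.ofReal_add (by positivity) (by positivity),
            ← ENNReal.ofReal_add (by positivity) (by positivity)]
          congr 1; ring
  have hfinal : volume (core K) ≤ volume S + ENNReal.ofReal (v / 2) :=
    (measure_mono_ae hcov).trans ((measure_union_le _ _).trans (by gcongr))
  have h2 : volume (core K) / 2 = ENNReal.ofReal v - ENNReal.ofReal (v / 2) := by
    rw [hvv, ← ENNReal.ofReal_sub _ (by positivity), ENNReal.div_eq_inv_mul,
      ← ENNReal.ofReal_ofNat 2, ← ENNReal.ofReal_inv_of_pos two_pos, ← ENNReal.ofReal_mul (by norm_num)]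
    congr 1; ring
  rw [h2, ← hvv]
  exact tsub_le_iff_right.mpr hfinal

end IsSmallDomain
end

section

/-! ### Rational points -/

theorem exists_gauge_ball_subset {W : Set Heis} (hW : W ∈ nhds (1 : Heis)) :
    ∃ ε > 0, ∀ x, gauge x < ε → x ∈ W := by
  have hW' : W ∈ nhds ((0, 0) : ℂ × ℝ) := hW
  obtain ⟨ε, hε, hb⟩ := Metric.mem_nhds_iff.mp hW'
  refine ⟨min ε 1, lt_min hε one_pos, fun x hx => ?_⟩
  have h0 := gauge_nonneg x
  have h1 : gauge x < ε := hx.trans_le (min_le_left _ _)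
  have h2 : gauge x < 1 := hx.trans_le (min_le_right _ _)
  refine hb (show dist (α := ℂ × ℝ) x (0, 0) < ε from max_lt ?_ ?_)
  · exact (dist_zero_right x.z).trans_lt ((norm_z_le x).trans_lt h1)
  · exact (dist_zero_right x.t).trans_lt ((abs_t_le x).trans_lt (by nlinarith))

theorem exists_kd_ball_subset {x : Heis} {W : Set Heis} (hW : W ∈ nhds x) :
    ∃ ε > 0, ∀ y, kd x y < ε → y ∈ W := by
  have h1 : (fun h => x * h) ⁻¹' W ∈ nhds (1 : Heis) :=
    (continuous_mul_left x).continuousAt.preimage_mem_nhds (by rwa [mul_one])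
  obtain ⟨ε, hε, h⟩ := exists_gauge_ball_subset h1
  refine ⟨ε, hε, fun y hy => ?_⟩
  have := h (x⁻¹ * y) hy
  rwa [mem_preimage, mul_inv_cancel_left] at this

/-- The point `p` is rational with denominator `q`. -/
def IsRat (q : ℂ) (p : Heis) : Prop := q ≠ 0 ∧ q • X p ∈ lattice

theorem IsRat.isInt {q : ℂ} {p : Heis} (h : IsRat q p) : IsInt q := by
  have := h.2.1
  simpa [X] using this

theorem IsRat.map {q : ℂ} {p : Heis} (h : IsRat q p) {A : V ≃ₗ[ℂ] V} (hA : A ∈ modular)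
    (h0 : den A p ≠ 0) : IsRat (q * den A p) (act A p) := by
  refine ⟨mul_ne_zero h.1 h0, ?_⟩
  rw [mul_smul, ← act_spec hA h0, ← map_smul]
  exact map_lattice hA h.2

theorem exists_isRat_mem {U : Set Heis} (hU : IsOpen U) (hne : U.Nonempty) : ∃ q, ∃ p ∈ U, IsRat q p := by
  obtain ⟨x, hx⟩ := hne
  let F (n : ℕ) : Heis := mk ⟨⌊x.z.re * n⌋ / n, ⌊x.z.im * n⌋ / n⟩ (⌊x.t * n⌋ / n)
  have hlim : ∀ a : ℝ, Filter.Tendsto (fun n : ℕ => (⌊a * n⌋ : ℝ) / n) Filter.atTop (nhds a) :=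
    fun a => by
      have h1 : Filter.Tendsto (fun n : ℕ => a - 1 / (n : ℝ)) Filter.atTop (nhds a) := by
        simpa using tendsto_const_nhds.sub (tendsto_one_div_atTop_nhds_zero_nat (𝕜 := ℝ))
      refine tendsto_of_tendsto_of_tendsto_of_le_of_le' h1 tendsto_const_nhds ?_ ?_
      · filter_upwards [Filter.eventually_ge_atTop 1] with n hn
        have hn0 : (0 : ℝ) < n := by exact_mod_cast hn
        rw [le_div_iff₀ hn0, sub_mul, one_div_mul_cancel hn0.ne']
        exact (Int.sub_one_lt_floor _).le
      · filter_upwards [Filter.eventually_ge_atTop 1] with n hn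
        have hn0 : (0 : ℝ) < n := by exact_mod_cast hn
        rw [div_le_iff₀ hn0]
        exact Int.floor_le _
  have hF : Filter.Tendsto F Filter.atTop (nhds x) := by
    have h1 : Filter.Tendsto (fun n : ℕ => (⟨⌊x.z.re * n⌋ / n, ⌊x.z.im * n⌋ / n⟩ : ℂ))
        Filter.atTop (nhds x.z) := by
      have := (Complex.continuous_ofReal.tendsto _).comp (hlim x.z.re) |>.add
        (((Complex.continuous_ofReal.tendsto _).comp (hlim x.z.im)).mul_const Complex.I)
      rw [Complex.re_add_im] at this
      refine this.congr fun n => ?_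
      apply Complex.ext <;> simp
    exact h1.prodMk_nhds (hlim x.t)
  obtain ⟨n, hn, hn1⟩ := ((hF.eventually (hU.mem_nhds hx)).and (Filter.eventually_ge_atTop 1)).exists
  have hn0 : (n : ℝ) ≠ 0 := by positivity
  refine ⟨(n : ℂ) ^ 2, F n, hn, pow_ne_zero 2 (by exact_mod_cast hn0), ⟨⟨n ^ 2, 0, ?_⟩, ⟨⌊x.z.re * n⌋ * n, ⌊x.z.im * n⌋ * n, ?_⟩,
    ⟨⌊x.z.re * n⌋ ^ 2 + ⌊x.z.im * n⌋ ^ 2, ⌊x.t * n⌋ * n, ?_⟩⟩⟩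
  · apply Complex.ext <;> simp [X, pow_two]
  · apply Complex.ext <;> simp [X, F, pow_two] <;> field_simp
  · apply Complex.ext
    · simp [X, F, pow_two]
      rw [← pow_two ‖_‖, Complex.sq_norm, Complex.normSq_mk]
      field_simp
    · simp [X, F, pow_two]
      field_simp

/-! ### Orbits that avoid the boundary and end at the origin -/

variable {K : Set Heis} {r : ℝ}

theorem finite_integers_gauge_le (R : ℝ) : {g : Heis | g ∈ integers ∧ gauge g ≤ R}.Finite := by
  refine Finite.of_finite_image (f := X) ((finite_lattice_norm_le (1 + |R| + R ^ 2)).subset ?_)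
    fun g _ h _ e => X_injective e
  rintro _ ⟨g, ⟨hg, hR⟩, rfl⟩
  have h0 := gauge_nonneg g
  have h1 : ‖u g‖ ≤ R ^ 2 := by rw [← gauge_sq]; exact pow_le_pow_left₀ h0 hR 2
  have h2 := (norm_z_le g).trans (hR.trans (le_abs_self R))
  refine ⟨X_mem_lattice hg, norm_prod_le_iff.mpr ⟨?_, norm_prod_le_iff.mpr ⟨?_, ?_⟩⟩⟩
  · rw [X, norm_one]; nlinarith [abs_nonneg R]
  · exact h2.trans (by nlinarith)
  · exact h1.trans (by nlinarith [abs_nonneg R])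

/-- The points of the interior of `K` whose orbit starts with a given word of digits and stays in
the interior. -/
def orbInt (K : Set Heis) : List integers → Set Heis
  | [] => interior K
  | g :: w => {x | x ∈ interior K ∧ x ≠ 1 ∧ act (step g) x ∈ orbInt K w}

theorem den_step_ne_zero (g : Heis) {x : Heis} (hx : x ≠ 1) : den (step g) x ≠ 0 := by
  rwa [den_step, Ne, u_eq_zero]

theorem isOpen_orbInt : ∀ w, IsOpen (orbInt K w)
  | [] => isOpen_interior
  | g :: w => by
    rw [isOpen_iff_mem_nhds]
    rintro x ⟨h1, h2, h3⟩
    filter_upwards [isOpen_interior.mem_nhds h1, isOpen_ne.mem_nhds h2,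
      (continuousAt_act (den_step_ne_zero g h2)).preimage_mem_nhds
        ((isOpen_orbInt w).mem_nhds h3)] with y h4 h5 h6
    exact ⟨h4, h5, h6⟩

theorem den_ne_zero_of_mem_orbInt {w : List integers} {x : Heis} (hx : x ∈ orbInt K w) :
    den (mat w) x ≠ 0 := by
  induction w generalizing x with
  | nil => simp [mat]
  | cons g w ih =>
    have h0 := den_step_ne_zero g hx.2.1
    rw [mat, den_mul (step_mem g.2) h0]
    exact mul_ne_zero (ih hx.2.2) h0

theorem act_mem_interior {w : List integers} {x : Heis} (hx : x ∈ orbInt K w) :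
    act (mat w) x ∈ interior K := by
  induction w generalizing x with
  | nil => rw [mat, act_one]; exact hx
  | cons g w ih =>
    rw [mat, act_mul (step_mem g.2) (den_step_ne_zero g hx.2.1)]
    exact ih hx.2.2

theorem mem_orbInt_append {w v : List integers} {x : Heis} (h1 : x ∈ orbInt K w)
    (h2 : act (mat w) x ∈ orbInt K v) : x ∈ orbInt K (w ++ v) := by
  induction w generalizing x with
  | nil => simpa [mat] using h2
  | cons g w ih =>
    rw [mat, act_mul (step_mem g.2) (den_step_ne_zero g h1.2.1)] at h2
    exact ⟨h1.1, h1.2.1, ih h1.2.2 h2⟩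

theorem orbInt_inter_generic {w : List integers} {x : Heis} (hx : x ∈ orbInt K w)
    (hg : x ∈ generic) : x ∈ orb K w := by
  induction w generalizing x with
  | nil => exact ⟨hx, hg⟩
  | cons g w ih => exact ⟨⟨hx.1, hg⟩, ih hx.2.2 (act_mem_generic (step_mem g.2) hg)⟩

namespace IsSmallDomain

variable (D : IsSmallDomain K r)
include D

/-- The Euclidean algorithm: translation into `K` keeps the denominator, and inversion multiplies it
by `u`, of norm less than 1. Its squared norm is a natural number, so the descent stops. -/
theorem exists_act_eq_one {q : ℂ} {p : Heis} (h : IsRat q p) :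
    ∃ A ∈ modular, den A p ≠ 0 ∧ act A p = 1 := by
  obtain ⟨n, hn⟩ := h.isInt.normSq
  induction n using Nat.strong_induction_on generalizing q p with
  | _ n ih =>
    obtain ⟨g, hg, hgK⟩ := D.exists_digit p
    have hT := transl_mem (inv_mem hg)
    have hdT : den (transl g⁻¹) p ≠ 0 := by simp
    by_cases h1 : g⁻¹ * p = 1
    · exact ⟨transl g⁻¹, hT, hdT, by rw [act_transl, h1]⟩
    have hdI : den invl (g⁻¹ * p) ≠ 0 := by rwa [den_invl, Ne, u_eq_zero]
    have h2 : IsRat q (g⁻¹ * p) := by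
      have := h.map hT hdT
      rwa [den_transl, mul_one, act_transl] at this
    have h3 := h2.map invl_mem hdI
    obtain ⟨m, hm⟩ := h3.isInt.normSq
    have hlt : m < n := by
      have hq : 0 < ‖q‖ := norm_pos_iff.mpr h.1
      rw [den_invl, norm_mul, ← gauge_sq] at hm
      have h5 := gauge_nonneg (g⁻¹ * p)
      have h6 := (D.gauge_le _ hgK).trans_lt D.lt_one
      have h7 : gauge (g⁻¹ * p) ^ 2 < 1 := by nlinarith
      have h8 : (m : ℝ) < n := by
        rw [← hm, ← hn, mul_pow]
        have : (gauge (g⁻¹ * p) ^ 2) ^ 2 < 1 := by nlinarith [sq_nonneg (gauge (g⁻¹ * p))]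
        exact mul_lt_of_lt_one_right (by positivity) this
      exact_mod_cast h8
    obtain ⟨A, hA, hA0, hA1⟩ := ih m hlt h3 hm
    have hBm : invl * transl g⁻¹ ∈ modular := mul_mem invl_mem hT
    have hBd : den (invl * transl g⁻¹) p = den invl (g⁻¹ * p) := by
      rw [den_mul hT hdT, act_transl, den_transl, mul_one]
    have hBa : act (invl * transl g⁻¹) p = act invl (g⁻¹ * p) := by
      rw [act_mul hT hdT, act_transl]
    refine ⟨A * (invl * transl g⁻¹), mul_mem hA hBm, ?_, ?_⟩
    · rw [den_mul hBm (by rwa [hBd]), hBa, hBd]; exact mul_ne_zero hA0 hdI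
    · rw [act_mul hBm (by rwa [hBd]), hBa, hA1]

/-- Near a rational point, only finitely many elements of the modular group occur along the orbits
until they come close to the origin. -/
theorem exists_finite_descent {q : ℂ} {p : Heis} (h : IsRat q p) (hp : p ∈ closure K) :
    ∃ Λ : Set (V ≃ₗ[ℂ] V), Λ.Finite ∧ Λ ⊆ modular ∧ ∃ W ∈ nhds p, ∀ v ∈ W, v ∈ interior K →
      (∀ σ ∈ Λ, den σ v ≠ 0 → act σ v ∉ frontier K) →
        ∃ w, v ∈ orbInt K w ∧ den (mat w) p ≠ 0 ∧ act (mat w) p = 1 := by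
  obtain ⟨n, hn⟩ := h.isInt.normSq
  induction n using Nat.strong_induction_on generalizing q p with
  | _ n ih =>
    by_cases hp1 : p = 1
    · exact ⟨∅, finite_empty, empty_subset _, univ, Filter.univ_mem, fun v _ hv _ =>
        ⟨[], hv, by simp [mat], by simp [mat, hp1]⟩⟩
    have hd := fun g => den_step_ne_zero g hp1
    -- The only digits possible near `p`: one unit of room for replacing `p` by a nearby `v`, and
    -- one for the radius of `K`.
    let H : Set Heis := {g | g ∈ integers ∧ gauge g ≤ gauge (inversion p) + 2}
    have hH : H.Finite := finite_integers_gauge_le _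
    -- A digit that sends `p` outside `closure K` does so near `p` as well. The remaining digits
    -- lead to rational points of `closure K` with smaller denominator, to which induction applies;
    -- several may occur when `p` is sent to the boundary.
    let H₀ : Set Heis := {g | g ∈ H ∧ act (step g) p ∈ closure K}
    have hH₀ : H₀.Finite := hH.subset fun g hg => hg.1
    have hih : ∀ g ∈ H₀, ∃ Λ : Set (V ≃ₗ[ℂ] V), Λ.Finite ∧ Λ ⊆ modular ∧
        ∃ W ∈ nhds (act (step g) p), ∀ v ∈ W, v ∈ interior K →
        (∀ σ ∈ Λ, den σ v ≠ 0 → act σ v ∉ frontier K) →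
        ∃ w, v ∈ orbInt K w ∧ den (mat w) (act (step g) p) ≠ 0 ∧
          act (mat w) (act (step g) p) = 1 := by
      intro g hg
      have h3 := h.map (step_mem hg.1.1) (hd g)
      obtain ⟨m, hm⟩ := h3.isInt.normSq
      refine ih m ?_ h3 hg.2 hm
      have hq : 0 < ‖q‖ := norm_pos_iff.mpr h.1
      rw [den_step, norm_mul, ← gauge_sq] at hm
      have h5 := gauge_nonneg p
      have h6 := (D.gauge_le_closure hp).trans_lt D.lt_one
      have h7 : gauge p ^ 2 < 1 := by nlinarith
      have h8 : (m : ℝ) < n := by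
        rw [← hm, ← hn, mul_pow]
        have : (gauge p ^ 2) ^ 2 < 1 := by nlinarith [sq_nonneg (gauge p)]
        exact mul_lt_of_lt_one_right (by positivity) this
      exact_mod_cast h8
    choose! S hSf hSm W hW hWS using hih
    refine ⟨⋃ g ∈ H₀, insert (step g) ((fun σ => σ * step g) '' S g),
      hH₀.biUnion fun g hg => ((hSf g hg).image _).insert _, ?_, ?_⟩
    · refine iUnion₂_subset fun g hg => insert_subset (step_mem hg.1.1) ?_
      rintro _ ⟨σ, hσ, rfl⟩
      exact mul_mem (hSm g hg hσ) (step_mem hg.1.1)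
    have hc : ∀ g, ContinuousAt (act (step g)) p := fun g => continuousAt_act (hd g)
    have hev : ∀ᶠ v in nhds p, v ≠ 1 ∧ gauge (act invl v) < gauge (inversion p) + 1 ∧
        (∀ g ∈ H \ H₀, act (step g) v ∉ closure K) ∧ ∀ g ∈ H₀, act (step g) v ∈ W g := by
      refine Filter.Eventually.and (isOpen_ne.mem_nhds hp1)
        (Filter.Eventually.and ?_ (Filter.Eventually.and ?_ ?_))
      · have hci : ContinuousAt (fun v => gauge (act invl v)) p :=
          continuous_gauge.continuousAt.comp (continuousAt_act (A := invl)
            (by rwa [den_invl, Ne, u_eq_zero]))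
        refine hci.eventually_lt continuousAt_const ?_
        rw [act_invl hp1]; linarith
      · rw [Filter.eventually_all_finite (hH.subset sdiff_subset)]
        intro g hg
        exact (hc g).eventually (isClosed_closure.isOpen_compl.mem_nhds fun hcl => hg.2 ⟨hg.1, hcl⟩)
      · rw [Filter.eventually_all_finite hH₀]
        intro g hg
        exact (hc g).preimage_mem_nhds (hW g hg)
    refine ⟨_, hev, ?_⟩
    rintro v ⟨hv1, hv2, hv3, hv4⟩ hvi hav
    rw [act_invl hv1] at hv2
    obtain ⟨g, hg, hgK⟩ := D.exists_digit (inversion v)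
    have hgK' := hgK
    rw [← act_step g hv1] at hgK'
    have hgH : g ∈ H := by
      refine ⟨hg, ?_⟩
      have h8 := gauge_mul_le (inversion v) (g⁻¹ * inversion v)⁻¹
      rw [gauge_inv, mul_inv_rev, inv_inv, mul_inv_cancel_left] at h8
      linarith [D.gauge_le_one hgK]
    have hg₀ : g ∈ H₀ := by
      by_contra h9
      exact hv3 g ⟨hgH, h9⟩ (subset_closure hgK')
    have hdv := den_step_ne_zero g hv1
    have hmem : ∀ {σ}, σ ∈ insert (step g) ((fun σ => σ * step g) '' S g) →
        σ ∈ ⋃ g ∈ H₀, insert (step g) ((fun σ => σ * step g) '' S g) := fun h9 =>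
      mem_biUnion hg₀ h9
    -- The digit puts the image in `K`, and the avoidance hypothesis keeps it off the frontier.
    have hint : act (step g) v ∈ interior K := by
      have h9 := hav _ (hmem (mem_insert _ _)) hdv
      by_contra h10
      exact h9 ⟨subset_closure hgK', h10⟩
    obtain ⟨w, hw1, hw2, hw3⟩ := hWS g hg₀ (act (step g) v) (hv4 g hg₀) hint (by
      intro σ hσ hσd
      have h9 := hav _ (hmem (mem_insert_of_mem _ (mem_image_of_mem _ hσ)))
      rw [act_mul (step_mem hg) hdv] at h9
      refine h9 ?_
      rw [den_mul (step_mem hg) hdv]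
      exact mul_ne_zero hσd hdv)
    refine ⟨⟨g, hg⟩ :: w, ⟨hvi, hv1, hw1⟩, ?_, ?_⟩
    · rw [mat, den_mul (step_mem hg) (hd g)]; exact mul_ne_zero hw2 (hd g)
    · rw [mat, act_mul (step_mem hg) (hd g), hw3]

end IsSmallDomain

/-- Far integer points can be chosen such that finitely many given elements of the modular group do
not move them to the boundary of `K`. -/
theorem exists_integer_avoiding (hK : HasPiecewiseSmoothBoundary K) {Ψ : Set (V ≃ₗ[ℂ] V)}
    (hΨ : Ψ.Finite) (hΨm : Ψ ⊆ modular) (R : ℝ) :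
    ∃ g ∈ integers, R ≤ gauge g ∧ ∀ ψ ∈ Ψ, den ψ g ≠ 0 → act ψ g ∉ frontier K := by
  obtain ⟨n, f, hf, hfr⟩ := hK
  have : Fintype Ψ := hΨ.fintype
  -- The boundary patches, lifted to homogeneous coordinates and pulled back by the elements of `Ψ`;
  -- no division is needed, so they stay smooth on the whole square.
  let G (i : Ψ × Fin n) (s : ℝ × ℝ) : V :=
    (i.1 : V ≃ₗ[ℂ] V)⁻¹ (1, (f i.2 s).1, ⟨‖(f i.2 s).1‖ ^ 2, (f i.2 s).2⟩)
  have hG : ∀ i, ContDiff ℝ ∞ (G i) := by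
    intro i
    have h1 : ContDiff ℝ ∞ fun s => (f i.2 s).1 := (hf i.2).fst
    have h2 : ContDiff ℝ ∞ fun s => (f i.2 s).2 := (hf i.2).snd
    have h3 : ContDiff ℝ ∞ fun s => (⟨‖(f i.2 s).1‖ ^ 2, (f i.2 s).2⟩ : ℂ) := by
      have e : (fun s => (⟨‖(f i.2 s).1‖ ^ 2, (f i.2 s).2⟩ : ℂ)) = fun s =>
          Complex.ofRealCLM (‖(f i.2 s).1‖ ^ 2) + Complex.ofRealCLM (f i.2 s).2 * Complex.I := by
        funext s; apply Complex.ext <;> simp [-Complex.ofReal_pow]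
      rw [e]
      exact (Complex.ofRealCLM.contDiff.comp (h1.norm_sq ℝ)).add
        ((Complex.ofRealCLM.contDiff.comp h2).mul contDiff_const)
    have h4 : ContDiff ℝ ∞ fun s => ((1, (f i.2 s).1, ⟨‖(f i.2 s).1‖ ^ 2, (f i.2 s).2⟩) : V) :=
      contDiff_const.prodMk (h1.prodMk h3)
    exact ((LinearMap.toContinuousLinearMap
      (((i.1 : V ≃ₗ[ℂ] V)⁻¹ : V ≃ₗ[ℂ] V) : V →ₗ[ℂ] V)).restrictScalars ℝ).contDiff.comp h4
  have hre : ∀ {F : ℝ × ℝ → ℂ}, ContDiff ℝ ∞ F → ContDiff ℝ ∞ fun s => (F s).re :=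
    fun h => Complex.reCLM.contDiff.comp h
  have him : ∀ {F : ℝ × ℝ → ℂ}, ContDiff ℝ ∞ F → ContDiff ℝ ∞ fun s => (F s).im :=
    fun h => Complex.imCLM.contDiff.comp h
  have hcj : ∀ {F : ℝ × ℝ → ℂ}, ContDiff ℝ ∞ F → ContDiff ℝ ∞ fun s => starRingEnd ℂ (F s) :=
    fun h => Complex.conjCLE.contDiff.comp h
  obtain ⟨M, hM1, hM⟩ : ∃ M : ℝ, 1 ≤ M ∧ ∀ ψ ∈ Ψ, ∀ v : V, ‖ψ v‖ ≤ M * ‖v‖ := by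
    obtain ⟨M, hM⟩ := (hΨ.image fun ψ : V ≃ₗ[ℂ] V =>
      ‖LinearMap.toContinuousLinearMap (ψ : V →ₗ[ℂ] V)‖).bddAbove
    refine ⟨max 1 M, le_max_left _ _, fun ψ hψ v => ?_⟩
    refine ((LinearMap.toContinuousLinearMap (ψ : V →ₗ[ℂ] V)).le_opNorm v).trans ?_
    gcongr
    exact (hM (mem_image_of_mem _ hψ)).trans (le_max_right _ _)
  obtain ⟨L₀, hL₀⟩ := exists_nat_ge (max R 1)
  -- Multiplication by the conjugate of the first coordinate makes the denominator the real function
  -- `|G.1| ^ 2`. At an integer point sent to the boundary it equals `‖den ψ g‖ ^ (-2)`. Since `‖X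
  -- g‖ ≤ 10 * L ^ 8`, it is at least `1 / (100 * M ^ 2 * L ^ 16)`, whence the exponent 16 and `C₀`.
  obtain ⟨L, hLL, φ, hφ, hD⟩ := exists_integer_point_off_surfaces
    (A := fun i s => ((G i s).2.1 * starRingEnd ℂ (G i s).1).re)
    (B := fun i s => ((G i s).2.1 * starRingEnd ℂ (G i s).1).im)
    (C := fun i s => ((G i s).2.2 * starRingEnd ℂ (G i s).1).im)
    (D := fun i s => ((G i s).1 * starRingEnd ℂ (G i s).1).re)
    (fun i => hre ((hG i).snd.fst.mul (hcj (hG i).fst)))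
    (fun i => him ((hG i).snd.fst.mul (hcj (hG i).fst)))
    (fun i => him ((hG i).snd.snd.mul (hcj (hG i).fst)))
    (fun i => hre ((hG i).fst.mul (hcj (hG i).fst))) 16 (C₀ := 100 * M ^ 2) (by positivity) L₀
  have hL1 : (1 : ℝ) ≤ L := (le_max_right R 1).trans (hL₀.trans (by exact_mod_cast hLL))
  have hLR : R ≤ L := (le_max_left R 1).trans (hL₀.trans (by exact_mod_cast hLL))
  have hφ' : ∀ j, (L : ℝ) ^ 4 ≤ φ j ∧ (φ j : ℝ) ≤ 2 * (L : ℝ) ^ 4 := fun j =>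
    ⟨by exact_mod_cast (hφ j).1, by exact_mod_cast (hφ j).2.le⟩
  have hL4 : (1 : ℝ) ≤ (L : ℝ) ^ 4 := one_le_pow₀ hL1
  set g : Heis := mk ⟨φ 0, φ 1⟩ (φ 2) with hgdef
  refine ⟨g, ⟨φ 0, φ 1, φ 2, rfl⟩, ?_, ?_⟩
  · calc R ≤ L := hLR
      _ ≤ (L : ℝ) ^ 4 := le_self_pow₀ hL1 (by norm_num)
      _ ≤ φ 0 := (hφ' 0).1
      _ ≤ ‖g.z‖ := (le_abs_self _).trans (Complex.abs_re_le_norm g.z)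
      _ ≤ gauge g := norm_z_le g
  · intro ψ hψ hd0 hmem
    rw [hfr] at hmem
    obtain ⟨j, s, hs, e⟩ := mem_iUnion.mp hmem
    have hGs : G (⟨ψ, hψ⟩, j) s = (den ψ g)⁻¹ • X g := by
      have h1 : ((1, (f j s).1, ⟨‖(f j s).1‖ ^ 2, (f j s).2⟩) : V) = X (act ψ g) := by
        rw [e]; rfl
      have h2 : ψ⁻¹ (ψ (X g)) = X g := ψ.symm_apply_apply _
      show ψ⁻¹ (1, (f j s).1, ⟨‖(f j s).1‖ ^ 2, (f j s).2⟩) = _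
      rw [h1, ← h2, act_spec (hΨm hψ) hd0, map_smul, smul_smul, inv_mul_cancel₀ hd0, one_smul]
    have hX1 : (X g).1 = 1 := rfl
    have hX2 : (X g).2.1 = ⟨φ 0, φ 1⟩ := rfl
    have hX3 : (X g).2.2.im = φ 2 := rfl
    set d := den ψ g
    have hdd : ∀ c : ℂ, d⁻¹ * c * starRingEnd ℂ d⁻¹ = ((‖d‖ ^ 2)⁻¹ : ℝ) * c := by
      intro c
      rw [mul_right_comm, Complex.mul_conj, Complex.normSq_eq_norm_sq, norm_inv, inv_pow]
    have hdd1 : d⁻¹ * starRingEnd ℂ d⁻¹ = ((‖d‖ ^ 2)⁻¹ : ℝ) := by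
      simpa only [mul_one] using hdd 1
    have hlt := hD (⟨ψ, hψ⟩, j) s hs
    simp only [hGs, Prod.smul_fst, Prod.smul_snd, smul_eq_mul, hX1, mul_one, hdd, hdd1,
      Complex.re_ofReal_mul, Complex.im_ofReal_mul, hX2, hX3, Complex.ofReal_re, forall_const] at hlt
    have hdpos : 0 < ‖d‖ := norm_pos_iff.mpr hd0
    have hX : ‖X g‖ ≤ 10 * (L : ℝ) ^ 8 := by
      have h8 : (L : ℝ) ^ 8 = (L : ℝ) ^ 4 * (L : ℝ) ^ 4 := by ring
      have hz2 : ‖g.z‖ ^ 2 ≤ 8 * (L : ℝ) ^ 8 := by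
        rw [norm_sq_eq, h8]
        have h0 := hφ' 0
        have h1 := hφ' 1
        show (φ 0 : ℝ) * φ 0 + φ 1 * φ 1 ≤ _
        nlinarith
      have ht : |g.t| ≤ 2 * (L : ℝ) ^ 8 := by
        show |(φ 2 : ℝ)| ≤ _
        rw [abs_of_nonneg (by linarith [hφ' 2]), h8]
        nlinarith [hφ' 2]
      refine norm_prod_le_iff.mpr ⟨?_, norm_prod_le_iff.mpr ⟨?_, ?_⟩⟩
      · rw [hX1, norm_one]; nlinarith
      · show ‖g.z‖ ≤ _
        nlinarith [norm_nonneg g.z, sq_nonneg (‖g.z‖ - 1)]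
      · show ‖u g‖ ≤ _
        refine (Complex.norm_le_abs_re_add_abs_im _).trans ?_
        rw [u_re, u_im, abs_of_nonneg (by positivity)]
        linarith
    have hd2 : ‖d‖ ≤ M * (10 * (L : ℝ) ^ 8) :=
      (norm_fst_le (ψ (X g))).trans ((hM ψ hψ _).trans (by gcongr))
    have hd3 : ‖d‖ ^ 2 ≤ 100 * M ^ 2 * (L : ℝ) ^ 16 := by
      calc ‖d‖ ^ 2 ≤ (M * (10 * (L : ℝ) ^ 8)) ^ 2 := by gcongr
        _ = _ := by ring
    rw [abs_of_nonneg (by positivity), ← div_eq_mul_inv, div_lt_one (by positivity)] at hlt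
    exact hlt.not_ge hd3

/-- Conjugated by the inversion, `B` fixes infinity, so it should permute the integers. Indeed both
`b` and `b⁻¹` are Gaussian integers, so `‖b‖ = 1`. The first coordinate `m` of the image of `X g` is
then a unit, and dividing by it leaves a lattice vector that is a lift. -/
theorem inversion_mem_integers {B : V ≃ₗ[ℂ] V} (hB : B ∈ modular) {b : ℂ} (hb : b ≠ 0)
    (hBb : B (X 1) = b • X 1) {g : Heis} (hg : g ∈ integers) (hg1 : g ≠ 1)
    (hd : den B (inversion g) ≠ 0) (h1 : act B (inversion g) ≠ 1) :
    inversion (act B (inversion g)) ∈ integers := by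
  have hX1 : X 1 = ((1, 0, 0) : V) := by
    refine Prod.ext rfl (Prod.ext rfl ?_)
    exact u_eq_zero.mpr rfl
  have hl1 : X 1 ∈ lattice := X_mem_lattice (one_mem _)
  have hb1 : 1 ≤ ‖b‖ := by
    have h2 := map_lattice hB hl1
    rw [hBb, hX1] at h2
    have h3 : IsInt b := by simpa using h2.1
    exact h3.one_le_norm hb
  have hBinv : B⁻¹ (X 1) = b⁻¹ • X 1 := by
    have h2 : B⁻¹ (B (X 1)) = X 1 := B.symm_apply_apply _
    rw [hBb, map_smul] at h2
    rw [eq_inv_smul_iff₀ hb, h2]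
  have hb2 : 1 ≤ ‖b⁻¹‖ := by
    have h2 := map_lattice (inv_mem hB) hl1
    rw [hBinv, hX1] at h2
    have h3 : IsInt b⁻¹ := by simpa using h2.1
    exact h3.one_le_norm (inv_ne_zero hb)
  have hbn : ‖b⁻¹‖ = 1 := by
    rw [norm_inv] at hb2 ⊢
    have := inv_le_one_of_one_le₀ hb1
    linarith
  set y := act B (inversion g)
  set Y : V := invl (B (invl (X g)))
  have hY : Y = (u g * den B (inversion g) * u y) • X (inversion y) := by
    rw [mul_smul, ← invl_X h1, mul_smul, ← map_smul invl, ← act_spec hB hd, ← map_smul invl,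
      ← map_smul B, ← invl_X hg1]
  have hYl : Y ∈ lattice := map_lattice invl_mem (map_lattice hB (map_lattice invl_mem (X_mem_lattice hg)))
  set m := u g * den B (inversion g) * u y
  have hYm : Y.1 = m := by rw [hY]; simp [X]
  have hm : ‖m‖ = 1 := by
    have h2 : Y.1 = form (X 1) (B (invl (X g))) := by rw [hX1]; simp [form, Y, invl_apply]
    have h3 : form (X 1) (B (invl (X g))) = form (B⁻¹ (X 1)) (invl (X g)) := by
      rw [← form_map hB (B⁻¹ (X 1))]
      congr 1
      exact (B.apply_symm_apply _).symm
    rw [← hYm, h2, h3, hBinv, form_smul_left, norm_mul, Complex.norm_conj, hbn, hX1]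
    simp [form, invl_apply, X]
  have hmi : IsInt (starRingEnd ℂ m) := by rw [← hYm]; exact hYl.1.conj
  have hmm : starRingEnd ℂ m * m = 1 := by
    rw [mul_comm, Complex.mul_conj, Complex.normSq_eq_norm_sq, hm]; simp
  have hXY : X (inversion y) = starRingEnd ℂ m • Y := by rw [hY, smul_smul, hmm, one_smul]
  rw [mem_integers_iff]
  have h4 : (X (inversion y)).2.1 = starRingEnd ℂ m * Y.2.1 := by rw [hXY]; rfl
  have h5 : (X (inversion y)).2.2 = starRingEnd ℂ m * Y.2.2 := by rw [hXY]; rfl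
  exact ⟨by rw [show (inversion y).z = _ from h4]; exact hmi.mul hYl.2.1,
    by rw [show u (inversion y) = _ from h5]; exact hmi.mul hYl.2.2⟩

/-- A word of digits is full if every point of the core of `K` has a preimage along it. -/
def IsFull (K : Set Heis) (w : List integers) : Prop := ∀ k ∈ core K, act (mat w)⁻¹ k ∈ orb K w

namespace IsSmallDomain

variable (D : IsSmallDomain K r)
include D

/-- There are points in every open set whose orbit stays in the interior of `K` and ends at the
origin. -/
theorem exists_orbInt_eq_one {U : Set Heis} (hU : IsOpen U) (hne : U.Nonempty) (hUK : U ⊆ K) :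
    ∃ v ∈ U, ∃ w, v ∈ orbInt K w ∧ act (mat w) v = 1 := by
  have hUi : U ⊆ interior K := interior_maximal hUK hU
  obtain ⟨q, p, hpU, hrat⟩ := exists_isRat_mem hU hne
  obtain ⟨σ₀, hσ₀, hσd, hσ1⟩ := D.exists_act_eq_one hrat
  obtain ⟨Λ, hfin, hmod, W, hW, hWv⟩ := D.exists_finite_descent hrat (subset_closure (hUK hpU))
  have hinv := den_inv hσ₀ hσd
  rw [hσ1] at hinv
  have hi0 : den σ₀⁻¹ 1 ≠ 0 := by rw [hinv.1]; exact inv_ne_zero hσd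
  have hW' : (act σ₀⁻¹) ⁻¹' (W ∩ U) ∩ {x | den σ₀⁻¹ x ≠ 0} ∈ nhds (1 : Heis) := by
    refine Filter.inter_mem ((continuousAt_act hi0).preimage_mem_nhds ?_)
      ((isOpen_ne_fun (continuous_den _) continuous_const).mem_nhds hi0)
    rw [hinv.2]
    exact Filter.inter_mem hW (hU.mem_nhds hpU)
  obtain ⟨ε, hε, hball⟩ := exists_gauge_ball_subset hW'
  -- The perturbation of `p` is `act σ₀⁻¹ (inversion g)`: for large `g`, `inversion g` is near the
  -- origin, and `σ₀⁻¹` sends the origin to `p`.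
  obtain ⟨g, hg, hgR, hav⟩ := exists_integer_avoiding D.dom.boundary
    (Ψ := (fun σ => σ * (σ₀⁻¹ * invl)) '' Λ) (hfin.image _) (by
      rintro _ ⟨σ, hσ, rfl⟩
      exact mul_mem (hmod hσ) (mul_mem (inv_mem hσ₀) invl_mem)) (1 / ε + 1)
  have hg0 : 0 < gauge g := by have : 0 < 1 / ε := by positivity
                               linarith
  have hg1 : g ≠ 1 := by rintro rfl; simp at hg0
  have hdg : den invl g ≠ 0 := by rwa [den_invl, Ne, u_eq_zero]
  obtain ⟨⟨hvW, hvU⟩, hvd⟩ := hball (inversion g) (by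
    rw [gauge_inversion, inv_lt_comm₀ hg0 hε, ← one_div]; linarith)
  have hvd : den σ₀⁻¹ (inversion g) ≠ 0 := hvd
  have hψ : σ₀⁻¹ * invl ∈ modular := mul_mem (inv_mem hσ₀) invl_mem
  have hψa : act (σ₀⁻¹ * invl) g = act σ₀⁻¹ (inversion g) := by
    rw [act_mul invl_mem hdg, act_invl hg1]
  have hψd : den (σ₀⁻¹ * invl) g ≠ 0 := by
    rw [den_mul invl_mem hdg, act_invl hg1]; exact mul_ne_zero hvd hdg
  set v := act σ₀⁻¹ (inversion g)
  have hvU : v ∈ U := hvU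
  obtain ⟨w, hw, hwd, hw1⟩ := hWv v hvW (hUi hvU) (by
    intro σ hσ hσv
    have h1 := hav _ (mem_image_of_mem _ hσ)
    rw [act_mul hψ hψd, hψa] at h1
    refine h1 ?_
    rw [den_mul hψ hψd, hψa]
    exact mul_ne_zero hσv hψd)
  by_cases hy1 : act (mat w) v = 1
  · exact ⟨v, hvU, w, hw, hy1⟩
  have hBm : mat w * σ₀⁻¹ ∈ modular := mul_mem (mat_mem w) (inv_mem hσ₀)
  -- `mat w` sends `p` to the origin, so this product fixes the origin. By `inversion_mem_integers`,
  -- the orbit of `v` reaches the inversion of an integer (or already the origin), and that integer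
  -- is the last digit.
  have hBX : (mat w * σ₀⁻¹) (X 1) = (den σ₀⁻¹ 1 * den (mat w) p) • X 1 := by
    rw [LinearEquiv.mul_apply, act_spec (inv_mem hσ₀) hi0, hinv.2, map_smul,
      act_spec (mat_mem w) hwd, hw1, smul_smul]
  have hBa : act (mat w * σ₀⁻¹) (inversion g) = act (mat w) v := act_mul (inv_mem hσ₀) hvd
  have hBd : den (mat w * σ₀⁻¹) (inversion g) ≠ 0 := by
    rw [den_mul (inv_mem hσ₀) hvd]
    exact mul_ne_zero (den_ne_zero_of_mem_orbInt hw) hvd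
  have hint := inversion_mem_integers hBm (mul_ne_zero hi0 hwd) hBX hg hg1 hBd (by rwa [hBa])
  rw [hBa] at hint
  have hend : act (step (inversion (act (mat w) v))) (act (mat w) v) = 1 := by
    rw [act_step _ hy1, inv_mul_cancel]
  have hyi : act (mat w) v ∈ interior K := act_mem_interior hw
  refine ⟨v, hvU, w ++ [⟨_, hint⟩], mem_orbInt_append hw ⟨hyi, hy1, ?_⟩, ?_⟩
  · rw [hend]; exact D.one_mem_interior
  · rw [mat_append, act_mul (mat_mem w) (den_ne_zero_of_mem_orbInt hw)]
    simp only [mat, one_mul]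
    exact hend

end IsSmallDomain
end

section

variable {K : Set Heis} {r : ℝ}

/-! ### The size of the branches -/

/-- The points of `orb K w` that are mapped to `B` along `w`. -/
def branch (K : Set Heis) (w : List integers) (B : Set Heis) : Set Heis :=
  orb K w ∩ act (mat w) ⁻¹' B

theorem measurableSet_branch (w : List integers) {B : Set Heis} (hB : MeasurableSet B) :
    MeasurableSet (branch K w B) := (measurableSet_orb w).inter (measurable_act _ hB)

theorem volume_branch (w : List integers) {B : Set Heis} (hB : MeasurableSet B) :
    volume (branch K w B) = ∫⁻ k, (act (mat w)⁻¹ ⁻¹' orb K w ∩ B).indicator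
      (fun k => ENNReal.ofReal (‖den (mat w) (act (mat w)⁻¹ k)‖ ^ 4)) k := by
  rw [← lintegral_indicator_one (measurableSet_branch w hB),
    ← lintegral_act (inv_mem (mat_mem w)) (measurable_one.indicator (measurableSet_branch w hB))]
  refine lintegral_congr_ae ?_
  filter_upwards [ae_generic] with k hk
  have hx : act (mat w)⁻¹ k ∈ generic := act_mem_generic (inv_mem (mat_mem w)) hk
  have hj : jac (mat w)⁻¹ k = ENNReal.ofReal (‖den (mat w) (act (mat w)⁻¹ k)‖ ^ 4) := by
    have h := (den_inv (mat_mem w) (den_ne_zero w hx)).1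
    rw [act_inv_mat w hk] at h
    rw [jac, h, norm_inv, inv_pow, inv_inv]
  by_cases h : act (mat w)⁻¹ k ∈ orb K w ∧ k ∈ B
  · rw [indicator_of_mem (s := act (mat w)⁻¹ ⁻¹' orb K w ∩ B) h, indicator_of_mem, Pi.one_apply, one_mul, hj]
    refine ⟨h.1, ?_⟩
    rw [mem_preimage, act_inv_mat w hk]
    exact h.2
  · rw [indicator_of_notMem (s := act (mat w)⁻¹ ⁻¹' orb K w ∩ B) h, indicator_of_notMem, zero_mul]
    rintro ⟨h1, h2⟩
    rw [mem_preimage, act_inv_mat w hk] at h2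
    exact h ⟨h1, h2⟩

/-- The Jacobian of the inverse branch is `‖den‖ ^ 4`; this and the next bound estimate it from
above and below. -/
theorem volume_branch_le {w : List integers} {B : Set Heis} (hB : MeasurableSet B) {δ : ℝ}
    (h : ∀ x ∈ branch K w B, ‖den (mat w) x‖ ≤ δ) :
    volume (branch K w B) ≤ ENNReal.ofReal (δ ^ 4) * volume B := by
  rw [volume_branch w hB, ← lintegral_indicator_const hB]
  refine lintegral_mono_ae ?_
  filter_upwards [ae_generic] with k hk
  by_cases hm : act (mat w)⁻¹ k ∈ orb K w ∧ k ∈ B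
  · rw [indicator_of_mem (s := act (mat w)⁻¹ ⁻¹' orb K w ∩ B) hm, indicator_of_mem hm.2]
    refine ENNReal.ofReal_le_ofReal (pow_le_pow_left₀ (norm_nonneg _) (h _ ⟨hm.1, ?_⟩) 4)
    rw [mem_preimage, act_inv_mat w hk]
    exact hm.2
  · rw [indicator_of_notMem (s := act (mat w)⁻¹ ⁻¹' orb K w ∩ B) hm]
    exact zero_le

theorem le_volume_branch {w : List integers} (hw : IsFull K w) {B : Set Heis} (hB : MeasurableSet B)
    (hBK : B ⊆ core K) {δ : ℝ} (hδ : 0 ≤ δ)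
    (h : ∀ k ∈ B, δ ≤ ‖den (mat w) (act (mat w)⁻¹ k)‖) :
    ENNReal.ofReal (δ ^ 4) * volume B ≤ volume (branch K w B) := by
  rw [volume_branch w hB, ← lintegral_indicator_const hB]
  refine lintegral_mono fun k => ?_
  by_cases hm : k ∈ B
  · rw [indicator_of_mem (s := act (mat w)⁻¹ ⁻¹' orb K w ∩ B) ⟨hw k (hBK hm), hm⟩, indicator_of_mem hm]
    exact ENNReal.ofReal_le_ofReal (pow_le_pow_left₀ hδ (h k hm) 4)
  · rw [indicator_of_notMem hm]
    exact zero_le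

theorem branch_core (w : List integers) : branch K w (core K) = orb K w :=
  inter_eq_left.mpr fun _ hx => act_mem_core hx

/-! ### Full words -/

theorem exists_integer_gauge_ge (R : ℝ) : ∃ g ∈ integers, R ≤ gauge g := by
  obtain ⟨n, hn⟩ := exists_nat_ge R
  refine ⟨mk ⟨((n : ℤ) : ℝ), ((0 : ℤ) : ℝ)⟩ ((0 : ℤ) : ℝ), ⟨n, 0, 0, rfl⟩, hn.trans ?_⟩
  refine le_trans ?_ (norm_z_le _)
  have := Complex.re_le_norm (mk ⟨((n : ℤ) : ℝ), ((0 : ℤ) : ℝ)⟩ ((0 : ℤ) : ℝ)).z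
  simpa using this

theorem IsFull.append {w v : List integers} (hv : IsFull K v)
    (h : ∀ k ∈ core K, act (mat w)⁻¹ (act (mat v)⁻¹ k) ∈ orb K w) :
    IsFull K (w ++ v) ∧ ∀ k ∈ core K,
      act (mat (w ++ v))⁻¹ k = act (mat w)⁻¹ (act (mat v)⁻¹ k) := by
  have key : ∀ k ∈ core K,
      act (mat (w ++ v))⁻¹ k = act (mat w)⁻¹ (act (mat v)⁻¹ k) := by
    intro k hk
    have hg : act (mat v)⁻¹ k ∈ generic := act_mem_generic (inv_mem (mat_mem v)) hk.2
    have hx : act (mat w)⁻¹ (act (mat v)⁻¹ k) ∈ generic := act_mem_generic (inv_mem (mat_mem w)) hg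
    have e : act (mat (w ++ v)) (act (mat w)⁻¹ (act (mat v)⁻¹ k)) = k := by
      rw [act_append w v hx, act_inv_mat w hg, act_inv_mat v hk.2]
    have := act_mat_inv (w ++ v) hx
    rwa [e] at this
  refine ⟨fun k hk => ?_, key⟩
  rw [key k hk, mem_orb_append]
  refine ⟨h k hk, ?_⟩
  rw [act_inv_mat w (act_mem_generic (inv_mem (mat_mem v)) hk.2)]
  exact hv k hk

namespace IsSmallDomain

variable (D : IsSmallDomain K r)
include D

theorem core_nonempty : (core K).Nonempty := nonempty_of_measure_ne_zero D.volume_core_pos.ne'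

/-- Every open set contains a full branch. -/
theorem exists_isFull {U : Set Heis} (hU : IsOpen U) (hne : U.Nonempty) (hUK : U ⊆ K) :
    ∃ w, IsFull K w ∧ ∀ k ∈ core K, act (mat w)⁻¹ k ∈ U := by
  obtain ⟨v, hvU, w, hw, hw1⟩ := D.exists_orbInt_eq_one hU hne hUK
  have hd := den_ne_zero_of_mem_orbInt hw
  have hinv := den_inv (mat_mem w) hd
  rw [hw1] at hinv
  have hi0 : den (mat w)⁻¹ 1 ≠ 0 := by rw [hinv.1]; exact inv_ne_zero hd
  have hN : (act (mat w)⁻¹) ⁻¹' (orbInt K w ∩ U) ∩ interior K ∈ nhds (1 : Heis) := by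
    refine Filter.inter_mem ((continuousAt_act hi0).preimage_mem_nhds ?_)
      (isOpen_interior.mem_nhds D.one_mem_interior)
    rw [hinv.2]
    exact ((isOpen_orbInt w).inter hU).mem_nhds ⟨hw, hvU⟩
  obtain ⟨ε, hε, hball⟩ := exists_gauge_ball_subset hN
  -- A digit this large is full: `inversion (h * k)` stays within `ε` of the origin for every `k` in
  -- the core. There the inverse branch along `w` is defined and lands in `U`.
  obtain ⟨h, hh, hR⟩ := exists_integer_gauge_ge (1 / ε + 2)
  have hε' : 0 < 1 / ε := by positivity
  have key : ∀ k ∈ core K, act (mat [⟨h, hh⟩])⁻¹ k = inversion (h * k) ∧ inversion (h * k) ≠ 1 ∧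
      act (step h) (inversion (h * k)) = k ∧ gauge (inversion (h * k)) < ε := by
    intro k hk
    have h1 : 1 / ε + 1 ≤ gauge (h * k) := by
      have h2 := gauge_mul_le (h * k) k⁻¹
      rw [mul_inv_cancel_right, gauge_inv] at h2
      linarith [D.gauge_le_one (core_subset hk)]
    have h3 : h * k ≠ 1 := by
      intro e; rw [e, gauge_one] at h1; linarith
    have h4 : inversion (h * k) ≠ 1 := fun e => h3 (inversion_eq_one.mp e)
    have h5 : act (step h) (inversion (h * k)) = k := by
      rw [act_step _ h4, inversion_inversion, inv_mul_cancel_left]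
    refine ⟨?_, h4, h5, ?_⟩
    · have h6 := (den_inv (step_mem hh) (den_step_ne_zero h h4)).2
      rw [h5] at h6
      simpa [mat] using h6
    · rw [gauge_inversion, inv_lt_comm₀ (by linarith) hε, ← one_div]; linarith
  have hfull : IsFull K [⟨h, hh⟩] := by
    intro k hk
    obtain ⟨h1, h2, h3, h4⟩ := key k hk
    refine ⟨⟨?_, act_mem_generic (inv_mem (mat_mem _)) hk.2⟩, ?_⟩
    · rw [h1]; exact (hball _ h4).2
    · rw [h1]
      show act (step h) _ ∈ core K
      rw [h3]; exact hk
  have hmem : ∀ k ∈ core K, act (mat w)⁻¹ (act (mat [⟨h, hh⟩])⁻¹ k) ∈ orbInt K w ∩ U := by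
    intro k hk
    obtain ⟨h1, h2, h3, h4⟩ := key k hk
    rw [h1]; exact (hball _ h4).1
  have happ := hfull.append (w := w) fun k hk => orbInt_inter_generic (hmem k hk).1
    (act_mem_generic (inv_mem (mat_mem w)) (act_mem_generic (inv_mem (mat_mem _)) hk.2))
  exact ⟨w ++ [⟨h, hh⟩], happ.1, fun k hk => by rw [happ.2 k hk]; exact (hmem k hk).2⟩

/-- Compactness of `closure K`: finitely many full words suffice to place a full branch in every
ball of radius `ε` about a point of the core. -/
theorem exists_finite_isFull {ε : ℝ} (hε : 0 < ε) : ∃ F : Finset (List integers), F.Nonempty ∧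
    (∀ v ∈ F, IsFull K v) ∧
      ∀ x ∈ core K, ∃ v ∈ F, ∀ k ∈ core K, kd x (act (mat v)⁻¹ k) < ε := by
  classical
  let B (c : Heis) : Set Heis := {y | kd c y < ε / 2}
  have hB : ∀ c, IsOpen (B c) := fun c => isOpen_lt (continuous_kd_right c) continuous_const
  obtain ⟨t, ht⟩ := D.isCompact_closure.elim_finite_subcover B hB fun x _ =>
    mem_iUnion.mpr ⟨x, by show kd x x < ε / 2; rw [kd_self]; positivity⟩
  have hch : ∀ c, (B c ∩ interior K).Nonempty → ∃ v, IsFull K v ∧ ∀ k ∈ core K,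
      act (mat v)⁻¹ k ∈ B c ∩ interior K := fun c hc =>
    D.exists_isFull ((hB c).inter isOpen_interior) hc (inter_subset_right.trans interior_subset)
  choose! v hv hvB using hch
  let F := (t.filter fun c => (B c ∩ interior K).Nonempty).image v
  have hF : ∀ x ∈ core K, ∃ w ∈ F, ∀ k ∈ core K, kd x (act (mat w)⁻¹ k) < ε := by
    intro x hx
    obtain ⟨c, hct, hxc⟩ := mem_iUnion₂.mp (ht (subset_closure (core_subset hx)))
    have hne : (B c ∩ interior K).Nonempty := ⟨x, hxc, hx.1⟩
    refine ⟨v c, Finset.mem_image_of_mem _ (Finset.mem_filter.mpr ⟨hct, hne⟩), fun k hk => ?_⟩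
    have h1 : kd c (act (mat (v c))⁻¹ k) < ε / 2 := (hvB c hne k hk).1
    have h2 : kd c x < ε / 2 := hxc
    have h3 := kd_triangle x c (act (mat (v c))⁻¹ k)
    rw [kd_comm x c] at h3
    linarith
  obtain ⟨x, hx⟩ := D.core_nonempty
  obtain ⟨w, hw, -⟩ := hF x hx
  refine ⟨F, ⟨w, hw⟩, fun u hu => ?_, hF⟩
  obtain ⟨c, hc, rfl⟩ := Finset.mem_image.mp hu
  exact hv c (Finset.mem_filter.mp hc).2

theorem exists_lower_bound_den (F : Finset (List integers)) : ∃ m : ℝ, 0 < m ∧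
    ∀ v ∈ F, ∀ y ∈ orb K v, m ≤ ‖den (mat v) y‖ := by
  have h1 : ∀ v : List integers, ∃ m : ℝ, 0 < m ∧ ∀ y ∈ orb K v, m ≤ ‖den (mat v) y‖ := by
    intro v
    rcases (orb K v).eq_empty_or_nonempty with h | ⟨y₀, hy₀⟩
    · exact ⟨1, one_pos, by simp [h]⟩
    · refine ⟨‖den (mat v) y₀‖ / distortion r, div_pos (norm_den_mat_pos hy₀) D.distortion_pos, fun y hy => ?_⟩
      rw [div_le_iff₀' D.distortion_pos]
      exact D.den_le_distortion hy₀ hy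
  choose m hm hmy using h1
  refine ⟨(∑ v ∈ F, (m v)⁻¹ + 1)⁻¹, ?_, fun v hv y hy => le_trans ?_ (hmy v y hy)⟩
  · have : 0 ≤ ∑ v ∈ F, (m v)⁻¹ := Finset.sum_nonneg fun v _ => (inv_pos.mpr (hm v)).le
    positivity
  · refine inv_le_of_inv_le₀ (hm v) ?_
    have := Finset.single_le_sum (f := fun v => (m v)⁻¹) (fun v _ => (inv_pos.mpr (hm v)).le) hv
    linarith

/-- There are many full words of a prescribed size. -/
theorem exists_many_full : ∃ a b c : ℝ, 0 < a ∧ 0 < b ∧ 0 < c ∧ ∀ n : ℕ, ∃ δ : ℝ, 0 < δ ∧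
    ∃ W : Finset (List integers), (∀ w ∈ W, n ≤ w.length ∧ IsFull K w ∧
      ∀ x ∈ orb K w, a * δ ≤ ‖den (mat w) x‖ ∧ ‖den (mat w) x‖ ≤ b * δ) ∧
      c ≤ W.card * δ ^ 4 := by
  classical
  obtain ⟨ρ, hρ, I, hI⟩ := D.exists_volume_fine_ge
  have hθ := D.sq_pos
  have hsep := D.sep_pos
  have hr1 : 0 < 1 / r - 1 := by linarith [one_lt_one_div D.pos D.lt_one]
  have hC := D.distortion_pos
  obtain ⟨F, hFne, hFfull, hF⟩ := D.exists_finite_isFull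
    (ε := min (ρ / 8) (min (sep r / 2) (1 / r - 1))) (by positivity)
  set ρ' := min (ρ / 8) (min (sep r / 2) (1 / r - 1)) with hρ'
  obtain ⟨m, hm, hmF⟩ := D.exists_lower_bound_den F
  have hFc : 0 < (F.card : ℝ) := by exact_mod_cast hFne.card_pos
  refine ⟨m / distortion r, distortion r / (r ^ 2) ^ I,
    ((r ^ 2) ^ I) ^ 4 / (4 * distortion r ^ 4 * F.card),
    by positivity, by positivity, by positivity, fun n => ?_⟩
  obtain ⟨J, hJ⟩ := hI n
  specialize hJ J le_rfl
  refine ⟨(r ^ 2) ^ J, by positivity, ?_⟩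
  set δ := (r ^ 2) ^ J with hδ
  have hδ0 : 0 < δ := by positivity
  -- The words supplied by `exists_volume_fine_ge`; by distortion their `den` is comparable to `δ`
  -- on all of `orb K w`.
  let G (w : List integers) : Prop := n ≤ w.length ∧ ∃ x ∈ orb K w, IsFine K ρ x w ∧
    δ < ‖den (mat w) x‖ ∧ ‖den (mat w) x‖ * (r ^ 2) ^ I ≤ δ
  have hGle : ∀ w, G w → ∀ z ∈ orb K w, δ / distortion r ≤ ‖den (mat w) z‖ ∧
      ‖den (mat w) z‖ ≤ distortion r / (r ^ 2) ^ I * δ := by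
    rintro w ⟨-, x, hx, -, h1, h2⟩ z hz
    constructor
    · rw [div_le_iff₀' hC]
      exact h1.le.trans (D.den_le_distortion hx hz)
    · refine (D.den_le_distortion hz hx).trans ?_
      rw [div_mul_eq_mul_div, le_div_iff₀ (by positivity), mul_assoc]
      gcongr
  set κ := (distortion r / (r ^ 2) ^ I * δ) ^ 4 with hκ
  have hκ0 : 0 < κ := by positivity
  let E (w : List integers) : Set Heis := {x | G w ∧ x ∈ orb K w}
  have hE : ∀ w, G w → volume (E w) ≤ ENNReal.ofReal κ * volume (core K) := by
    intro w hw
    have : E w = branch K w (core K) := by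
      rw [branch_core]; ext x; exact and_iff_right hw
    rw [this]
    refine volume_branch_le measurableSet_core fun x hx => ?_
    rw [branch_core] at hx
    exact (hGle w hw x hx).2
  have hE0 : ∀ w, ¬ G w → volume (E w) = 0 := by
    intro w hw
    have : E w = ∅ := eq_empty_of_forall_notMem fun x hx => hw hx.1
    rw [this, measure_empty]
  have hvt : volume (core K) ≠ ⊤ := ((measure_mono core_subset).trans_lt D.volume_lt_top).ne
  -- A quarter in place of a half makes the inequality strict, so that a finite subfamily suffices.
  have hsum : volume (core K) / 4 < ∑' w, volume (E w) := by
    refine lt_of_lt_of_le ?_ (hJ.trans ((measure_mono ?_).trans (measure_iUnion_le E)))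
    · refine ENNReal.div_lt_div_left D.volume_core_pos.ne' hvt ?_
      norm_num
    · rintro x ⟨w, h1, h2, h3⟩
      exact mem_iUnion.mpr ⟨w, ⟨h1, x, h2, h3⟩, h2⟩
  rw [ENNReal.tsum_eq_iSup_sum, lt_iSup_iff] at hsum
  obtain ⟨s, hs⟩ := hsum
  have hs' : volume (core K) / 4 < (s.filter G).card * ENNReal.ofReal κ * volume (core K) := by
    refine hs.trans_le ?_
    rw [← Finset.sum_filter_add_sum_filter_not s G,
      Finset.sum_eq_zero (s := s.filter fun w => ¬ G w) fun w hw => hE0 w (Finset.mem_filter.mp hw).2,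
      add_zero, mul_assoc, ← nsmul_eq_mul]
    exact Finset.sum_le_card_nsmul _ _ _ fun w hw => hE w (Finset.mem_filter.mp hw).2
  set t := s.filter G
  have hcard : 1 / 4 ≤ (t.card : ℝ) * κ := by
    by_contra! hlt
    refine hs'.not_ge ?_
    rw [← ENNReal.ofReal_natCast, ← ENNReal.ofReal_mul (by positivity), ENNReal.div_eq_inv_mul]
    refine mul_le_mul_left (ENNReal.ofReal_le_of_le_toReal ?_) _
    rw [ENNReal.toReal_inv]
    norm_num
    linarith
  -- The inverse branch along `w` is defined on generic points within `ρ'` of the endpoint of `x`,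
  -- and `F` contains a full word `v` whose branch lies in that ball. So `w ++ v` is full.
  have hch : ∀ w, G w → ∃ v ∈ F, IsFull K (w ++ v) := by
    rintro w ⟨-, x, hx, hf, -⟩
    obtain ⟨v, hvF, hv⟩ := hF _ (act_mem_core hx)
    refine ⟨v, hvF, ((hFfull v hvF).append fun k hk => ?_).1⟩
    exact (D.mem_orb_of_isFine (min_le_left _ _) ((min_le_right _ _).trans (min_le_left _ _))
      ((min_le_right _ _).trans (min_le_right _ _)) hρ hx hf
      (act_mem_generic (inv_mem (mat_mem v)) hk.2) (hv k hk)).1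
  choose! v hvF hvfull using hch
  refine ⟨t.image fun w => w ++ v w, ?_, ?_⟩
  · intro u hu
    obtain ⟨w, hw, rfl⟩ := Finset.mem_image.mp hu
    have hG : G w := (Finset.mem_filter.mp hw).2
    refine ⟨by rw [List.length_append]; exact hG.1.trans (Nat.le_add_right _ _), hvfull w hG,
      fun x hx => ?_⟩
    have hxw := (mem_orb_append _ _).mp hx
    have h1 := hGle w hG x hxw.1
    have h2 := hmF _ (hvF w hG) _ hxw.2
    constructor
    · rw [den_append _ _ (orb_subset_core _ hxw.1).2, norm_mul]
      calc m / distortion r * δ = m * (δ / distortion r) := by ring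
        _ ≤ _ := mul_le_mul h2 h1.1 (by positivity) (norm_nonneg _)
    · exact ((D.den_append_le hx).trans (mul_le_of_le_one_left (norm_nonneg _)
        (pow_le_one₀ hθ.le D.sq_lt_one.le))).trans h1.2
  · have hinj : t.card ≤ (t.image fun w => w ++ v w).card * F.card := by
      rw [← Finset.card_product]
      refine Finset.card_le_card_of_injOn (fun w => (w ++ v w, v w)) ?_ ?_
      · intro w hw
        exact Finset.mem_coe.mpr (Finset.mem_product.mpr ⟨Finset.mem_image_of_mem _ hw,
          hvF w (Finset.mem_filter.mp hw).2⟩)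
      · intro w _ w' _ e
        have e1 := congrArg Prod.fst e
        have e2 : v w = v w' := congrArg Prod.snd e
        simp only [e2] at e1
        exact List.append_cancel_right e1
    have hinj' : (t.card : ℝ) ≤ (t.image fun w => w ++ v w).card * F.card := by exact_mod_cast hinj
    rw [div_le_iff₀ (by positivity)]
    have h3 : 1 / 4 ≤ ((t.image fun w => w ++ v w).card * F.card : ℝ) * κ := by
      refine hcard.trans (by gcongr)
    have h4 : κ * ((r ^ 2) ^ I) ^ 4 = distortion r ^ 4 * δ ^ 4 := by
      rw [hκ]; field_simp
    have h5 : 0 < ((r ^ 2) ^ I) ^ 4 := by positivity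
    calc ((r ^ 2) ^ I) ^ 4 = 4 * (1 / 4) * ((r ^ 2) ^ I) ^ 4 := by ring
      _ ≤ 4 * (((t.image fun w => w ++ v w).card * F.card : ℝ) * κ) * ((r ^ 2) ^ I) ^ 4 := by gcongr
      _ = 4 * ((t.image fun w => w ++ v w).card * F.card : ℝ) * (κ * ((r ^ 2) ^ I) ^ 4) := by ring
      _ = _ := by rw [h4]; ring

end IsSmallDomain
end

section

variable {K : Set Heis} {r : ℝ}

/-! ### The invariant measure -/

/-- The pairs of points that have a preimage of order `n` under the Gauss map, extended to pairs of
points, within the pairs at a distance of at least `sep r`. -/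
def pastPairs (K : Set Heis) (r : ℝ) (n : ℕ) : Set (Heis × Heis) :=
  {p | (p.1 ∈ generic ∧ p.2 ∈ generic) ∧ ∃ w : List integers, w.length = n ∧
    act (mat w)⁻¹ p.1 ∈ orb K w ∧ sep r ≤ kd (act (mat w)⁻¹ p.1) (act (mat w)⁻¹ p.2)}

theorem measurableSet_pastPairs (n : ℕ) : MeasurableSet (pastPairs K r n) := by
  have e : {p : Heis × Heis | ∃ w : List integers, w.length = n ∧
      act (mat w)⁻¹ p.1 ∈ orb K w ∧ sep r ≤ kd (act (mat w)⁻¹ p.1) (act (mat w)⁻¹ p.2)} =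
      ⋃ w : List integers, {p | w.length = n ∧ act (mat w)⁻¹ p.1 ∈ orb K w ∧
        sep r ≤ kd (act (mat w)⁻¹ p.1) (act (mat w)⁻¹ p.2)} := by
    ext p; simp
  refine ((measurable_fst measurableSet_generic).inter (measurable_snd measurableSet_generic)).inter
    (e.symm ▸ MeasurableSet.iUnion fun w => (MeasurableSet.const _).inter
      (MeasurableSet.inter ?_ ?_) : MeasurableSet {p : Heis × Heis | ∃ w : List integers, w.length = n ∧
      act (mat w)⁻¹ p.1 ∈ orb K w ∧ sep r ≤ kd (act (mat w)⁻¹ p.1) (act (mat w)⁻¹ p.2)})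
  · exact ((measurable_act _).comp measurable_fst) (measurableSet_orb w)
  · exact measurableSet_le measurable_const (continuous_kd.measurable.comp (measurable_act_prod _))

/-- The preimage of a set under the Gauss map. -/
def gaussPreimage (K : Set Heis) (B : Set Heis) : Set Heis :=
  ⋃ g : integers, branch K [g] B

theorem measurableSet_gaussPreimage {B : Set Heis} (hB : MeasurableSet B) :
    MeasurableSet (gaussPreimage K B) := MeasurableSet.iUnion fun _ => measurableSet_branch _ hB

/-- The density measure on `K` of the pairs with an infinite past. -/
def gaussMeasure (K : Set Heis) (r : ℝ) : Measure Heis :=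
  (pairMeasure.restrict (⋂ n, pastPairs K r n)).map Prod.fst

theorem gaussMeasure_apply {B : Set Heis} (hB : MeasurableSet B) :
    gaussMeasure K r B = pairMeasure (⋂ n, pastPairs K r n ∩ Prod.fst ⁻¹' B) := by
  rw [gaussMeasure, Measure.map_apply measurable_fst hB, Measure.restrict_apply (measurable_fst hB),
    inter_comm, iInter_inter]

theorem gaussMeasure_absolutelyContinuous : gaussMeasure K r ≪ volume := by
  refine (Measure.AbsolutelyContinuous.map ?_ measurable_fst).trans
    (Measure.quasiMeasurePreserving_fst (μ := (volume : Measure Heis)) (ν := (volume : Measure Heis))).absolutelyContinuous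
  exact Measure.restrict_le_self.absolutelyContinuous.trans (withDensity_absolutelyContinuous _ _)

theorem act_inv_tail {g : integers} {w : List integers} {k : Heis} (hk : k ∈ generic) :
    act (step g) (act (mat (g :: w))⁻¹ k) = act (mat w)⁻¹ k := by
  have hx : act (mat (g :: w))⁻¹ k ∈ generic := act_mem_generic (inv_mem (mat_mem _)) hk
  have h1 := act_inv_mat (g :: w) hk
  rw [act_cons g w hx] at h1
  rw [← act_mat_inv w (act_mem_generic (step_mem g.2) hx), h1]

theorem gaussMeasure_compl_core : gaussMeasure K r (core K)ᶜ = 0 := by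
  rw [gaussMeasure_apply measurableSet_core.compl]
  have : ⋂ n, pastPairs K r n ∩ Prod.fst ⁻¹' (core K)ᶜ = ∅ := by
    refine eq_empty_of_forall_notMem fun p hp => ?_
    obtain ⟨⟨-, w, hw, h1, -⟩, h2⟩ := mem_iInter.mp hp 0
    obtain rfl := List.length_eq_zero_iff.mp hw
    simp only [mat, inv_one, act_one] at h1
    exact h2 h1
  rw [this, measure_empty]

namespace IsSmallDomain

variable (D : IsSmallDomain K r)
include D

/-- A longer past yields a shorter one by dropping its first digit; the separation survives the step
by `sep_le_kd_act`. -/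
theorem antitone_pastPairs : Antitone (pastPairs K r) := by
  refine antitone_nat_of_succ_le fun n => ?_
  rintro p ⟨hp, w, hw, h1, h2⟩
  obtain ⟨g, w, rfl⟩ := List.exists_cons_of_length_eq_add_one hw
  refine ⟨hp, w, by simpa using hw, ?_, ?_⟩
  · rw [← act_inv_tail hp.1 (g := g)]; exact h1.2
  · have h3 := D.sep_le_kd_act (w := [g]) (x := act (mat (g :: w))⁻¹ p.1)
      (y := act (mat (g :: w))⁻¹ p.2) ⟨h1.1, orb_subset_core w h1.2⟩
      (act_mem_generic (inv_mem (mat_mem _)) hp.2) h2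
    simp only [mat, one_mul] at h3
    rwa [show mat w * step g = mat (g :: w) from rfl, act_inv_tail hp.1, act_inv_tail hp.2] at h3

theorem pairMeasure_pastPairs_zero_lt_top : pairMeasure (pastPairs K r 0) < ⊤ := by
  have hC := D.sep_pos
  have hsub : pastPairs K r 0 ⊆ {p | p.1 ∈ core K ∧ sep r ≤ kd p.1 p.2} := by
    rintro p ⟨-, w, hw, h1, h2⟩
    obtain rfl := List.length_eq_zero_iff.mp hw
    simp only [mat, inv_one, act_one] at h1 h2
    exact ⟨h1, h2⟩
  refine (measure_mono hsub).trans_lt ?_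
  have hm : MeasurableSet {p : Heis × Heis | p.1 ∈ core K ∧ sep r ≤ kd p.1 p.2} :=
    (measurable_fst measurableSet_core).inter
      (isClosed_le continuous_const continuous_kd).measurableSet
  rw [pairMeasure_apply hm]
  generalize hT : {p : Heis × Heis | p.1 ∈ core K ∧ sep r ≤ kd p.1 p.2} = T
  refine lt_of_le_of_lt (b := ∫⁻ x, (core K).indicator (fun _ => ENNReal.ofReal (8 * (1 / sep r) ^ 4)) x) ?_ ?_
  · refine lintegral_mono fun x => ?_
    by_cases hx : x ∈ core K
    · rw [indicator_of_mem hx]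
      refine le_trans (lintegral_mono fun y => ?_) (lintegral_pairDensity_le x hC)
      by_cases hy : y ∈ {y | sep r ≤ kd x y}
      · rw [indicator_of_mem hy, indicator_of_mem (show (x, y) ∈ T from hT ▸ ⟨hx, hy⟩)]
      · rw [indicator_of_notMem (show (x, y) ∉ T from fun h => hy (hT ▸ h :).2)]
        exact zero_le
    · rw [indicator_of_notMem hx]
      have : ∀ y, T.indicator pairDensity (x, y) = 0 :=
        fun y => indicator_of_notMem (fun h => hx (hT ▸ h :).1) _
      simp only [this, lintegral_zero, le_refl]
  · rw [lintegral_indicator_const measurableSet_core]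
    exact ENNReal.mul_lt_top ENNReal.ofReal_lt_top
      ((measure_mono core_subset).trans_lt D.volume_lt_top)

theorem tendsto_gaussMeasure {B : Set Heis} (hB : MeasurableSet B) :
    Filter.Tendsto (fun n => pairMeasure (pastPairs K r n ∩ Prod.fst ⁻¹' B)) Filter.atTop
      (nhds (gaussMeasure K r B)) := by
  rw [gaussMeasure_apply hB]
  refine tendsto_measure_iInter_atTop
    (fun n => ((measurableSet_pastPairs n).inter (measurable_fst hB)).nullMeasurableSet)
    (fun n m h => inter_subset_inter_left _ (D.antitone_pastPairs h)) ⟨0, ?_⟩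
  exact ((measure_mono inter_subset_left).trans_lt D.pairMeasure_pastPairs_zero_lt_top).ne

theorem isFiniteMeasure_gaussMeasure : IsFiniteMeasure (gaussMeasure K r) := by
  refine ⟨?_⟩
  rw [gaussMeasure_apply MeasurableSet.univ]
  exact (measure_mono ((iInter_subset (fun n => pastPairs K r n ∩ Prod.fst ⁻¹' univ) 0).trans
    inter_subset_left)).trans_lt
    D.pairMeasure_pastPairs_zero_lt_top

theorem disjoint_branch {g h : integers} (hgh : g ≠ h) (B B' : Set Heis) :
    Disjoint (branch K [g] B) (branch K [h] B') := by
  rw [Set.disjoint_left]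
  rintro x hx hx'
  have := D.orb_unique (w := [g]) (v := [h]) rfl hx.1 hx'.1
  simp only [List.cons.injEq, and_true] at this
  exact hgh this

/-- The pairs are sorted by the last digit of their past, and its inverse branch preserves the pair
measure and lands over disjoint branches. Only an inequality results, as a pair may have several
pasts. -/
theorem pairMeasure_pastPairs_succ_le (n : ℕ) {B : Set Heis} (hB : MeasurableSet B) :
    pairMeasure (pastPairs K r (n + 1) ∩ Prod.fst ⁻¹' B) ≤
      pairMeasure (pastPairs K r n ∩ Prod.fst ⁻¹' gaussPreimage K B) := by
  let S (g : integers) : Set (Heis × Heis) := pastPairs K r n ∩ Prod.fst ⁻¹' branch K [g] B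
  have hS : ∀ g, MeasurableSet (S g) := fun g =>
    (measurableSet_pastPairs n).inter (measurable_fst (measurableSet_branch _ hB))
  have hsub : pastPairs K r (n + 1) ∩ Prod.fst ⁻¹' B ⊆ ⋃ g : integers,
      {p | (act (mat [g])⁻¹ p.1, act (mat [g])⁻¹ p.2) ∈ S g} := by
    rintro p ⟨⟨hp, w', hw', h1, h2⟩, hpB⟩
    have hne : w' ≠ [] := by rintro rfl; simp at hw'
    obtain ⟨w, g, rfl⟩ : ∃ w g, w' = w ++ [g] := ⟨_, _, (List.dropLast_append_getLast hne).symm⟩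
    have key : ∀ k ∈ generic, act (mat w) (act (mat (w ++ [g]))⁻¹ k) = act (mat [g])⁻¹ k := by
      intro k hk
      have hx : act (mat (w ++ [g]))⁻¹ k ∈ generic := act_mem_generic (inv_mem (mat_mem _)) hk
      have h3 := act_inv_mat (w ++ [g]) hk
      rw [act_append w [g] hx] at h3
      rw [← act_mat_inv [g] (act_mat_mem_generic w hx), h3]
    have key2 : ∀ k ∈ generic, act (mat w)⁻¹ (act (mat [g])⁻¹ k) = act (mat (w ++ [g]))⁻¹ k := by
      intro k hk
      rw [← key k hk, act_mat_inv w (act_mem_generic (inv_mem (mat_mem _)) hk)]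
    have h4 := (mem_orb_append w [g]).mp h1
    rw [key _ hp.1] at h4
    refine mem_iUnion.mpr ⟨g, ⟨⟨act_mem_generic (inv_mem (mat_mem _)) hp.1,
      act_mem_generic (inv_mem (mat_mem _)) hp.2⟩, w, by simpa using hw', ?_, ?_⟩, h4.2, ?_⟩
    · simp only [key2 _ hp.1]; exact h4.1
    · simp only [key2 _ hp.1, key2 _ hp.2]; exact h2
    · rw [mem_preimage]
      simp only [act_inv_mat [g] hp.1]
      exact hpB
  refine (measure_mono hsub).trans ((measure_iUnion_le _).trans ?_)
  calc _ = ∑' g, pairMeasure (S g) :=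
        tsum_congr fun g => pairMeasure_preimage_act (inv_mem (mat_mem _)) (hS g)
    _ = pairMeasure (⋃ g, S g) := by
        refine (measure_iUnion (fun g h hgh => ?_) hS).symm
        exact ((D.disjoint_branch hgh B B).preimage Prod.fst).mono inter_subset_right inter_subset_right
    _ ≤ pairMeasure (pastPairs K r n ∩ Prod.fst ⁻¹' gaussPreimage K B) := by
        rw [gaussPreimage, preimage_iUnion, inter_iUnion]

/-- `gaussMeasure K r` is invariant under the Gauss map. -/
theorem gaussMeasure_gaussPreimage {B : Set Heis} (hB : MeasurableSet B) :
    gaussMeasure K r (gaussPreimage K B) = gaussMeasure K r B := by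
  have hfin := D.isFiniteMeasure_gaussMeasure
  have hle : ∀ {B : Set Heis}, MeasurableSet B →
      gaussMeasure K r B ≤ gaussMeasure K r (gaussPreimage K B) := by
    intro B hB
    refine le_of_tendsto_of_tendsto ((D.tendsto_gaussMeasure hB).comp (Filter.tendsto_add_atTop_nat 1))
      (D.tendsto_gaussMeasure (measurableSet_gaussPreimage hB))
      (Filter.Eventually.of_forall fun n => D.pairMeasure_pastPairs_succ_le n hB)
  refine le_antisymm ?_ (hle hB)
  have hdisj : Disjoint (gaussPreimage K B) (gaussPreimage K Bᶜ) := by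
    rw [gaussPreimage, gaussPreimage, disjoint_iUnion_left]
    intro g
    rw [disjoint_iUnion_right]
    intro h
    by_cases e : g = h
    · subst e
      exact (disjoint_compl_right.preimage (act (mat [g]))).mono inter_subset_right inter_subset_right
    · exact D.disjoint_branch e _ _
  -- The inequality for `B` and that for its complement add up to at most the total mass, which is
  -- finite, so neither can be strict.
  have h1 : gaussMeasure K r (gaussPreimage K B) + gaussMeasure K r Bᶜ ≤
      gaussMeasure K r B + gaussMeasure K r Bᶜ := by
    calc _ ≤ gaussMeasure K r (gaussPreimage K B) + gaussMeasure K r (gaussPreimage K Bᶜ) :=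
          add_le_add_right (hle hB.compl) _
      _ = gaussMeasure K r (gaussPreimage K B ∪ gaussPreimage K Bᶜ) :=
          (measure_union hdisj (measurableSet_gaussPreimage hB.compl)).symm
      _ ≤ gaussMeasure K r univ := measure_mono (subset_univ _)
      _ = _ := (measure_add_measure_compl hB).symm
  exact (ENNReal.add_le_add_iff_right (measure_ne_top _ _)).mp h1

/-- The density of `gaussMeasure K r` is bounded below on the core of `K`. -/
theorem exists_le_gaussMeasure : ∃ c : ℝ≥0∞, c ≠ 0 ∧ ∀ B : Set Heis, MeasurableSet B → B ⊆ core K →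
    c * volume B ≤ gaussMeasure K r B := by
  classical
  obtain ⟨a, b, c, ha, hb, hc, hW⟩ := D.exists_many_full
  obtain ⟨N, hN⟩ := D.exists_encard_words_le (C := max 1 (b / a)) (le_max_left _ _)
  let c₀ : ℝ≥0∞ := ENNReal.ofReal (a ^ 4 * c) * volume shell / (ENNReal.ofReal (4 ^ 8) * (N + 1))
  have hden0 : ENNReal.ofReal (4 ^ 8) * ((N : ℝ≥0∞) + 1) ≠ 0 :=
    mul_ne_zero (by norm_num) (by simp)
  have hdent : ENNReal.ofReal (4 ^ 8) * ((N : ℝ≥0∞) + 1) ≠ ⊤ :=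
    ENNReal.mul_ne_top ENNReal.ofReal_ne_top (by simp)
  refine ⟨c₀, ?_, fun B hB hBK => ?_⟩
  · refine (ENNReal.div_pos (mul_ne_zero ?_ volume_shell_pos.ne') hdent).ne'
    rw [Ne, ENNReal.ofReal_eq_zero, not_le]; positivity
  refine ge_of_tendsto' (D.tendsto_gaussMeasure hB) fun n => ?_
  obtain ⟨δ, hδ, W, hWf, hcard⟩ := hW n
  -- Images of `branch K w B ×ˢ shell` under full words. They lie over `B`, have a past of order
  -- `n`, overlap at most `N` times, and each has measure at least a constant times `δ ^ 4 * volume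
  -- B`.
  let S (w : List integers) : Set (Heis × Heis) :=
    {p | w ∈ W ∧ (act (mat w)⁻¹ p.1, act (mat w)⁻¹ p.2) ∈ branch K w B ×ˢ shell}
  have hS : ∀ w, MeasurableSet (S w) := fun w => (MeasurableSet.const _).inter
    (measurable_act_prod _ ((measurableSet_branch w hB).prod measurableSet_shell))
  have hSle : ∀ w ∈ W, ENNReal.ofReal ((a * δ) ^ 4) * volume B * volume shell ≤
      ENNReal.ofReal (4 ^ 8) * pairMeasure (S w) := by
    intro w hw
    have e : pairMeasure (S w) = pairMeasure (branch K w B ×ˢ shell) := by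
      rw [← pairMeasure_preimage_act (inv_mem (mat_mem w))
        ((measurableSet_branch w hB).prod measurableSet_shell)]
      congr 1; ext p; exact and_iff_right hw
    rw [e]
    refine le_trans ?_ (volume_mul_shell_le (measurableSet_branch w hB) fun x hx =>
      D.gauge_le_one (core_subset (orb_subset_core w hx.1)))
    gcongr
    exact le_volume_branch (hWf w hw).2.1 hB hBK (by positivity) fun k hk =>
      ((hWf w hw).2.2 _ ((hWf w hw).2.1 k (hBK hk))).1
  have key : ∑' w, pairMeasure (S w) ≤ N * pairMeasure (pastPairs K r n ∩ Prod.fst ⁻¹' B) := by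
    refine tsum_measure_le_of_encard_le hS
      ((measurableSet_pastPairs n).inter (measurable_fst hB)) N ?_
    filter_upwards [ae_pairMeasure_generic] with p hp
    constructor
    · refine (encard_le_encard fun w hw => ?_).trans
        (hN (a * δ) (by positivity) p.1 hp.1 p.2 hp.2)
      obtain ⟨hwW, h1, h2⟩ := hw
      have h3 := (hWf w hwW).2.2 _ h1.1
      refine ⟨h1.1, h2, h3.1, h3.2.trans ?_⟩
      calc b * δ = b / a * (a * δ) := by field_simp
        _ ≤ _ := by gcongr; exact le_max_right _ _
    · rintro w ⟨hwW, h1, h2⟩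
      have h3 := h1.2
      rw [mem_preimage] at h3
      simp only [act_inv_mat w hp.1] at h3
      refine ⟨D.antitone_pastPairs (hWf w hwW).1 ⟨hp, w, rfl, h1.1, ?_⟩, h3⟩
      exact D.sep_le_kd (core_subset (orb_subset_core w h1.1)) h2.1
  have h1 : (W.card : ℝ≥0∞) * (ENNReal.ofReal ((a * δ) ^ 4) * volume B * volume shell) ≤
      ENNReal.ofReal (4 ^ 8) * (N * pairMeasure (pastPairs K r n ∩ Prod.fst ⁻¹' B)) := by
    calc _ = ∑ w ∈ W, ENNReal.ofReal ((a * δ) ^ 4) * volume B * volume shell := by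
          rw [Finset.sum_const, nsmul_eq_mul]
      _ ≤ ∑ w ∈ W, ENNReal.ofReal (4 ^ 8) * pairMeasure (S w) := Finset.sum_le_sum hSle
      _ = ENNReal.ofReal (4 ^ 8) * ∑ w ∈ W, pairMeasure (S w) := (Finset.mul_sum _ _ _).symm
      _ ≤ _ := by gcongr; exact (ENNReal.sum_le_tsum W).trans key
  have h2 : ENNReal.ofReal (a ^ 4 * c) ≤ W.card * ENNReal.ofReal ((a * δ) ^ 4) := by
    rw [← ENNReal.ofReal_natCast, ← ENNReal.ofReal_mul (by positivity)]
    refine ENNReal.ofReal_le_ofReal ?_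
    calc a ^ 4 * c ≤ a ^ 4 * (W.card * δ ^ 4) := by gcongr
      _ = _ := by ring
  rw [show c₀ * volume B = ENNReal.ofReal (a ^ 4 * c) * volume shell * volume B /
    (ENNReal.ofReal (4 ^ 8) * (N + 1)) from by simp only [c₀, div_eq_mul_inv]; ring]
  refine ENNReal.div_le_of_le_mul' ?_
  calc _ ≤ W.card * ENNReal.ofReal ((a * δ) ^ 4) * volume shell * volume B := by gcongr
    _ = (W.card : ℝ≥0∞) * (ENNReal.ofReal ((a * δ) ^ 4) * volume B * volume shell) := by ring
    _ ≤ _ := h1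
    _ = ENNReal.ofReal (4 ^ 8) * N * pairMeasure (pastPairs K r n ∩ Prod.fst ⁻¹' B) := by ring
    _ ≤ _ := by gcongr; exact le_self_add

end IsSmallDomain
end

section

variable {K : Set Heis} {r : ℝ}

/-! ### Ergodicity -/

/-- The points that lie in arbitrarily deep full branches. -/
def recurrent (K : Set Heis) : Set Heis :=
  ⋂ n : ℕ, ⋃ w ∈ {w : List integers | n ≤ w.length ∧ IsFull K w}, orb K w

theorem measurableSet_iUnion_orb (s : Set (List integers)) : MeasurableSet (⋃ w ∈ s, orb K w) :=
  MeasurableSet.biUnion (to_countable _) fun w _ => measurableSet_orb w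

theorem measurableSet_recurrent : MeasurableSet (recurrent K) :=
  MeasurableSet.iInter fun _ => measurableSet_iUnion_orb _

theorem recurrent_subset_core : recurrent K ⊆ core K := fun x hx => by
  obtain ⟨w, -, hw⟩ := mem_iUnion₂.mp (mem_iInter.mp hx 0)
  exact orb_subset_core w hw

namespace IsSmallDomain

variable (D : IsSmallDomain K r)
include D

/-- The many full branches at one scale overlap boundedly, so their union has volume bounded below
independently of the depth; the bound passes to the decreasing intersection. -/
theorem volume_recurrent_pos : 0 < volume (recurrent K) := by
  classical
  obtain ⟨a, b, c, ha, hb, hc, hW⟩ := D.exists_many_full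
  obtain ⟨N, hN⟩ := D.exists_encard_prefixes_le (C := b / a) (by positivity)
  have hle : ∀ n : ℕ, ENNReal.ofReal (a ^ 4 * c) * volume (core K) / ((N : ℝ≥0∞) + 1) ≤
      volume (⋃ w ∈ {w : List integers | n ≤ w.length ∧ IsFull K w}, orb K w) := by
    intro n
    obtain ⟨δ, hδ, W, hWf, hcard⟩ := hW n
    let S (w : List integers) : Set Heis := {x | w ∈ W ∧ x ∈ orb K w}
    have hS : ∀ w, MeasurableSet (S w) := fun w => (MeasurableSet.const _).inter (measurableSet_orb w)
    have hSle : ∀ w ∈ W, ENNReal.ofReal ((a * δ) ^ 4) * volume (core K) ≤ volume (S w) := by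
      intro w hw
      have e : S w = orb K w := by ext x; exact and_iff_right hw
      rw [e, ← branch_core]
      exact le_volume_branch (hWf w hw).2.1 measurableSet_core subset_rfl (by positivity)
        fun k hk => ((hWf w hw).2.2 _ ((hWf w hw).2.1 k hk)).1
    have key := tsum_measure_le_of_encard_le (μ := volume) hS
      (measurableSet_iUnion_orb (K := K) {w : List integers | n ≤ w.length ∧ IsFull K w}) N
      (Filter.Eventually.of_forall fun x => ⟨(encard_le_encard fun w hw => ?_).trans
        (hN (a * δ) (by positivity) x), fun w hw =>
        mem_iUnion₂.mpr ⟨w, ⟨(hWf w hw.1).1, (hWf w hw.1).2.1⟩, hw.2⟩⟩)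
    swap
    · have h3 := (hWf w hw.1).2.2 _ hw.2
      refine ⟨hw.2, h3.1, h3.2.trans_eq ?_⟩
      field_simp
    have h2 : ENNReal.ofReal (a ^ 4 * c) ≤ W.card * ENNReal.ofReal ((a * δ) ^ 4) := by
      rw [← ENNReal.ofReal_natCast, ← ENNReal.ofReal_mul (by positivity)]
      refine ENNReal.ofReal_le_ofReal ?_
      calc a ^ 4 * c ≤ a ^ 4 * (W.card * δ ^ 4) := by gcongr
        _ = _ := by ring
    refine ENNReal.div_le_of_le_mul' ?_
    calc _ ≤ W.card * ENNReal.ofReal ((a * δ) ^ 4) * volume (core K) := by gcongr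
      _ = ∑ w ∈ W, ENNReal.ofReal ((a * δ) ^ 4) * volume (core K) := by
          rw [Finset.sum_const, nsmul_eq_mul, mul_assoc]
      _ ≤ ∑ w ∈ W, volume (S w) := Finset.sum_le_sum hSle
      _ ≤ ∑' w, volume (S w) := ENNReal.sum_le_tsum W
      _ ≤ _ := key
      _ ≤ _ := by gcongr; exact le_self_add
  have hpos : 0 < ENNReal.ofReal (a ^ 4 * c) * volume (core K) / ((N : ℝ≥0∞) + 1) :=
    ENNReal.div_pos (mul_ne_zero (by rw [Ne, ENNReal.ofReal_eq_zero, not_le]; positivity)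
      D.volume_core_pos.ne') (by simp)
  refine hpos.trans_le (ge_of_tendsto' (tendsto_measure_iInter_atTop
    (fun n => (measurableSet_iUnion_orb _).nullMeasurableSet) (fun n m h => ?_) ⟨0, ?_⟩) hle)
  · exact biUnion_subset_biUnion_left fun w hw => ⟨h.trans hw.1, hw.2⟩
  · refine ((measure_mono (iUnion₂_subset fun w _ => ?_)).trans_lt D.volume_lt_top).ne
    exact (orb_subset_core w).trans core_subset

theorem kd_le_of_mem_orb {w : List integers} {x y : Heis} (hx : x ∈ orb K w) (hy : y ∈ orb K w) :
    kd x y ≤ 2 * (r ^ 2) ^ w.length := by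
  have h1 := kd_act (mat_mem w) (den_ne_zero w (orb_subset_core w hx).2)
    (den_ne_zero w (orb_subset_core w hy).2)
  have h2 : kd (act (mat w) x) (act (mat w) y) ≤ 2 := (kd_le_add _ _).trans (by
    linarith [D.gauge_le_one (core_subset (act_mem_core hx)),
      D.gauge_le_one (core_subset (act_mem_core hy))])
  have hr := D.pos
  refine le_of_sq_le_sq ?_ (by positivity)
  rw [← h1, mul_pow, sq ((r ^ 2) ^ w.length)]
  have h3 := D.den_le hx
  have h4 := D.den_le hy
  gcongr
  exact kd_nonneg _ _

/-- Bounded distortion: the preimages of `B` fill at least a fixed multiple of `volume B` of every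
full branch, in proportion. -/
theorem volume_orb_mul_le {w : List integers} (hw : IsFull K w) {B : Set Heis} (hB : MeasurableSet B)
    (hBK : B ⊆ core K) : volume (orb K w) * volume B ≤
      ENNReal.ofReal (distortion r ^ 8) * volume (core K) * volume (branch K w B) := by
  rcases (orb K w).eq_empty_or_nonempty with h0 | ⟨x, hx⟩
  · rw [h0, measure_empty, zero_mul]; exact zero_le
  have hd := norm_den_mat_pos hx
  have hq := D.distortion_pos
  have h1 : volume (orb K w) ≤
      ENNReal.ofReal ((distortion r * ‖den (mat w) x‖) ^ 4) * volume (core K) := by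
    rw [← branch_core]
    exact volume_branch_le measurableSet_core fun y hy => D.den_le_distortion hy.1 hx
  have h2 : ENNReal.ofReal ((‖den (mat w) x‖ / distortion r) ^ 4) * volume B ≤
      volume (branch K w B) :=
    le_volume_branch hw hB hBK (by positivity) fun k hk => by
      rw [div_le_iff₀' hq]
      exact D.den_le_distortion hx (hw k (hBK hk))
  have h3 : ENNReal.ofReal ((distortion r * ‖den (mat w) x‖) ^ 4) =
      ENNReal.ofReal (distortion r ^ 8) * ENNReal.ofReal ((‖den (mat w) x‖ / distortion r) ^ 4) := by
    rw [← ENNReal.ofReal_mul (by positivity)]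
    congr 1
    field_simp
  calc _ ≤ ENNReal.ofReal ((distortion r * ‖den (mat w) x‖) ^ 4) * volume (core K) * volume B := by
        gcongr
    _ = ENNReal.ofReal (distortion r ^ 8) * volume (core K) *
        (ENNReal.ofReal ((‖den (mat w) x‖ / distortion r) ^ 4) * volume B) := by rw [h3]; ring
    _ ≤ _ := by gcongr

/-- Recurrent points of an open set are covered by disjoint full branches in the open set. -/
theorem exists_disjoint_full_cover {U : Set Heis} (hU : IsOpen U) : ∃ M : Set (List integers),
    (∀ w ∈ M, IsFull K w ∧ orb K w ⊆ U) ∧ M.PairwiseDisjoint (orb K) ∧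
      recurrent K ∩ U ⊆ ⋃ w ∈ M, orb K w := by
  classical
  let P (w : List integers) : Prop := IsFull K w ∧ orb K w ⊆ U
  -- Full words that lie in `U` and have no proper prefix with these properties: overlapping
  -- branches are nested, so minimality makes them disjoint.
  refine ⟨{w | P w ∧ ∀ m < w.length, ¬ P (w.take m)}, fun w hw => hw.1, ?_, ?_⟩
  · have key : ∀ w v : List integers, (P w ∧ ∀ m < w.length, ¬ P (w.take m)) →
        (P v ∧ ∀ m < v.length, ¬ P (v.take m)) → w.length ≤ v.length →
        ∀ x, x ∈ orb K w → x ∈ orb K v → w = v := by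
      intro w v hw hv hl x hxw hxv
      obtain ⟨v', rfl⟩ := D.orb_prefix hl hxw hxv
      rcases v' with _ | ⟨g, v'⟩
      · simp
      · exact absurd hw.1 (by simpa using hv.2 w.length (by simp))
    intro w hw v hv hwv
    rw [Function.onFun, Set.disjoint_left]
    intro x hxw hxv
    rcases le_total w.length v.length with hl | hl
    · exact hwv (key w v hw hv hl x hxw hxv)
    · exact hwv (key v w hv hw hl x hxv hxw).symm
  · rintro x ⟨hx, hxU⟩
    obtain ⟨ε, hε, hball⟩ := exists_kd_ball_subset (hU.mem_nhds hxU)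
    obtain ⟨n, hn⟩ := exists_pow_lt_of_lt_one (half_pos hε) D.sq_lt_one
    obtain ⟨w, ⟨hnw, hwf⟩, hxw⟩ := mem_iUnion₂.mp (mem_iInter.mp hx n)
    have hPw : P w := ⟨hwf, fun y hy => hball y <| by
      have h1 := D.kd_le_of_mem_orb hxw hy
      have h2 := pow_le_pow_of_le_one D.sq_pos.le D.sq_lt_one.le hnw
      linarith⟩
    have hex : ∃ m, P (w.take m) := ⟨w.length, by rwa [List.take_length]⟩
    refine mem_iUnion₂.mpr ⟨w.take (Nat.find hex), ⟨Nat.find_spec hex, fun m hm => ?_⟩, ?_⟩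
    · have hm' : m < Nat.find hex := hm.trans_le (List.length_take_le _ _)
      rw [List.take_take, min_eq_left hm'.le]
      exact Nat.find_min hex hm'
    · exact ((mem_orb_append (w.take (Nat.find hex)) (w.drop (Nat.find hex))).mp
        (by rwa [List.take_append_drop])).1

/-- A density argument without a density theorem. An open set slightly larger than the remaining
part of the recurrent set is filled by disjoint full branches. In each, the preimages of `B ⊆ E`
have a definite proportion and lie in `E` by invariance. They therefore lie in the excess, whose
volume is at most `ε`. -/
theorem volume_recurrent_diff_eq_zero {E : Set Heis} (hE : NullMeasurableSet E)
    (hinv : ∀ w x, x ∈ orb K w → act (mat w) x ∈ E → x ∈ E) (hpos : volume (E ∩ core K) ≠ 0) :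
    volume (recurrent K \ E) = 0 := by
  obtain ⟨B, hBE, hB, hBae⟩ :=
    (hE.inter measurableSet_core.nullMeasurableSet).exists_measurable_subset_ae_eq
  have hB0 : volume B ≠ 0 := by rwa [measure_congr hBae]
  have hFfin : volume (recurrent K \ E) ≠ ⊤ := ((measure_mono (sdiff_subset.trans
    (recurrent_subset_core.trans core_subset))).trans_lt D.volume_lt_top).ne
  have hF : NullMeasurableSet (recurrent K \ E) := measurableSet_recurrent.nullMeasurableSet.diff hE
  have hQ : ENNReal.ofReal (distortion r ^ 8) * volume (core K) ≠ ⊤ := ENNReal.mul_ne_top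
    ENNReal.ofReal_ne_top ((measure_mono core_subset).trans_lt D.volume_lt_top).ne
  have key : ∀ ε : ℝ≥0∞, ε ≠ 0 → volume (recurrent K \ E) * volume B ≤
      ENNReal.ofReal (distortion r ^ 8) * volume (core K) * ε := by
    intro ε hε
    obtain ⟨U, hFU, hU, hUε⟩ := Set.exists_isOpen_le_add (recurrent K \ E) volume hε
    obtain ⟨M, hM, hMd, hMc⟩ := D.exists_disjoint_full_cover hU
    have hMb : M.PairwiseDisjoint fun w => branch K w B := hMd.mono fun w => inter_subset_left
    have hsub : ⋃ w ∈ M, branch K w B ⊆ U \ (recurrent K \ E) := iUnion₂_subset fun w hw x hx =>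
      ⟨(hM w hw).2 hx.1, fun h => h.2 (hinv w x hx.1 (hBE hx.2).1)⟩
    calc volume (recurrent K \ E) * volume B ≤ volume (⋃ w ∈ M, orb K w) * volume B := by
          gcongr; exact fun x hx => hMc ⟨hx.1, hFU hx⟩
      _ = ∑' w : M, volume (orb K w) * volume B := by
          rw [measure_biUnion (to_countable M) hMd fun w _ => measurableSet_orb w,
            ENNReal.tsum_mul_right]
      _ ≤ ∑' w : M, ENNReal.ofReal (distortion r ^ 8) * volume (core K) * volume (branch K w B) :=
          ENNReal.tsum_le_tsum fun w =>
            D.volume_orb_mul_le (hM w w.2).1 hB (hBE.trans inter_subset_right)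
      _ = ENNReal.ofReal (distortion r ^ 8) * volume (core K) * volume (⋃ w ∈ M, branch K w B) := by
          rw [measure_biUnion (to_countable M) hMb fun w _ => measurableSet_branch w hB, ENNReal.tsum_mul_left]
      _ ≤ _ := by
          gcongr
          refine (measure_mono hsub).trans ?_
          rw [measure_sdiff hFU hF hFfin]
          exact tsub_le_iff_left.mpr hUε
  have h0 : volume (recurrent K \ E) * volume B ≤ 0 := by
    have ht := ENNReal.Tendsto.const_mul ENNReal.tendsto_inv_nat_nhds_zero (Or.inr hQ)
    rw [mul_zero] at ht
    exact ge_of_tendsto' ht fun n => key _ (by simp)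
  simpa [hB0] using h0

/-- A measurable set that is invariant under the Gauss map is null or has full measure. -/
theorem volume_inter_core_eq_zero_or {E : Set Heis} (hE : NullMeasurableSet E)
    (hinv : ∀ g : integers, ∀ x ∈ core K, act (step g) x ∈ core K → (act (step g) x ∈ E ↔ x ∈ E)) :
    volume (E ∩ core K) = 0 ∨ volume (Eᶜ ∩ core K) = 0 := by
  have hw : ∀ w x, x ∈ orb K w → (act (mat w) x ∈ E ↔ x ∈ E) := by
    intro w
    induction w with
    | nil => intro x _; rw [mat, act_one]
    | cons g w ih =>
      intro x hx
      rw [act_cons g w hx.1.2, ih _ hx.2]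
      exact hinv g x hx.1 (orb_subset_core w hx.2)
  by_contra! h
  have h1 := D.volume_recurrent_diff_eq_zero hE (fun w x hx => (hw w x hx).mp) h.1
  have h2 := D.volume_recurrent_diff_eq_zero hE.compl (fun w x hx => mt (hw w x hx).mpr) h.2
  -- Almost every recurrent point would lie both in `E` and in its complement.
  refine D.volume_recurrent_pos.ne' (le_antisymm ?_ zero_le)
  calc _ ≤ volume (recurrent K \ E ∪ recurrent K \ Eᶜ) :=
        measure_mono fun x hx => by by_cases hxE : x ∈ E <;> simp [hx]
    _ ≤ _ := (measure_union_le _ _).trans (by rw [h1, h2, add_zero])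

end IsSmallDomain
end

section

variable {K : Set Heis} {r : ℝ}

/-! ### The Gauss map -/

/-- `K` is only known to be null measurable, so null sets of the subtype are compared through
measurable supersets. -/
theorem comap_val_eq_zero_iff {ν : Measure Heis} (hK : NullMeasurableSet K ν) {s : Set K} :
    ν.comap Subtype.val s = 0 ↔ ν (Subtype.val '' s) = 0 := by
  refine ⟨Measure.measure_subtype_coe_eq_zero_of_comap_eq_zero hK, fun h => ?_⟩
  obtain ⟨t, hst, ht, ht0⟩ := exists_measurable_superset_of_null h
  refine measure_mono_null (t := Subtype.val ⁻¹' t) (image_subset_iff.mp hst) ?_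
  rw [Measure.comap_preimage _ _ Subtype.val_injective measurable_subtype_coe
    (fun _ => Measure.MeasurableSet.nullMeasurableSet_subtype_coe hK) ht]
  exact measure_mono_null inter_subset_left ht0

namespace IsSmallDomain

variable (D : IsSmallDomain K r)
include D

theorem nullMeasurableSet_gaussMeasure : NullMeasurableSet K (gaussMeasure K r) :=
  D.nullMeasurableSet.mono_ac gaussMeasure_absolutelyContinuous

theorem gaussMap_of_mem_orb {g : integers} {x : K} (hx : (x : Heis) ∈ orb K [g]) :
    (gaussMap D.dom x : Heis) = act (step g) x := by
  have h1 : (x : Heis) ≠ 1 := generic_ne_one hx.1.2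
  have h2 : act (step g) x = (g : Heis)⁻¹ * inversion x := act_step g h1
  have h3 : (g : Heis)⁻¹ * inversion x ∈ K := h2 ▸ core_subset (orb_subset_core [] hx.2)
  rw [h2]
  exact congrArg (fun a : Heis => a⁻¹ * inversion x)
    (floor_eq D.dom g.2 ⟨_, h3, mul_inv_cancel_left _ _⟩)

theorem comap_gaussMeasure_absolutelyContinuous :
    (gaussMeasure K r).comap (Subtype.val : K → Heis) ≪ volume.comap Subtype.val := fun s hs => by
  rw [comap_val_eq_zero_iff D.nullMeasurableSet] at hs
  rw [comap_val_eq_zero_iff D.nullMeasurableSet_gaussMeasure]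
  exact gaussMeasure_absolutelyContinuous hs

theorem absolutelyContinuous_comap_gaussMeasure :
    volume.comap (Subtype.val : K → Heis) ≪ (gaussMeasure K r).comap Subtype.val := by
  refine Measure.AbsolutelyContinuous.mk fun s hs h0 => ?_
  rw [comap_val_eq_zero_iff D.nullMeasurableSet_gaussMeasure] at h0
  rw [comap_val_eq_zero_iff D.nullMeasurableSet]
  obtain ⟨B, hB, rfl⟩ := hs
  rw [Subtype.image_preimage_coe] at h0 ⊢
  obtain ⟨c, hc, h⟩ := D.exists_le_gaussMeasure
  have h1 : c * volume (B ∩ core K) ≤ 0 := (h _ (hB.inter measurableSet_core) inter_subset_right).trans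
    ((measure_mono (t := K ∩ B) fun x hx => ⟨core_subset hx.2, hx.1⟩).trans_eq h0)
  have h2 : volume (B ∩ core K) = 0 := by simpa [hc] using h1
  refine measure_mono_null (t := B ∩ core K ∪ K \ core K) (fun x hx => ?_)
    (measure_union_null h2 D.volume_diff_core)
  by_cases hxc : x ∈ core K
  · exact Or.inl ⟨hx.2, hxc⟩
  · exact Or.inr ⟨hx.1, hxc⟩

theorem ae_comap_gaussMeasure_of_volume {A : Set Heis} (hA : volume (A ∩ core K) = 0) :
    ∀ᵐ x : K ∂(gaussMeasure K r).comap Subtype.val, (x : Heis) ∉ A := by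
  refine (comap_val_eq_zero_iff D.nullMeasurableSet_gaussMeasure).mpr ?_
  refine measure_mono_null (t := A ∩ core K ∪ (core K)ᶜ) ?_
    (measure_union_null (gaussMeasure_absolutelyContinuous hA) gaussMeasure_compl_core)
  rintro _ ⟨x, hx, rfl⟩
  by_cases hxc : (x : Heis) ∈ core K
  · exact Or.inl ⟨not_not.mp hx, hxc⟩
  · exact Or.inr hxc

theorem ae_exists_mem_orb :
    ∀ᵐ x : K ∂(gaussMeasure K r).comap Subtype.val, ∃ g, (x : Heis) ∈ orb K [g] := by
  have h := D.ae_comap_gaussMeasure_of_volume (A := {x | ¬ ∃ g, x ∈ orb K [g]}) <| by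
    exact measure_mono_null (t := {x | ¬ ∀ w, x ∈ orb K w → ∃ g, x ∈ orb K (w ++ [g])})
      (fun x hx h => hx.1 (h [] hx.2)) (ae_iff.mp D.ae_exists_next)
  filter_upwards [h] with x hx using not_not.mp hx

/-- Almost every point has a digit along which it stays in the core, and by uniqueness this is the
digit used by `gaussMap`. -/
theorem preimage_gaussMap_ae_eq (B : Set Heis) :
    gaussMap D.dom ⁻¹' (Subtype.val ⁻¹' B) =ᵐ[(gaussMeasure K r).comap Subtype.val]
      (Subtype.val ⁻¹' gaussPreimage K B : Set K) := by
  refine Filter.eventuallyEq_set.mpr ?_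
  filter_upwards [D.ae_exists_mem_orb] with x hx
  obtain ⟨g, hg⟩ := hx
  have e : act (mat [g]) x = act (step g) x := by rw [mat, mat, one_mul]
  rw [mem_preimage, mem_preimage, D.gaussMap_of_mem_orb hg, mem_preimage, gaussPreimage, mem_iUnion]
  constructor
  · exact fun h => ⟨g, hg, by rwa [mem_preimage, e]⟩
  · rintro ⟨h, hh⟩
    have := D.orb_unique (w := [g]) (v := [h]) rfl hg hh.1
    rw [← this] at hh
    rw [← e]
    exact hh.2

theorem comap_gaussMeasure_preimage {B : Set Heis} (hB : MeasurableSet B) :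
    (gaussMeasure K r).comap (Subtype.val : K → Heis) (Subtype.val ⁻¹' B) = gaussMeasure K r B := by
  rw [Measure.comap_preimage _ _ Subtype.val_injective measurable_subtype_coe
    (fun _ => Measure.MeasurableSet.nullMeasurableSet_subtype_coe D.nullMeasurableSet_gaussMeasure) hB,
    Subtype.range_coe]
  refine measure_inter_conull (measure_mono_null ?_ gaussMeasure_compl_core)
  exact fun x hx h => hx (core_subset h)

/-- Invariance on measurable sets shows that null sets pull back to null sets, which extends
measurability and invariance to the completion. -/
theorem nullMeasurableSet_preimage_gaussMap {s : Set K}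
    (hs : NullMeasurableSet s ((gaussMeasure K r).comap Subtype.val)) :
    NullMeasurableSet (gaussMap D.dom ⁻¹' s) ((gaussMeasure K r).comap Subtype.val) ∧
      (gaussMeasure K r).comap Subtype.val (gaussMap D.dom ⁻¹' s) =
        (gaussMeasure K r).comap Subtype.val s := by
  set μ := (gaussMeasure K r).comap (Subtype.val : K → Heis)
  have key : ∀ t : Set K, MeasurableSet t → NullMeasurableSet (gaussMap D.dom ⁻¹' t) μ ∧
      μ (gaussMap D.dom ⁻¹' t) = μ t := by
    rintro _ ⟨B, hB, rfl⟩
    have h := D.preimage_gaussMap_ae_eq B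
    refine ⟨(measurable_subtype_coe (measurableSet_gaussPreimage hB)).nullMeasurableSet.congr h.symm, ?_⟩
    rw [measure_congr h, D.comap_gaussMeasure_preimage (measurableSet_gaussPreimage hB),
      D.comap_gaussMeasure_preimage hB, D.gaussMeasure_gaussPreimage hB]
  obtain ⟨t, hst, ht, hts⟩ := hs.exists_measurable_superset_ae_eq
  obtain ⟨n, hn, hnm, hn0⟩ := exists_measurable_superset_of_null (ae_le_set.mp hts.le)
  have h0 : μ (gaussMap D.dom ⁻¹' t \ gaussMap D.dom ⁻¹' s) = 0 :=
    measure_mono_null (t := gaussMap D.dom ⁻¹' n) (fun x hx => hn hx) ((key n hnm).2.trans hn0)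
  have h1 : gaussMap D.dom ⁻¹' t =ᵐ[μ] gaussMap D.dom ⁻¹' s :=
    (ae_le_set.mpr h0).antisymm (preimage_mono hst).eventuallyLE
  exact ⟨(key t ht).1.congr h1, by rw [← measure_congr h1, (key t ht).2, measure_congr hts]⟩

theorem eventuallyConst_of_preimage_gaussMap_eq {s : Set K}
    (hs : NullMeasurableSet s ((gaussMeasure K r).comap Subtype.val))
    (hinv : gaussMap D.dom ⁻¹' s = s) :
    Filter.EventuallyConst s (ae ((gaussMeasure K r).comap Subtype.val)) := by
  have hE : NullMeasurableSet (Subtype.val '' s : Set Heis) :=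
    Measure.NullMeasurableSet.subtype_coe D.nullMeasurableSet
      (hs.mono_ac D.absolutelyContinuous_comap_gaussMeasure)
  have hmem : ∀ x : K, (x : Heis) ∈ (Subtype.val '' s : Set Heis) ↔ x ∈ s := fun x =>
    Subtype.val_injective.mem_set_image
  have hor := D.volume_inter_core_eq_zero_or hE fun g x hx hgx => by
    rw [← D.gaussMap_of_mem_orb (g := g) (x := ⟨x, core_subset hx⟩) ⟨hx, hgx⟩, hmem,
      hmem ⟨x, core_subset hx⟩, ← mem_preimage, hinv]
  rw [Filter.eventuallyConst_set]
  rcases hor with h | h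
  · right
    filter_upwards [D.ae_comap_gaussMeasure_of_volume h] with x hx
    rwa [← hmem]
  · left
    filter_upwards [D.ae_comap_gaussMeasure_of_volume h] with x hx
    rwa [← hmem, ← not_not (a := _ ∈ _)]

theorem ergodic_gaussMap : Ergodic
    (α := NullMeasurableSpace K ((gaussMeasure K r).comap (Subtype.val : K → Heis)))
    (gaussMap D.dom) ((gaussMeasure K r).comap (Subtype.val : K → Heis)).completion where
  measurable s hs := (D.nullMeasurableSet_preimage_gaussMap hs).1
  map_eq := by
    refine Measure.ext fun s hs => ?_
    rw [Measure.map_apply (fun s hs => (D.nullMeasurableSet_preimage_gaussMap hs).1) hs,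
      Measure.coe_completion]
    exact (D.nullMeasurableSet_preimage_gaussMap hs).2
  aeconst_set s hs hinv := D.eventuallyConst_of_preimage_gaussMap_eq hs hinv

theorem isFiniteMeasure_comap_gaussMeasure :
    IsFiniteMeasure ((gaussMeasure K r).comap (Subtype.val : K → Heis)) := by
  have := D.isFiniteMeasure_gaussMeasure
  refine ⟨?_⟩
  rw [← preimage_univ (f := Subtype.val), D.comap_gaussMeasure_preimage MeasurableSet.univ]
  exact measure_lt_top _ _

end IsSmallDomain
end

end Heis

end

theorem theorem4p9 (K : Set Heis) (hK : Heis.IsFundamentalDomain K) (hrad : Heis.rad K < 1) :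
    ∃ μ : Measure K, IsFiniteMeasure μ ∧
      μ ≪ (volume : Measure Heis).comap (↑) ∧ (volume : Measure Heis).comap (↑) ≪ μ ∧
      Ergodic (α := NullMeasurableSpace K μ) (Heis.gaussMap hK) μ.completion := by
  obtain ⟨r, D⟩ := Heis.exists_isSmallDomain hK hrad
  exact ⟨(Heis.gaussMeasure K r).comap (↑), D.isFiniteMeasure_comap_gaussMeasure,
    D.comap_gaussMeasure_absolutelyContinuous, D.absolutelyContinuous_comap_gaussMeasure,
    D.ergodic_gaussMap⟩
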